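/- **Setting.** Let $\mathcal H$ be an infinite-dimensional separable complex Hilbert space and let $\mathcal I$ be the set of bounded intervals $I=(a,b)$, $a<b$; put $|I|=\sup\{|x|:x\in I\}$. A *graded translation-covariant net* consists of von Neumann algebras $\mathcal A(I)\subset B(\mathcal H)$, $I\in\mathcal I$, with $\mathcal A(I)\subset\mathcal A(J)$ if $I\subset J$; a selfadjoint unitary $\Gamma\ne\mathbf 1$ with $\Gamma\mathcal A(I)\Gamma=\mathcal A(I)$; and a strongly continuous unitary group $e^{itP}$ commuting with $\Gamma$, with $P\ge 0$ and $e^{itP}\mathcal A(I)e^{-itP}=\mathcal A(t+I)$, such that, for $\gamma=\operatorname{Ad}\Gamma$ and $\alpha_t=\operatorname{Ad}e^{itP}$, the graded commutator $[x,\alpha_t(y)]$ tends to $0$ in norm as $t\to\infty$ for all $x,y\in\mathcal A(I)$. Let $\mathfrak A$ be the norm closure of $\bigcup_I\mathcal A(I)$. For a set $E$ write $E_I=E\cap\mathcal A(I)$ and $E_c=\bigcup_I E_I$. All *-algebras are unital. A *superderivation* is a linear map $\delta:\operatorname{dom}(\delta)\to\mathfrak A$ on an $\alpha$-$\gamma$-invariant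 *-subalgebra $\operatorname{dom}(\delta)\subset\mathfrak A$ with $\alpha_t\delta=\delta\alpha_t$, $\gamma\delta=-\delta\gamma$, $\delta(x^*)=\gamma(\delta(x)^*)$, $\delta(xy)=\delta(x)y+\gamma(x)\delta(y)$, such that for every $I$ the restriction $\delta_I$ of $\delta$ to $\operatorname{dom}(\delta)_I$ has image in $\mathcal A(I)$, is ($\sigma$-weakly)-($\sigma$-weakly) closed, and both $\operatorname{dom}(\delta)_I$ and $C^\infty(\delta)_I=\bigcap_n\operatorname{dom}(\delta_I^n)$ are $\sigma$-weakly dense in $\mathcal A(I)$. Let $C^\infty(\delta)_c=\bigcup_I C^\infty(\delta)_I$ and let $C^\infty(\delta)_c^\gamma$ be the *-algebra of its $\gamma$-fixed points. Then $(\mathfrak A,\gamma,(\alpha_t)_{t\in\mathbb R},\delta)$ is called a graded quantum dynamical system. Let $\Delta_n=\{s\in\mathbb R^n:0\le s_1\le\dots\le s_n\le1\}$ and $\mathcal T^n=\{z\in\mathbb C^n:\Im z\in\Delta_n\}$. "Analytic continuation to $\mathcal T^n$" of a function on $\mathbb R^n$ means a function that is continuous on $\mathcal T^n$, analytic in its interior,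 and equal to the given one on $\mathbb R^n$. A *super-KMS (sKMS) functional* is a linear functional $\phi$ on an $\alpha$-$\gamma$-invariant *-subalgebra $\operatorname{dom}(\phi)\subset\mathfrak A$, containing $C^\infty(\delta)_c$, such that - $(S_0)$ $\phi(x^*)=\overline{\phi(x)}$, and $\operatorname{dom}(\phi)_I$ is $\sigma$-weakly dense in $\mathcal A(I)$ for all $I$; - $(S_1)$ for every $I$, $\phi|_{\operatorname{dom}(\phi)_I}$ is bounded and extends to a $\sigma$-weakly continuous linear functional on $\mathcal A(I)$; - $(S_2)$ for all $x,y\in\operatorname{dom}(\phi)$ there is a continuous function $F$ on $\mathcal T^1$, analytic in the interior, with $F(t)=\phi(x\alpha_t(y))$ and $F(t+i)=\phi(\alpha_t(y)\gamma(x))$ for $t\in\mathbb R$, and $|F(z)|\le C_0(1+|\Re z|)^{p_0}$ on $\mathcal T^1$ for some $C_0>0$, $p_0\in2\mathbb N$; - $(S_3)$ $\phi(\mathbf 1)=1$; - $(S_4)$ $\operatorname{im}(\delta_I)\subset\operatorname{dom}(\phi)_I$ for all $I$, and $\phi\circ\delta=0$ on $C^\infty(\delta)_c$; - $(S_5)$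 $\phi(x\delta^2(y)z)=-i\frac{d}{dt}\phi(x\alpha_t(y)z)|_{t=0}$ for $x,z\in\operatorname{dom}(\phi)_c$, $y\in C^\infty(\delta)_c$. It is *local-exponentially bounded*, with constants $C_1,C_2>0$, if $\|\phi|_{\operatorname{dom}(\phi)_I}\|\le C_1e^{C_2|I|^2}$ for all $I\in\mathcal I$. On $A=C^\infty(\delta)^\gamma_c$ with the graph norm $\|x\|_*=\|x\|+\|\delta(x)\|$, a *local-entire cochain* is a sequence $(\rho_n)_{n\ge0}$ of $(n+1)$-linear forms on $A$ with $\rho_n(x_0,\dots,x_n)=0$ if some $x_i\in\mathbb C\mathbf 1$, $i\ge1$, and $\lim_{n\to\infty}n^{1/2}\|\rho_n|_{A\cap\mathcal A(I)}\|_*^{1/n}=0$ for all $I\in\mathcal I$, where $\|\cdot\|_*$ of a multilinear form is the supremum of $|\rho_n(x_0,\dots,x_n)|/(\|x_0\|_*\cdots\|x_n\|_*)$. It is *even* if $\rho_n=0$ for all odd $n$, and a *local-entire cyclic cocycle* if $(B+b)\rho=0$, where $$(b\rho)_n(x_0,\dots,x_n)=\sum_{j=0}^{n-1}(-1)^j\rho_{n-1}(x_0,\dots,x_jx_{j+1},\dots,x_n)+(-1)^n\rho_{n-1}(x_nx_0,x_1,\dots,x_{n-1}),$$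 $$(B\rho)_n(x_0,\dots,x_n)=\sum_{j=0}^n(-1)^{nj}\rho_{n+1}(\mathbf 1,x_j,\dots,x_n,x_0,\dots,x_{j-1}),\qquad (b\rho)_0=0.$$ **Theorem.** Let $\phi$ be a local-exponentially bounded sKMS functional, with constants $C_1,C_2$, for the graded quantum dynamical system $(\mathfrak A,\gamma,(\alpha_t)_{t\in\mathbb R},\delta)$. 1. For every even $n$ and all $x_0,\dots,x_n\in C^\infty(\delta)_c^\gamma$, the integrals $$\int_{\Delta_n}\phi\big(x_0\,\alpha_{s_1t}(\delta(x_1))\cdots\alpha_{s_nt}(\delta(x_n))\big)\,d^ns,\qquad t\in\mathbb R,$$ exist, and as a function of $t$ they have a unique analytic continuation to $\mathcal T^1$. Let $\tau_n(x_0,\dots,x_n)$ be its value at $t=i$, and let $\tau_n=0$ for odd $n$. 2. $(\tau_n)_{n\ge0}$ is an even local-entire cyclic cocycle on $C^\infty(\delta)_c^\gamma$ with respect to the graph norm. 3. For all $I\in\mathcal I$, $n\ge0$ and $x_0,\dots,x_n\in\operatorname{dom}(\phi)_I$, the function $s\mapsto\phi(x_0\alpha_{s_1}(x_1)\cdots\alpha_{s_n}(x_n))$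 on $\mathbb R^n$ has a unique analytic continuation $F$ to $\mathcal T^n$, and $$|F(z)|\le C_1\,e^{2C_2(|I|+1)^2(n+1)}\,e^{2C_2(|I|+1)\sum_{k=1}^n|z_k|^2}\,\|x_0\|\cdots\|x_n\|,\qquad z\in\mathcal T^n.$$ -/

import Mathlib

open MeasureTheory Filter Topology
open scoped ComplexConjugate ENNReal InnerProductSpace

noncomputable section

/-! ### Bounded open intervals -/

/-- Nontrivial bounded open intervals `(left, right)` of the real line. -/
structure BddInterval where
  left : ℝ
  right : ℝ
  lt : left < right

namespace BddInterval

/-- The underlying set of points. -/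
def toSet (I : BddInterval) : Set ℝ := Set.Ioo I.left I.right

/-- The translated interval `t + I`. -/
def translate (t : ℝ) (I : BddInterval) : BddInterval :=
  ⟨t + I.left, t + I.right, by linarith [I.lt]⟩

/-- `|I| = sup {|x| : x ∈ I}`. -/
def radius (I : BddInterval) : ℝ := sSup ((fun x : ℝ => |x|) '' I.toSet)

/-- An interval that contains two given ones. -/
def hull (I J : BddInterval) : BddInterval :=
  ⟨min I.left J.left, max I.right J.right,
    lt_of_le_of_lt (min_le_left _ _) (lt_of_lt_of_le I.lt (le_max_left _ _))⟩

theorem subset_hull_left (I J : BddInterval) : I.toSet ⊆ (I.hull J).toSet :=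
  Set.Ioo_subset_Ioo (min_le_left _ _) (le_max_left _ _)

theorem subset_hull_right (I J : BddInterval) : J.toSet ⊆ (I.hull J).toSet :=
  Set.Ioo_subset_Ioo (min_le_right _ _) (le_max_right _ _)

end BddInterval

section Operators

variable (H : Type*) [NormedAddCommGroup H] [InnerProductSpace ℂ H] [CompleteSpace H]

/-- The σ-weak (ultraweak) topology on `B(H)`: the coarsest one for which all functionals
`x ↦ ∑ₙ ⟪ξₙ, x ηₙ⟫` with `∑ ‖ξₙ‖² < ∞` and `∑ ‖ηₙ‖² < ∞` are continuous. -/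
abbrev sigmaWeak : TopologicalSpace (H →L[ℂ] H) :=
  ⨅ p : {p : (ℕ → H) × (ℕ → H) //
      Summable (fun n => ‖p.1 n‖ ^ 2) ∧ Summable (fun n => ‖p.2 n‖ ^ 2)},
    TopologicalSpace.induced (fun x : H →L[ℂ] H => ∑' n, ⟪p.1.1 n, x (p.1.2 n)⟫_ℂ) inferInstance

variable {H}

/-- `S` is σ-weakly dense in `T`. -/
def SigmaWeaklyDenseIn (S T : Set (H →L[ℂ] H)) : Prop :=
  S ⊆ T ∧ T ⊆ @closure _ (sigmaWeak H) S

/-- A linear map between spaces of operators, with domain `E` and graph restricted to arguments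
in `M`, is (σ-weakly)-(σ-weakly) closed. -/
def SigmaWeaklyClosedOn (E : StarSubalgebra ℂ (H →L[ℂ] H)) (d : E →ₗ[ℂ] (H →L[ℂ] H))
    (M : Set (H →L[ℂ] H)) : Prop :=
  @IsClosed ((H →L[ℂ] H) × (H →L[ℂ] H))
    (@instTopologicalSpaceProd _ _ (sigmaWeak H) (sigmaWeak H))
    {p | ∃ x : E, (x : H →L[ℂ] H) ∈ M ∧ p = ((x : H →L[ℂ] H), d x)}

/-- `iterDom d M n` is the domain of the `n`-th power of the restriction of `d` to `M`. -/
def iterDom (E : StarSubalgebra ℂ (H →L[ℂ] H)) (d : E →ₗ[ℂ] (H →L[ℂ] H))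
    (M : Set (H →L[ℂ] H)) : ℕ → Set (H →L[ℂ] H)
  | 0 => M
  | n + 1 => {x | x ∈ M ∧ ∃ h : x ∈ E, d ⟨x, h⟩ ∈ iterDom E d M n}

/-- The elements of `M` that lie in the domains of all powers of `d` restricted to `M`. -/
def smoothOn (E : StarSubalgebra ℂ (H →L[ℂ] H)) (d : E →ₗ[ℂ] (H →L[ℂ] H))
    (M : Set (H →L[ℂ] H)) : Set (H →L[ℂ] H) :=
  ⋂ n, iterDom E d M n

/-- The graded commutator `[x, y]` for the grading `γ(x) = Γ x Γ`: it is `x y - y x` if `x` or `y`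
is even, and `x y + y x` if both are odd. -/
def gradedCommutator (Γ x y : H →L[ℂ] H) : H →L[ℂ] H :=
  x * y + (1 / 4 : ℂ) • ((y - Γ * y * Γ) * (x - Γ * x * Γ))
    - (1 / 4 : ℂ) • ((y + Γ * y * Γ) * (x - Γ * x * Γ))
    - (1 / 4 : ℂ) • ((y - Γ * y * Γ) * (x + Γ * x * Γ))
    - (1 / 4 : ℂ) • ((y + Γ * y * Γ) * (x + Γ * x * Γ))

end Operators

/-! ### Graded translation-covariant nets -/

section Systems

variable (H : Type*) [NormedAddCommGroup H] [InnerProductSpace ℂ H] [CompleteSpace H]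

/-- A graded translation-covariant net of von Neumann algebras over `ℝ`, acting on `H`. The
unitary group `U t = exp (i t P)` encodes its self-adjoint generator `P`. -/
structure GradedNet where
  alg : BddInterval → VonNeumannAlgebra H
  isotony : ∀ I J : BddInterval, I.toSet ⊆ J.toSet →
    (alg I : Set (H →L[ℂ] H)) ⊆ (alg J : Set (H →L[ℂ] H))
  Γ : H →L[ℂ] H
  Γ_star : star Γ = Γ
  Γ_sq : Γ * Γ = 1
  Γ_ne_one : Γ ≠ 1
  grading : ∀ I : BddInterval,
    (fun x => Γ * x * Γ) '' (alg I : Set (H →L[ℂ] H)) = (alg I : Set (H →L[ℂ] H))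
  U : ℝ → (H →L[ℂ] H)
  U_zero : U 0 = 1
  U_add : ∀ s t, U (s + t) = U s * U t
  U_star : ∀ t, star (U t) = U (-t)
  U_continuous : ∀ ξ : H, Continuous fun t => U t ξ
  U_Γ : ∀ t, U t * Γ = Γ * U t
  covariance : ∀ (t : ℝ) (I : BddInterval),
    (fun x => U t * x * U (-t)) '' (alg I : Set (H →L[ℂ] H))
      = (alg (I.translate t) : Set (H →L[ℂ] H))
  /-- `lim [x, α_t(y)] = 0` in norm as `t → ∞`, for the graded commutator. -/
  asymptotically_graded_abelian : ∀ (I : BddInterval) (x y : H →L[ℂ] H), x ∈ alg I → y ∈ alg I →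
    Tendsto (fun t : ℝ => gradedCommutator Γ x (U t * y * U (-t)))
      atTop (𝓝 0)
  /-- `⟪ξ, P ξ⟫ ≥ 0` for all `ξ` in the domain of `P`, where `P ξ = -i (d/dt) U t ξ` at `0`. -/
  positive_energy : ∀ ξ η : H, HasDerivAt (fun t : ℝ => U t ξ) (Complex.I • η) 0 →
    0 ≤ (⟪ξ, η⟫_ℂ).re

variable {H}

namespace GradedNet

variable (N : GradedNet H)

/-- The grading automorphism `γ = Ad Γ`. -/
def γ (x : H →L[ℂ] H) : H →L[ℂ] H := N.Γ * x * N.Γ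

/-- The translation automorphisms `α_t = Ad U(t)`. -/
def α (t : ℝ) (x : H →L[ℂ] H) : H →L[ℂ] H := N.U t * x * N.U (-t)

/-- The quasi-local C*-algebra: the norm closure of the union of all local algebras, which is the
C*-direct limit of this directed family of C*-algebras on `H`. -/
def quasiLocal : Set (H →L[ℂ] H) := closure (⋃ I, (N.alg I : Set (H →L[ℂ] H)))

theorem γ_mem {I : BddInterval} {x : H →L[ℂ] H} (hx : x ∈ N.alg I) : N.γ x ∈ N.alg I := by
  have : N.γ x ∈ (fun x => N.Γ * x * N.Γ) '' (N.alg I : Set (H →L[ℂ] H)) := ⟨x, hx, rfl⟩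
  rw [N.grading] at this
  exact this

theorem γ_add (x y : H →L[ℂ] H) : N.γ (x + y) = N.γ x + N.γ y := by
  simp [γ, mul_add, add_mul]

theorem γ_mul (x y : H →L[ℂ] H) : N.γ (x * y) = N.γ x * N.γ y := by
  have h := N.Γ_sq
  calc N.γ (x * y) = N.Γ * x * 1 * y * N.Γ := by simp [γ, mul_assoc]
    _ = N.Γ * x * (N.Γ * N.Γ) * y * N.Γ := by rw [h]
    _ = _ := by simp only [γ, mul_assoc]

theorem γ_star (x : H →L[ℂ] H) : N.γ (star x) = star (N.γ x) := by
  simp [γ, N.Γ_star, mul_assoc]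

theorem γ_one : N.γ 1 = 1 := by simp [γ, N.Γ_sq]

theorem γ_smul (c : ℂ) (x : H →L[ℂ] H) : N.γ (c • x) = c • N.γ x := by
  simp [γ]

end GradedNet

/-! ### Superderivations -/

/-- A superderivation on the quasi-local algebra of a net; together with the net, its grading and
its translations this is a graded quantum dynamical system. -/
structure Superderivation (N : GradedNet H) where
  dom : StarSubalgebra ℂ (H →L[ℂ] H)
  dom_subset : (dom : Set (H →L[ℂ] H)) ⊆ N.quasiLocal
  δ : dom →ₗ[ℂ] (H →L[ℂ] H)
  δ_mem : ∀ x, δ x ∈ N.quasiLocal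
  α_mem : ∀ (t : ℝ) (x : H →L[ℂ] H), x ∈ dom → N.α t x ∈ dom
  γ_mem : ∀ x : H →L[ℂ] H, x ∈ dom → N.γ x ∈ dom
  δ_α : ∀ (t : ℝ) (x : dom), N.α t (δ x) = δ ⟨N.α t x, α_mem t x x.2⟩
  δ_γ : ∀ x : dom, N.γ (δ x) = -δ ⟨N.γ x, γ_mem x x.2⟩
  δ_star : ∀ x : dom, δ (star x) = N.γ (star (δ x))
  δ_mul : ∀ x y : dom, δ (x * y) = δ x * (y : H →L[ℂ] H) + N.γ x * δ y
  δ_local : ∀ (I : BddInterval) (x : dom), (x : H →L[ℂ] H) ∈ N.alg I → δ x ∈ N.alg I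
  dom_dense : ∀ I : BddInterval,
    SigmaWeaklyDenseIn ((dom : Set (H →L[ℂ] H)) ∩ N.alg I) (N.alg I : Set (H →L[ℂ] H))
  δ_closed : ∀ I : BddInterval, SigmaWeaklyClosedOn dom δ (N.alg I : Set (H →L[ℂ] H))
  smooth_dense : ∀ I : BddInterval,
    SigmaWeaklyDenseIn (smoothOn dom δ (N.alg I : Set (H →L[ℂ] H))) (N.alg I : Set (H →L[ℂ] H))

namespace Superderivation

variable {N : GradedNet H} (D : Superderivation N)

/-- The domain of the `n`-th power of `δ` restricted to the local algebra of `I`. -/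
def domPow (I : BddInterval) (n : ℕ) : Set (H →L[ℂ] H) :=
  iterDom D.dom D.δ (N.alg I : Set (H →L[ℂ] H)) n

theorem domPow_succ {I : BddInterval} {n : ℕ} {x : H →L[ℂ] H} :
    x ∈ D.domPow I (n + 1) ↔ x ∈ N.alg I ∧ ∃ h : x ∈ D.dom, D.δ ⟨x, h⟩ ∈ D.domPow I n :=
  Iff.rfl

theorem domPow_mono {I J : BddInterval} (h : I.toSet ⊆ J.toSet) (n : ℕ) :
    D.domPow I n ⊆ D.domPow J n := by
  induction n with
  | zero => exact N.isotony I J h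
  | succ n ih =>
    rintro x ⟨hx, hd, hδ⟩
    exact ⟨N.isotony I J h hx, hd, ih hδ⟩

theorem domPow_anti (I : BddInterval) (n : ℕ) : D.domPow I (n + 1) ⊆ D.domPow I n := by
  induction n with
  | zero => exact fun x hx => hx.1
  | succ n ih =>
    rintro x ⟨hx, hd, hδ⟩
    exact ⟨hx, hd, ih hδ⟩

theorem domPow_add (I : BddInterval) (n : ℕ) {x y : H →L[ℂ] H} (hx : x ∈ D.domPow I n)
    (hy : y ∈ D.domPow I n) : x + y ∈ D.domPow I n := by
  induction n generalizing x y with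
  | zero => exact (N.alg I).toStarSubalgebra.add_mem hx hy
  | succ n ih =>
    obtain ⟨hx, hd, hδ⟩ := hx
    obtain ⟨hy, hd', hδ'⟩ := hy
    refine ⟨(N.alg I).toStarSubalgebra.add_mem hx hy, add_mem hd hd', ?_⟩
    have := D.δ.map_add ⟨x, hd⟩ ⟨y, hd'⟩
    exact this ▸ ih hδ hδ'

theorem domPow_smul (I : BddInterval) (n : ℕ) (c : ℂ) {x : H →L[ℂ] H} (hx : x ∈ D.domPow I n) :
    c • x ∈ D.domPow I n := by
  induction n generalizing x with
  | zero => exact (N.alg I).toStarSubalgebra.smul_mem hx c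
  | succ n ih =>
    obtain ⟨hx, hd, hδ⟩ := hx
    refine ⟨(N.alg I).toStarSubalgebra.smul_mem hx c, SMulMemClass.smul_mem c hd, ?_⟩
    have := D.δ.map_smul c ⟨x, hd⟩
    exact this ▸ ih hδ

theorem domPow_γ (I : BddInterval) (n : ℕ) {x : H →L[ℂ] H} (hx : x ∈ D.domPow I n) :
    N.γ x ∈ D.domPow I n := by
  induction n generalizing x with
  | zero => exact N.γ_mem hx
  | succ n ih =>
    obtain ⟨hx, hd, hδ⟩ := hx
    refine ⟨N.γ_mem hx, D.γ_mem x hd, ?_⟩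
    have h := D.δ_γ ⟨x, hd⟩
    have h' : D.δ ⟨N.γ x, D.γ_mem x hd⟩ = (-1 : ℂ) • N.γ (D.δ ⟨x, hd⟩) := by
      rw [h]; simp
    exact h' ▸ D.domPow_smul I n _ (ih hδ)

theorem domPow_star (I : BddInterval) (n : ℕ) {x : H →L[ℂ] H} (hx : x ∈ D.domPow I n) :
    star x ∈ D.domPow I n := by
  induction n generalizing x with
  | zero => exact star_mem (S := VonNeumannAlgebra H) (s := N.alg I) hx
  | succ n ih =>
    obtain ⟨hx, hd, hδ⟩ := hx
    refine ⟨star_mem (s := N.alg I) hx, star_mem hd, ?_⟩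
    have := D.δ_star ⟨x, hd⟩
    exact this ▸ D.domPow_γ I n (ih hδ)

theorem domPow_mul (I : BddInterval) (n : ℕ) {x y : H →L[ℂ] H} (hx : x ∈ D.domPow I n)
    (hy : y ∈ D.domPow I n) : x * y ∈ D.domPow I n := by
  induction n generalizing x y with
  | zero => exact (N.alg I).toStarSubalgebra.mul_mem hx hy
  | succ n ih =>
    have hx' := D.domPow_anti I n hx
    have hy' := D.domPow_anti I n hy
    obtain ⟨hx, hd, hδ⟩ := hx
    obtain ⟨hy, hd', hδ'⟩ := hy
    refine ⟨(N.alg I).toStarSubalgebra.mul_mem hx hy, mul_mem hd hd', ?_⟩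
    have := D.δ_mul ⟨x, hd⟩ ⟨y, hd'⟩
    exact this ▸ D.domPow_add I n (ih hδ hy') (ih (D.domPow_γ I n hx') hδ')

theorem δ_one : D.δ 1 = 0 := by
  have h := D.δ_mul 1 1
  rw [mul_one] at h
  simpa [N.γ_one] using h

theorem domPow_zero_mem (I : BddInterval) (n : ℕ) : (0 : H →L[ℂ] H) ∈ D.domPow I n := by
  induction n with
  | zero => exact zero_mem (N.alg I).toStarSubalgebra
  | succ n ih =>
    refine ⟨zero_mem (N.alg I).toStarSubalgebra, zero_mem D.dom, ?_⟩
    have h0 : D.δ ⟨0, zero_mem D.dom⟩ = 0 := D.δ.map_zero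
    change D.δ ⟨0, zero_mem D.dom⟩ ∈ D.domPow I n
    rw [h0]
    exact ih

theorem domPow_one_mem (I : BddInterval) (n : ℕ) : (1 : H →L[ℂ] H) ∈ D.domPow I n := by
  cases n with
  | zero => exact one_mem (N.alg I).toStarSubalgebra
  | succ n =>
    refine ⟨one_mem (N.alg I).toStarSubalgebra, one_mem D.dom, ?_⟩
    have : D.δ ⟨1, one_mem D.dom⟩ = 0 := D.δ_one
    exact this ▸ D.domPow_zero_mem I n

/-- `C^∞(δ)_I`, the elements of the local algebra of `I` in the domains of all powers of `δ`. -/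
def smoothLocal (I : BddInterval) : Set (H →L[ℂ] H) :=
  smoothOn D.dom D.δ (N.alg I : Set (H →L[ℂ] H))

theorem mem_smoothLocal {I : BddInterval} {x : H →L[ℂ] H} :
    x ∈ D.smoothLocal I ↔ ∀ n, x ∈ D.domPow I n := Set.mem_iInter

/-- Two elements that are smooth and local are so for a common interval. -/
theorem smoothLocal_common {x y : H →L[ℂ] H} (hx : ∃ I, x ∈ D.smoothLocal I)
    (hy : ∃ I, y ∈ D.smoothLocal I) : ∃ I, x ∈ D.smoothLocal I ∧ y ∈ D.smoothLocal I := by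
  obtain ⟨I, hI⟩ := hx
  obtain ⟨J, hJ⟩ := hy
  rw [mem_smoothLocal] at hI hJ
  exact ⟨I.hull J,
    D.mem_smoothLocal.2 fun n => D.domPow_mono (I.subset_hull_left J) n (hI n),
    D.mem_smoothLocal.2 fun n => D.domPow_mono (I.subset_hull_right J) n (hJ n)⟩

/-- The *-algebra `C^∞(δ)_c`, the union of all `C^∞(δ)_I`. -/
def smooth : StarSubalgebra ℂ (H →L[ℂ] H) where
  carrier := ⋃ I, D.smoothLocal I
  mul_mem' := by
    intro x y hx hy
    obtain ⟨I, hI, hJ⟩ := D.smoothLocal_common (Set.mem_iUnion.1 hx) (Set.mem_iUnion.1 hy)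
    rw [mem_smoothLocal] at hI hJ
    exact Set.mem_iUnion.2 ⟨I, D.mem_smoothLocal.2 fun n => D.domPow_mul I n (hI n) (hJ n)⟩
  add_mem' := by
    intro x y hx hy
    obtain ⟨I, hI, hJ⟩ := D.smoothLocal_common (Set.mem_iUnion.1 hx) (Set.mem_iUnion.1 hy)
    rw [mem_smoothLocal] at hI hJ
    exact Set.mem_iUnion.2 ⟨I, D.mem_smoothLocal.2 fun n => D.domPow_add I n (hI n) (hJ n)⟩
  algebraMap_mem' := by
    intro c
    refine Set.mem_iUnion.2 ⟨⟨0, 1, zero_lt_one⟩, D.mem_smoothLocal.2 fun n => ?_⟩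
    rw [Algebra.algebraMap_eq_smul_one]
    exact D.domPow_smul _ n c (D.domPow_one_mem _ n)
  star_mem' := by
    intro x hx
    obtain ⟨I, hI⟩ := Set.mem_iUnion.1 hx
    rw [mem_smoothLocal] at hI
    exact Set.mem_iUnion.2 ⟨I, D.mem_smoothLocal.2 fun n => D.domPow_star I n (hI n)⟩

theorem mem_smooth {x : H →L[ℂ] H} : x ∈ D.smooth ↔ ∃ I, x ∈ D.smoothLocal I := by
  change x ∈ ⋃ I, D.smoothLocal I ↔ _
  exact Set.mem_iUnion

theorem smooth_le_dom : D.smooth ≤ D.dom := by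
  intro x hx
  obtain ⟨I, hI⟩ := D.mem_smooth.1 hx
  exact (D.mem_smoothLocal.1 hI 1).2.1

theorem δ_mem_smooth {x : H →L[ℂ] H} (hx : x ∈ D.smooth) :
    D.δ ⟨x, D.smooth_le_dom hx⟩ ∈ D.smooth := by
  obtain ⟨I, hI⟩ := D.mem_smooth.1 hx
  exact D.mem_smooth.2 ⟨I, D.mem_smoothLocal.2 fun n => (D.mem_smoothLocal.1 hI (n + 1)).2.2⟩

theorem α_mem_smooth (t : ℝ) {x : H →L[ℂ] H} (hx : x ∈ D.smooth) : N.α t x ∈ D.smooth := by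
  have key : ∀ (I : BddInterval) (y : H →L[ℂ] H), y ∈ N.alg I →
      N.α t y ∈ N.alg (I.translate t) := by
    intro I y hy
    have : N.α t y ∈ (fun x => N.U t * x * N.U (-t)) '' (N.alg I : Set (H →L[ℂ] H)) := ⟨y, hy, rfl⟩
    rw [N.covariance] at this
    exact this
  obtain ⟨I, hI⟩ := D.mem_smooth.1 hx
  rw [mem_smoothLocal] at hI
  refine D.mem_smooth.2 ⟨I.translate t, D.mem_smoothLocal.2 fun n => ?_⟩
  have gen : ∀ (n : ℕ) (y : H →L[ℂ] H), y ∈ D.domPow I n →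
      N.α t y ∈ D.domPow (I.translate t) n := by
    intro n
    induction n with
    | zero => exact fun y hy => key I y hy
    | succ n ih =>
      rintro y ⟨hy, hd, hδ⟩
      refine ⟨key I y hy, D.α_mem t y hd, ?_⟩
      have := D.δ_α t ⟨y, hd⟩
      exact this ▸ ih _ hδ
  exact gen n x (hI n)

/-- `δ` as a map of `C^∞(δ)_c` into itself. -/
def δS (x : D.smooth) : D.smooth := ⟨D.δ ⟨x, D.smooth_le_dom x.2⟩, D.δ_mem_smooth x.2⟩

/-- `α_t` as a map of `C^∞(δ)_c` into itself. -/
def αS (t : ℝ) (x : D.smooth) : D.smooth := ⟨N.α t x, D.α_mem_smooth t x.2⟩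

/-- The *-algebra `C^∞(δ)_c^γ` of fixed points of `γ` in `C^∞(δ)_c`. -/
def evenSmooth : StarSubalgebra ℂ (H →L[ℂ] H) where
  carrier := {x | x ∈ D.smooth ∧ N.γ x = x}
  mul_mem' := fun hx hy => ⟨mul_mem hx.1 hy.1, by rw [N.γ_mul, hx.2, hy.2]⟩
  add_mem' := fun hx hy => ⟨add_mem hx.1 hy.1, by rw [N.γ_add, hx.2, hy.2]⟩
  algebraMap_mem' := fun c => ⟨D.smooth.algebraMap_mem c, by
    rw [Algebra.algebraMap_eq_smul_one, N.γ_smul, N.γ_one]⟩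
  star_mem' := fun hx => ⟨star_mem hx.1, by rw [N.γ_star, hx.2]⟩

/-- The inclusion of `C^∞(δ)_c^γ` into `C^∞(δ)_c`. -/
def toSmooth (x : D.evenSmooth) : D.smooth := ⟨x, x.2.1⟩

/-- The graph norm `‖x‖_* = ‖x‖ + ‖δ x‖` on `C^∞(δ)_c^γ`. -/
def graphNorm (x : D.evenSmooth) : ℝ :=
  ‖(x : H →L[ℂ] H)‖ + ‖(D.δS (D.toSmooth x) : H →L[ℂ] H)‖

end Superderivation

end Systems

/-! ### Analytic continuation into strips and tubes -/

/-- The closed strip `𝒯¹`, `0 ≤ Im z ≤ 1`. -/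
def strip : Set ℂ := {z | 0 ≤ z.im ∧ z.im ≤ 1}

/-- `F` is continuous on the closed strip, analytic inside, and equals `f` on the real line. -/
structure IsStripContinuation (f : ℝ → ℂ) (F : ℂ → ℂ) : Prop where
  continuousOn : ContinuousOn F strip
  analytic : DifferentiableOn ℂ F (interior strip)
  boundary : ∀ t : ℝ, F t = f t

open Classical in
/-- The value at `i` of the analytic continuation of `f` to the strip. It does not depend on the
chosen continuation as soon as continuations agree on the strip; it is `0` if there is none. -/
def analContAtI (f : ℝ → ℂ) : ℂ :=
  if h : ∃ F, IsStripContinuation f F then h.choose Complex.I else 0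

/-- The simplex `Δ_n = {0 ≤ s_1 ≤ ... ≤ s_n ≤ 1}`. -/
def orderSimplex (n : ℕ) : Set (Fin n → ℝ) :=
  {s | Monotone s ∧ ∀ i, 0 ≤ s i ∧ s i ≤ 1}

/-- The closed tube `𝒯ⁿ` of all `z ∈ ℂⁿ` with `Im z ∈ Δ_n`. -/
def tube (n : ℕ) : Set (Fin n → ℂ) := {z | (fun i => (z i).im) ∈ orderSimplex n}

/-- `F` is continuous on the closed tube, analytic inside, and equals `f` on `ℝⁿ`. -/
structure IsTubeContinuation {n : ℕ} (f : (Fin n → ℝ) → ℂ) (F : (Fin n → ℂ) → ℂ) : Prop where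
  continuousOn : ContinuousOn F (tube n)
  analytic : DifferentiableOn ℂ F (interior (tube n))
  boundary : ∀ s : Fin n → ℝ, F (fun i => (s i : ℂ)) = f s

/-! ### Super-KMS functionals -/

section SKMS

variable {H : Type*} [NormedAddCommGroup H] [InnerProductSpace ℂ H] [CompleteSpace H]

/-- A super-KMS functional for the graded quantum dynamical system given by `N` and `D`. -/
structure SKMSFunctional {N : GradedNet H} (D : Superderivation N) where
  dom : StarSubalgebra ℂ (H →L[ℂ] H)
  dom_subset : (dom : Set (H →L[ℂ] H)) ⊆ N.quasiLocal
  φ : dom →ₗ[ℂ] ℂ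
  α_mem : ∀ (t : ℝ) (x : H →L[ℂ] H), x ∈ dom → N.α t x ∈ dom
  γ_mem : ∀ x : H →L[ℂ] H, x ∈ dom → N.γ x ∈ dom
  hermitian : ∀ x : dom, φ (star x) = conj (φ x)
  dom_dense : ∀ I : BddInterval,
    SigmaWeaklyDenseIn ((dom : Set (H →L[ℂ] H)) ∩ N.alg I) (N.alg I : Set (H →L[ℂ] H))
  locally_bounded : ∀ I : BddInterval, ∃ C : ℝ, ∀ x : dom, (x : H →L[ℂ] H) ∈ N.alg I →
    ‖φ x‖ ≤ C * ‖(x : H →L[ℂ] H)‖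
  /-- The restriction to the local algebra of `I` extends to a σ-weakly continuous functional. -/
  locally_normal : ∀ I : BddInterval, ∃ ψ : (N.alg I).toStarSubalgebra →ₗ[ℂ] ℂ,
    @Continuous _ _ (TopologicalSpace.induced Subtype.val (sigmaWeak H)) inferInstance ψ ∧
    ∀ (x : dom) (hx : (x : H →L[ℂ] H) ∈ (N.alg I).toStarSubalgebra), ψ ⟨x, hx⟩ = φ x
  sKMS : ∀ x y : dom, ∃ F : ℂ → ℂ,
    ContinuousOn F strip ∧ DifferentiableOn ℂ F (interior strip) ∧
    (∀ t : ℝ, F t = φ (x * ⟨N.α t y, α_mem t y y.2⟩)) ∧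
    (∀ t : ℝ, F (t + Complex.I) = φ (⟨N.α t y, α_mem t y y.2⟩ * ⟨N.γ x, γ_mem x x.2⟩)) ∧
    ∃ (C₀ : ℝ) (p₀ : ℕ), 0 < C₀ ∧ Even p₀ ∧ ∀ z ∈ strip, ‖F z‖ ≤ C₀ * (1 + |z.re|) ^ p₀
  normalized : φ 1 = 1
  range_mem : ∀ (I : BddInterval) (x : D.dom), (x : H →L[ℂ] H) ∈ N.alg I → D.δ x ∈ dom
  /-- All expressions `φ(x α_t(y) z)` with `y ∈ C^∞(δ)_c` make sense. -/
  smooth_le : D.smooth ≤ dom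
  φ_δ : ∀ x : D.smooth, φ ⟨D.δS x, smooth_le (D.δS x).2⟩ = 0
  /-- `φ(x δ²(y) z) = -i (d/dt) φ(x α_t(y) z)` at `t = 0`, including differentiability. -/
  supersymmetry : ∀ x z : dom, (∃ I, (x : H →L[ℂ] H) ∈ N.alg I) →
    (∃ I, (z : H →L[ℂ] H) ∈ N.alg I) → ∀ y : D.smooth,
    HasDerivAt (fun t : ℝ => φ (x * ⟨D.αS t y, smooth_le (D.αS t y).2⟩ * z))
      (Complex.I * φ (x * ⟨D.δS (D.δS y), smooth_le (D.δS (D.δS y)).2⟩ * z)) 0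

namespace SKMSFunctional

variable {N : GradedNet H} {D : Superderivation N} (Φ : SKMSFunctional D)

/-- Local-exponential boundedness with constants `C₁`, `C₂`: the norm of `φ` restricted to
`dom(φ)_I` is at most `C₁ exp (C₂ |I|²)`. -/
def LocallyExpBounded (C₁ C₂ : ℝ) : Prop :=
  ∀ (I : BddInterval) (x : Φ.dom), (x : H →L[ℂ] H) ∈ N.alg I →
    ‖Φ.φ x‖ ≤ C₁ * Real.exp (C₂ * I.radius ^ 2) * ‖(x : H →L[ℂ] H)‖

/-- `α_t` as a map of `dom(φ)` into itself. -/
def αD (t : ℝ) (x : Φ.dom) : Φ.dom := ⟨N.α t x, Φ.α_mem t x x.2⟩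

/-- The inclusion of `C^∞(δ)_c` into `dom(φ)`. -/
def ofSmooth (x : D.smooth) : Φ.dom := ⟨x, Φ.smooth_le x.2⟩

/-- The multi-point function `s ↦ φ(x_0 α_{s_1}(x_1) ⋯ α_{s_n}(x_n))` on `ℝⁿ`. -/
def multiPoint {n : ℕ} (x : Fin (n + 1) → Φ.dom) (s : Fin n → ℝ) : ℂ :=
  Φ.φ (x 0 * (List.ofFn fun j : Fin n => Φ.αD (s j) (x j.succ)).prod)

/-- The entries `x_0, δ(x_1), ..., δ(x_n)`. -/
def jloEntries {n : ℕ} (x : Fin (n + 1) → D.evenSmooth) : Fin (n + 1) → Φ.dom :=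
  Fin.cons (Φ.ofSmooth (D.toSmooth (x 0)))
    fun j : Fin n => Φ.ofSmooth (D.δS (D.toSmooth (x j.succ)))

/-- The integrand `φ(x_0 α_{s_1 t}(δ(x_1)) ⋯ α_{s_n t}(δ(x_n)))`. -/
def jloIntegrand {n : ℕ} (x : Fin (n + 1) → D.evenSmooth) (t : ℝ) (s : Fin n → ℝ) : ℂ :=
  Φ.multiPoint (Φ.jloEntries x) fun j => s j * t

/-- `∫_{Δ_n} φ(x_0 α_{s_1 t}(δ(x_1)) ⋯ α_{s_n t}(δ(x_n))) dⁿs` for real `t`. -/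
def jloIntegral {n : ℕ} (x : Fin (n + 1) → D.evenSmooth) (t : ℝ) : ℂ :=
  ∫ s in orderSimplex n, Φ.jloIntegrand x t s

/-- The expression `τ_n(x_0, ..., x_n)`. -/
def jlo (n : ℕ) (x : Fin (n + 1) → D.evenSmooth) : ℂ :=
  if Even n then analContAtI (Φ.jloIntegral x) else 0

end SKMSFunctional

end SKMS

/-! ### Local-entire cyclic cohomology -/

section Cyclic

variable {H : Type*} [NormedAddCommGroup H] [InnerProductSpace ℂ H] [CompleteSpace H]

/-- Sequences of `(n+1)`-linear forms on `A`. -/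
abbrev Cochain (A : StarSubalgebra ℂ (H →L[ℂ] H)) : Type _ :=
  (n : ℕ) → MultilinearMap ℂ (fun _ : Fin (n + 1) => A) ℂ

variable {A : StarSubalgebra ℂ (H →L[ℂ] H)}

/-- The norm, possibly infinite, of a multilinear form restricted to arguments in `M`, with respect
to the norm `nrm` on `A`. -/
def restrictedNorm (nrm : A → ℝ) (M : Set (H →L[ℂ] H)) {n : ℕ}
    (ρ : MultilinearMap ℂ (fun _ : Fin (n + 1) => A) ℂ) : ℝ≥0∞ :=
  ⨆ x : {x : Fin (n + 1) → A // ∀ i, (x i : H →L[ℂ] H) ∈ M},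
    ENNReal.ofReal (‖ρ x.1‖ / ∏ i, nrm (x.1 i))

/-- Local-entire cochains on `A`, with respect to the norm `nrm` on `A`. -/
structure IsLocalEntireCochain (N : GradedNet H) (nrm : A → ℝ) (ρ : Cochain A) : Prop where
  normalized : ∀ (n : ℕ) (x : Fin (n + 1) → A),
    (∃ i, i ≠ 0 ∧ ∃ c : ℂ, x i = algebraMap ℂ A c) → ρ n x = 0
  entire : ∀ I : BddInterval,
    Tendsto (fun n : ℕ => (n : ℝ≥0∞) ^ (1 / 2 : ℝ) *
      restrictedNorm nrm (N.alg I : Set (H →L[ℂ] H)) (ρ n) ^ (1 / (n : ℝ))) atTop (𝓝 0)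

/-- Even cochains: all odd components vanish. -/
def IsEvenCochain (ρ : Cochain A) : Prop := ∀ n : ℕ, ρ (2 * n + 1) = 0

/-- The Hochschild operator `b`:
`∑_{j<n} (-1)^j ρ(x_0, ..., x_j x_{j+1}, ..., x_n) + (-1)^n ρ(x_n x_0, x_1, ..., x_{n-1})`. -/
def hochschildB (ρ : Cochain A) : (n : ℕ) → (Fin (n + 1) → A) → ℂ
  | 0, _ => 0
  | m + 1, x =>
      ∑ j : Fin (m + 1), (-1 : ℂ) ^ (j : ℕ) * ρ m (Fin.contractNth j.castSucc (· * ·) x)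
        + (-1 : ℂ) ^ (m + 1) *
          ρ m (Fin.cons (x (Fin.last (m + 1)) * x 0) fun i : Fin m => x i.succ.castSucc)

/-- The Connes operator `B`: `∑_{j≤n} (-1)^{nj} ρ(1, x_j, ..., x_n, x_0, ..., x_{j-1})`; the
addition in `Fin (n + 1)` is cyclic. -/
def connesB (ρ : Cochain A) (n : ℕ) (x : Fin (n + 1) → A) : ℂ :=
  ∑ j : Fin (n + 1), (-1 : ℂ) ^ (n * (j : ℕ)) *
    ρ (n + 1) (Fin.cons 1 fun i : Fin (n + 1) => x (j + i))

/-- Local-entire cyclic cocycles: local-entire cochains with `(B + b) ρ = 0`. -/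
structure IsLocalEntireCyclicCocycle (N : GradedNet H) (nrm : A → ℝ) (ρ : Cochain A) : Prop
    extends IsLocalEntireCochain N nrm ρ where
  closed : ∀ (n : ℕ) (x : Fin (n + 1) → A), connesB ρ n x + hochschildB ρ n x = 0

end Cyclic

end

noncomputable section

/-! ### One complex variable -/

/-! The sKMS condition continues in one variable only. Cut the product x_0 α_{s_1}(x_1) ⋯
α_{s_n}(x_n) behind position i and apply the condition to the two parts: the multi-point function
continues from ℝⁿ to ℝⁿ + i v along v = (0, …, 0, 1, …, 1), and over v it takes the value with the
two parts exchanged and γ applied to the first (`hasEdge_vertexFn`). These v are exactly the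
vertices of the simplex.

The tube is then filled in by `exists_tubeHolo_of_hasEdge`. Convolution with a Gaussian gives an
entire function whose values over a vertex are the convolution of the known boundary values. By the
three-lines theorem the set of u with a given bound on ℝⁿ + i u is convex, so the vertices control
the whole tube (`TubeHolo.norm_le`); as the Gaussians narrow, the regularizations are uniformly
Cauchy. This needs bounded, uniformly continuous boundary values. Local-exponential boundedness only
gives growth exp(C₂(|I| + ‖s‖)²), so `exists_tubeHolo` first multiplies by exp(-2C₂ ∑ z_j²) and
removes this weight at the end; the bound of part 3 comes out on the way.

Holomorphy is tracked as `TubeHolo`, along complex lines in the closed tube, including lines in its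
boundary. Every point of the tube is the value at w = i of a line that is real for real w, so
identities on ℝⁿ extend to the tube (`TubeHolo.eqOn`); `differentiableOn_of_lines` recovers joint
holomorphy.

The value τ_n is the integral of the continued function F over i Δ_n. On i Δ_n the continuation is
at most a constant times Kⁿ, and Δ_n has volume 1/n!, which gives entireness.

For the cocycle identity in odd degree, four identities are checked at real times and continued:
contraction of neighbours at equal times, cyclicity (KMS and translation invariance), invariance
under δ, and d/dt = i δ². In Bτ cyclicity moves the entry 1 to the end, where integrating out its
time yields a gap between neighbouring times; the gaps permute cyclically and sum to 1, so Bτ(x) is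
the integral of F for the entries δ(x_0), …, δ(x_n) (`sum_simplexIntegral_cons_one`). Invariance
under δ trades it for terms with one entry δ²(x_k). There δ² is a time derivative, and integrating
it leaves values on two faces of the simplex (`simplexIntegral_update_δδ`). By the Leibniz rule the
faces are the terms of bτ, with the opposite total sign. -/

theorem strip_eq : strip = Complex.im ⁻¹' Set.Icc 0 1 := rfl

theorem interior_strip : interior strip = Complex.im ⁻¹' Set.Ioo 0 1 := by
  rw [strip_eq, Complex.interior_preimage_im, interior_Icc]

theorem convex_strip : Convex ℝ strip := by
  rw [strip_eq]
  exact (convex_Icc (0 : ℝ) 1).linear_preimage Complex.imLm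

theorem strip_subset_closure : strip ⊆ closure (interior strip) := by
  rw [interior_strip, Complex.closure_preimage_im, closure_Ioo zero_ne_one]
  exact subset_rfl

theorem real_mem_strip (t : ℝ) : (t : ℂ) ∈ strip := by simp [strip]

/-- A function on the strip that vanishes on the real line vanishes at the centre of every square
in the strip with one side on the real line. -/
theorem eq_zero_of_strip_of_im_lt {f : ℂ → ℂ} (hc : ContinuousOn f strip)
    (hd : DifferentiableOn ℂ f (interior strip)) (h0 : ∀ t : ℝ, f t = 0) {c : ℂ}
    (hc0 : 0 < c.im) (hc1 : c.im < 1 / 2) : f c = 0 := by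
  set y := c.im with hy
  set U : Set ℂ := Set.Ioo (-y) y ×ℂ Set.Ioo (-y) y with hU
  have hyy : -y ≠ y := by linarith
  have hcl : closure U = Set.Icc (-y) y ×ℂ Set.Icc (-y) y := by
    rw [hU, Complex.closure_reProdIm, closure_Ioo hyy]
  have hUo : IsOpen U := isOpen_Ioo.reProdIm isOpen_Ioo
  -- a factor of the product
  have key : ∀ ω : ℂ, (ω = 1 ∨ ω = Complex.I ∨ ω = -1 ∨ ω = -Complex.I) →
      DiffContOnCl ℂ (fun u => f (c + ω * u)) U := by
    intro ω hω
    refine ⟨?_, ?_⟩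
    · refine hd.comp (by fun_prop) ?_
      intro u hu
      rw [interior_strip]
      obtain ⟨⟨h1, h2⟩, h3, h4⟩ := hu
      rcases hω with rfl | rfl | rfl | rfl <;> simp <;> constructor <;> linarith
    · refine hc.comp (by fun_prop) ?_
      intro u hu
      rw [hcl] at hu
      obtain ⟨⟨h1, h2⟩, h3, h4⟩ := hu
      rcases hω with rfl | rfl | rfl | rfl <;> simp [strip] <;> constructor <;> linarith
  -- Four copies of f, rotated about c by multiples of a right angle. Each side of the square is
  -- carried onto the real line by one of them, so the product vanishes on the frontier, while at
  -- the centre it is f(c)⁴. The rotated squares stay in the strip because 2 Im c < 1.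
  have hg : DiffContOnCl ℂ (fun u => (f (c + 1 * u) * f (c + Complex.I * u)) *
      (f (c + (-1) * u) * f (c + (-Complex.I) * u))) U := by
    have h1 := key 1 (by simp)
    have h2 := key Complex.I (by simp)
    have h3 := key (-1) (by simp)
    have h4 := key (-Complex.I) (by simp)
    exact ⟨(h1.1.mul h2.1).mul (h3.1.mul h4.1), (h1.2.mul h2.2).mul (h3.2.mul h4.2)⟩
  have hb : Bornology.IsBounded U :=
    (Metric.isBounded_Ioo _ _).reProdIm (Metric.isBounded_Ioo _ _)
  have hz : (0 : ℂ) ∈ closure U := by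
    rw [hcl]; refine ⟨⟨?_, ?_⟩, ?_, ?_⟩ <;> simp <;> linarith
  have hreal : ∀ z : ℂ, z.im = 0 → f z = 0 := by
    intro z hz
    have : z = (z.re : ℂ) := by apply Complex.ext <;> simp [hz]
    rw [this, h0]
  have := Complex.norm_le_of_forall_mem_frontier_norm_le hb hg (C := 0) ?_ hz
  · simp only [mul_zero, add_zero, norm_mul] at this
    by_contra hne
    have hpos : 0 < ‖f c‖ := norm_pos_iff.2 hne
    exact absurd this (not_le.2 (by positivity))
  · intro u hu
    rw [frontier, hcl, hUo.interior_eq] at hu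
    obtain ⟨⟨⟨h1, h2⟩, h3, h4⟩, h5⟩ := hu
    have h6 : u.re = -y ∨ u.re = y ∨ u.im = -y ∨ u.im = y := by
      by_contra hcon
      push Not at hcon
      exact h5 ⟨⟨lt_of_le_of_ne h1 (Ne.symm hcon.1), lt_of_le_of_ne h2 hcon.2.1⟩,
        lt_of_le_of_ne h3 (Ne.symm hcon.2.2.1), lt_of_le_of_ne h4 hcon.2.2.2⟩
    rw [norm_le_zero_iff]
    rcases h6 with h | h | h | h
    · rw [hreal (c + Complex.I * u) (by simp [h, ← hy])]; simp
    · rw [hreal (c + (-Complex.I) * u) (by simp [h, ← hy])]; simp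
    · rw [hreal (c + 1 * u) (by simp [h, ← hy])]; simp
    · rw [hreal (c + (-1) * u) (by simp [h, ← hy])]; simp

/-- Continuations into the strip are determined by their values on the real line. -/
theorem eq_zero_of_strip {f : ℂ → ℂ} (hc : ContinuousOn f strip)
    (hd : DifferentiableOn ℂ f (interior strip)) (h0 : ∀ t : ℝ, f t = 0) :
    ∀ z ∈ strip, f z = 0 := by
  have han : AnalyticOnNhd ℂ f (interior strip) := hd.analyticOnNhd isOpen_interior
  have hm : (Complex.I / 4) ∈ interior strip := by
    rw [interior_strip]; constructor <;> norm_num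
  -- The point i/4 lies in the lower half of the strip, which the square argument covers; the
  -- identity theorem does the rest.
  have hev : f =ᶠ[𝓝 (Complex.I / 4)] 0 := by
    have : Complex.im ⁻¹' Set.Ioo 0 (1 / 2) ∈ 𝓝 (Complex.I / 4) := by
      refine (isOpen_Ioo.preimage Complex.continuous_im).mem_nhds ?_
      constructor <;> norm_num
    filter_upwards [this] with w hw
    exact eq_zero_of_strip_of_im_lt hc hd h0 hw.1 hw.2
  have hint : Set.EqOn f 0 (interior strip) :=
    han.eqOn_zero_of_preconnected_of_eventuallyEq_zero
      convex_strip.interior.isPreconnected hm hev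
  have := hint.of_subset_closure hc continuousOn_const interior_subset strip_subset_closure
  exact this

theorem eqOn_strip {f g : ℂ → ℂ} (hfc : ContinuousOn f strip)
    (hfd : DifferentiableOn ℂ f (interior strip)) (hgc : ContinuousOn g strip)
    (hgd : DifferentiableOn ℂ g (interior strip)) (h : ∀ t : ℝ, f t = g t) :
    Set.EqOn f g strip := fun z hz =>
  sub_eq_zero.1 <| eq_zero_of_strip (hfc.sub hgc) (hfd.sub hgd)
    (fun t => sub_eq_zero.2 (h t)) z hz

/-- The Phragmén-Lindelöf principle on the strip, for functions of polynomial growth. -/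
theorem norm_le_of_strip {f : ℂ → ℂ} (hc : ContinuousOn f strip)
    (hd : DifferentiableOn ℂ f (interior strip)) {M C : ℝ} {p : ℕ}
    (hg : ∀ z ∈ strip, ‖f z‖ ≤ C * (1 + |z.re|) ^ p)
    (h0 : ∀ t : ℝ, ‖f t‖ ≤ M) (h1 : ∀ t : ℝ, ‖f (t + Complex.I)‖ ≤ M) :
    ∀ z ∈ strip, ‖f z‖ ≤ M := by
  intro z hz
  have hC : 0 ≤ C := by
    have := (norm_nonneg _).trans (hg 0 (by simpa using real_mem_strip 0))
    simpa using this
  refine PhragmenLindelof.horizontal_strip (a := 0) (b := 1) (f := f) ⟨?_, ?_⟩ ?_ ?_ ?_ hz.1 hz.2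
  · rwa [interior_strip] at hd
  · rw [Complex.closure_preimage_im, closure_Ioo zero_ne_one]
    exact hc
  -- For a strip of width 1 the admissible growth is exp(B exp(c|Re z|)) with c < π; here c = B = 1.
  -- Polynomial growth fits since (1 + x)^p ≤ p! exp(1 + x) ≤ p! exp(exp x).
  · refine ⟨1, by simpa using Real.pi_gt_three.trans' (by norm_num), 1, ?_⟩
    refine Asymptotics.IsBigO.of_bound (C * p.factorial) ?_
    refine Filter.eventually_inf_principal.2 (Filter.Eventually.of_forall fun w hw => ?_)
    have hw' : w ∈ strip := ⟨hw.1.le, hw.2.le⟩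
    refine (hg w hw').trans ?_
    rw [Real.norm_of_nonneg (Real.exp_pos _).le, mul_assoc]
    refine mul_le_mul_of_nonneg_left ?_ hC
    have h2 := Real.pow_div_factorial_le_exp (1 + |w.re|) (by positivity) p
    rw [div_le_iff₀ (by positivity)] at h2
    rw [mul_comm] at h2
    refine h2.trans (mul_le_mul_of_nonneg_left ?_ (by positivity))
    rw [one_mul, one_mul, Real.exp_le_exp, add_comm]
    exact Real.add_one_le_exp _
  · intro w hw
    have : w = (w.re : ℂ) := by apply Complex.ext <;> simp [hw]
    rw [this]; exact h0 _
  · intro w hw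
    have : w = (w.re : ℂ) + Complex.I := by apply Complex.ext <;> simp [hw]
    rw [this]; exact h1 _

theorem norm_le_of_strip_of_bounded {f : ℂ → ℂ} (hc : ContinuousOn f strip)
    (hd : DifferentiableOn ℂ f (interior strip)) {M C : ℝ} (hg : ∀ z ∈ strip, ‖f z‖ ≤ C)
    (h0 : ∀ t : ℝ, ‖f t‖ ≤ M) (h1 : ∀ t : ℝ, ‖f (t + Complex.I)‖ ≤ M) :
    ∀ z ∈ strip, ‖f z‖ ≤ M :=
  norm_le_of_strip hc hd (C := C) (p := 0) (by simpa using hg) h0 h1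

/-- Integrals of holomorphic functions depending on a parameter are holomorphic. -/
theorem differentiableOn_integral_of_dominated {T : Type*} [MeasurableSpace T] {μ : Measure T}
    {U : Set ℂ} (hU : IsOpen U) {f : ℂ → T → ℂ}
    (hmeas : ∀ z ∈ U, AEStronglyMeasurable (f z) μ)
    (hdiff : ∀ᵐ t ∂μ, DifferentiableOn ℂ (fun z => f z t) U)
    (hbound : ∀ z ∈ U, ∃ r > 0, ∃ b : T → ℝ, Integrable b μ ∧
      ∀ᵐ t ∂μ, ∀ w ∈ Metric.ball z r ∩ U, ‖f w t‖ ≤ b t) :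
    DifferentiableOn ℂ (fun z => ∫ t, f z t ∂μ) U := by
  intro z hz
  obtain ⟨r₁, hr₁, b, hb, hfb⟩ := hbound z hz
  obtain ⟨r₂, hr₂, hball⟩ := Metric.isOpen_iff.1 hU z hz
  obtain ⟨r, hr, hrr⟩ : ∃ r > 0, r ≤ min r₁ r₂ := ⟨min r₁ r₂, lt_min hr₁ hr₂, le_rfl⟩
  have hsub1 : Metric.ball z r ⊆ Metric.ball z r₁ :=
    Metric.ball_subset_ball (hrr.trans (min_le_left _ _))
  have hsub2 : Metric.ball z r ⊆ U :=
    (Metric.ball_subset_ball (hrr.trans (min_le_right _ _))).trans hball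
  have hint : Integrable (f z) μ := by
    refine hb.mono' (hmeas z hz) ?_
    filter_upwards [hfb] with t ht
    exact ht z ⟨Metric.mem_ball_self hr₁, hz⟩
  have hseq : ∀ n : ℕ, z + ((r / (n + 2) : ℝ) : ℂ) ∈ U := by
    intro n
    apply hsub2
    rw [Metric.mem_ball, dist_eq_norm, add_sub_cancel_left, Complex.norm_real,
      Real.norm_of_nonneg (by positivity), div_lt_iff₀ (by positivity)]
    nlinarith [(Nat.cast_nonneg n : (0 : ℝ) ≤ n)]
  -- The derivative in z is a pointwise limit of difference quotients, taken along z + r/(n+2),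
  -- which lies in the ball of radius r for every n.
  have hmeas' : AEStronglyMeasurable (fun t => deriv (fun w => f w t) z) μ := by
    refine aestronglyMeasurable_of_tendsto_ae (u := atTop)
      (f := fun (n : ℕ) t => (((r / (n + 2) : ℝ) : ℂ))⁻¹ •
        (f (z + ((r / (n + 2) : ℝ) : ℂ)) t - f z t)) ?_ ?_
    · intro n
      exact ((hmeas _ (hseq n)).sub (hmeas z hz)).const_smul (((r / (n + 2) : ℝ) : ℂ))⁻¹
    · filter_upwards [hdiff] with t ht
      have hda := (ht.differentiableAt (hU.mem_nhds hz)).hasDerivAt.tendsto_slope_zero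
      refine hda.comp (tendsto_nhdsWithin_iff.2 ⟨?_, Filter.Eventually.of_forall fun n => ?_⟩)
      · rw [← Complex.ofReal_zero]
        refine (Complex.continuous_ofReal.tendsto 0).comp ?_
        refine tendsto_const_nhds.div_atTop ?_
        exact tendsto_atTop_add_const_right _ _ tendsto_natCast_atTop_atTop
      · have : r / ((n : ℝ) + 2) ≠ 0 := by positivity
        exact Complex.ofReal_ne_zero.2 this
  have := hasDerivAt_integral_of_dominated_loc_of_deriv_le (μ := μ) (F := f)
    (F' := fun w t => deriv (fun w => f w t) w) (bound := fun t => b t / (r / 2))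
    (Metric.ball_mem_nhds z (half_pos hr))
    ?_ hint hmeas' ?_ (hb.div_const _) ?_
  · exact this.2.differentiableAt.differentiableWithinAt
  · filter_upwards [hU.mem_nhds hz] with w hw using hmeas w hw
  -- Cauchy's estimate on the circle of radius r/2 about w, which stays in the ball of radius r
  -- about z.
  · filter_upwards [hfb, hdiff] with t ht htd w hw
    have hsub : Metric.closedBall w (r / 2) ⊆ Metric.ball z r := by
      intro u hu
      rw [Metric.mem_ball] at hw ⊢
      rw [Metric.mem_closedBall] at hu
      linarith [dist_triangle u w z]
    refine Complex.norm_deriv_le_of_forall_mem_sphere_norm_le (half_pos hr) ?_ ?_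
    · refine DifferentiableOn.diffContOnCl ?_
      rw [closure_ball _ (half_pos hr).ne']
      exact htd.mono (hsub.trans hsub2)
    · intro u hu
      have := hsub (Metric.sphere_subset_closedBall hu)
      exact ht u ⟨hsub1 this, hsub2 this⟩
  · filter_upwards [hdiff] with t ht w hw
    exact (ht.differentiableAt (hU.mem_nhds
      (hsub2 (Metric.ball_subset_ball (half_le_self hr.le) hw)))).hasDerivAt

/-! ### Holomorphy along lines -/

/-- Maximum principle: the divided difference is holomorphic also at 0, and on the circle of radius
R it is (h(u) - h(0))/u. -/
theorem norm_dslope_le {h : ℂ → ℂ} {U : Set ℂ} {R M : ℝ} (hR : 0 < R) (hU : U ∈ 𝓝 (0 : ℂ))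
    (hd : DifferentiableOn ℂ h U) (hs : Metric.closedBall 0 R ⊆ U)
    (hM : ∀ w ∈ Metric.closedBall (0 : ℂ) R, ‖h w‖ ≤ M) :
    ∀ w ∈ Metric.closedBall (0 : ℂ) R, ‖dslope h 0 w‖ ≤ 2 * M / R := by
  intro w hw
  have hds : DifferentiableOn ℂ (dslope h 0) U := (Complex.differentiableOn_dslope hU).2 hd
  rw [← closure_ball _ hR.ne'] at hw hs
  refine Complex.norm_le_of_forall_mem_frontier_norm_le Metric.isBounded_ball
    (hds.mono hs).diffContOnCl ?_ hw
  intro u hu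
  rw [frontier_ball _ hR.ne'] at hu
  have hu' : ‖u‖ = R := by simpa using hu
  have hu0 : u ≠ 0 := by rintro rfl; simp at hu'; linarith
  rw [dslope_of_ne _ hu0, slope_def_field, norm_div, sub_zero, hu']
  gcongr
  refine (norm_sub_le _ _).trans ?_
  have h1 := hM u (by simp [hu'])
  have h2 := hM 0 (by simp [hR.le])
  linarith

/-- A quantitative form of complex differentiability for bounded functions. -/
theorem norm_sub_sub_deriv_le {f : ℂ → ℂ} {R M : ℝ} (hR : 1 ≤ R)
    (hd : DifferentiableOn ℂ f (Metric.ball 0 (2 * R)))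
    (hM : ∀ w ∈ Metric.ball (0 : ℂ) (2 * R), ‖f w‖ ≤ M) :
    ‖f 1 - f 0 - deriv f 0‖ ≤ 4 * M / R ^ 2 := by
  have hR0 : 0 < R := by linarith
  have hU : Metric.ball (0 : ℂ) (2 * R) ∈ 𝓝 (0 : ℂ) := Metric.ball_mem_nhds _ (by linarith)
  have hs : Metric.closedBall (0 : ℂ) R ⊆ Metric.ball 0 (2 * R) :=
    Metric.closedBall_subset_ball (by linarith)
  have h1 := norm_dslope_le hR0 hU hd hs fun w hw => hM w (hs hw)
  have h2 := norm_dslope_le hR0 hU ((Complex.differentiableOn_dslope hU).2 hd) hs h1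
    1 (by simpa using hR)
  -- The second divided difference at 1 is the first-order Taylor remainder, so two applications of
  -- `norm_dslope_le` bound it.
  have h3 : dslope (dslope f 0) 0 1 = f 1 - f 0 - deriv f 0 := by
    rw [dslope_of_ne _ one_ne_zero, slope_def_field, dslope_of_ne _ one_ne_zero, slope_def_field,
      dslope_same]
    simp
  rw [h3] at h2
  refine h2.trans (le_of_eq ?_)
  field_simp
  ring

/-- A continuous function on an open set that is holomorphic along all complex lines is
holomorphic. -/
theorem differentiableOn_of_lines {E : Type*} [NormedAddCommGroup E] [NormedSpace ℂ E] {F : E → ℂ}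
    {U : Set E} (hU : IsOpen U) (hc : ContinuousOn F U)
    (hl : ∀ a b : E, DifferentiableOn ℂ (fun w : ℂ => F (a + w • b)) {w | a + w • b ∈ U}) :
    DifferentiableOn ℂ F U := by
  intro z₀ hz₀
  obtain ⟨r, hr, hrU, M, hM⟩ : ∃ r > 0, Metric.ball z₀ (2 * r) ⊆ U ∧
      ∃ M, ∀ z ∈ Metric.ball z₀ (2 * r), ‖F z‖ ≤ M := by
    have h1 : ∀ᶠ z in 𝓝 z₀, z ∈ U ∧ ‖F z‖ < ‖F z₀‖ + 1 := by
      refine Filter.Eventually.and (hU.mem_nhds hz₀) ?_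
      exact (hc.continuousAt (hU.mem_nhds hz₀)).norm.eventually_lt_const (by linarith)
    obtain ⟨r, hr, h⟩ := Metric.eventually_nhds_iff_ball.1 h1
    have hr2 : 2 * (r / 2) = r := by ring
    exact ⟨r / 2, half_pos hr, fun z hz => (h z (hr2 ▸ hz)).1, ‖F z₀‖ + 1,
      fun z hz => (h z (hr2 ▸ hz)).2.le⟩
  set L : E → E → ℂ := fun z v => deriv (fun w : ℂ => F (z + w • v)) 0 with hL
  have hM0 : 0 ≤ M := (norm_nonneg _).trans (hM z₀ (Metric.mem_ball_self (by linarith)))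
  set K : ℝ := 16 * M / r ^ 2 with hK
  have hK0 : 0 ≤ K := by positivity
  have hline : ∀ z ∈ Metric.ball z₀ r, ∀ v : E, ‖v‖ < r → z + v ∈ Metric.ball z₀ (2 * r) := by
    intro z hz v hv
    rw [Metric.mem_ball, dist_eq_norm] at hz ⊢
    have : z + v - z₀ = (z - z₀) + v := by abel
    rw [this]
    linarith [norm_add_le (z - z₀) v]
  -- A second-order Taylor estimate along each line, uniform in the base point. The radius R =
  -- r/(2‖v‖) makes w • v shorter than r for |w| < 2R, and 4M/R² becomes K‖v‖².
  have est : ∀ z ∈ Metric.ball z₀ r, ∀ v : E, 2 * ‖v‖ ≤ r →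
      ‖F (z + v) - F z - L z v‖ ≤ K * ‖v‖ ^ 2 := by
    intro z hz v hv
    rcases eq_or_ne v 0 with rfl | hv0
    · simp [hL]
    have hvp : 0 < ‖v‖ := norm_pos_iff.2 hv0
    have hmem : ∀ w ∈ Metric.ball (0 : ℂ) (2 * (r / (2 * ‖v‖))), z + w • v ∈
        Metric.ball z₀ (2 * r) := by
      intro w hw
      refine hline z hz _ ?_
      rw [mem_ball_zero_iff] at hw
      rw [norm_smul]
      calc ‖w‖ * ‖v‖ < 2 * (r / (2 * ‖v‖)) * ‖v‖ := by gcongr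
        _ = r := by field_simp
    have := norm_sub_sub_deriv_le (f := fun w : ℂ => F (z + w • v)) (R := r / (2 * ‖v‖)) (M := M)
      (by rw [le_div_iff₀ (by positivity)]; linarith)
      ((hl z v).mono fun w hw => hrU (hmem w hw)) fun w hw => hM _ (hmem w hw)
    simp only [one_smul, zero_smul, add_zero] at this
    refine this.trans (le_of_eq ?_)
    rw [hK]
    field_simp
    ring
  have hom : ∀ z (c : ℂ) v, L z (c • v) = c * L z v := by
    intro z c v
    have := deriv_comp_mul_left c (fun w : ℂ => F (z + w • v)) 0
    simp only [mul_zero, smul_eq_mul] at this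
    rw [hL]
    simp only
    rw [← this]
    congr 1
    ext w
    rw [mul_comm c w, mul_smul]
  -- The directional derivative is, uniformly near `z₀`, a limit of difference quotients of step h
  -- with error K h ‖v‖²; for fixed h the quotients are continuous because F is.
  have hcont : ∀ v, Tendsto (fun z => L z v) (𝓝 z₀) (𝓝 (L z₀ v)) := by
    intro v
    rw [Metric.tendsto_nhds]
    intro ε hε
    obtain ⟨h, hh, hh1, hh2⟩ : ∃ h : ℝ, 0 < h ∧ 2 * (h * ‖v‖) ≤ r ∧
        2 * (K * h * ‖v‖ ^ 2) < ε / 2 := by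
      have e1 : Tendsto (fun h : ℝ => 2 * (h * ‖v‖)) (𝓝[>] 0) (𝓝 (2 * (0 * ‖v‖))) :=
        tendsto_nhdsWithin_of_tendsto_nhds (Continuous.tendsto (by fun_prop) 0)
      have e2 : Tendsto (fun h : ℝ => 2 * (K * h * ‖v‖ ^ 2)) (𝓝[>] 0)
          (𝓝 (2 * (K * 0 * ‖v‖ ^ 2))) :=
        tendsto_nhdsWithin_of_tendsto_nhds (Continuous.tendsto (by fun_prop) 0)
      have e3 := e1.eventually_lt_const (u := r) (by simpa using hr)
      have e4 := e2.eventually_lt_const (u := ε / 2) (by simpa using half_pos hε)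
      obtain ⟨h, ⟨h1, h2⟩, h3⟩ := ((e3.and e4).and self_mem_nhdsWithin).exists
      exact ⟨h, h3, h1.le, h2⟩
    have hnv : ‖(h : ℂ) • v‖ = h * ‖v‖ := by
      rw [norm_smul, Complex.norm_real, Real.norm_of_nonneg hh.le]
    have hq : Tendsto (fun z => F (z + (h : ℂ) • v) - F z) (𝓝 z₀)
        (𝓝 (F (z₀ + (h : ℂ) • v) - F z₀)) := by
      have h2 : z₀ + (h : ℂ) • v ∈ U := hrU (hline z₀ (Metric.mem_ball_self hr) _ (by
        rw [hnv]; nlinarith [mul_nonneg hh.le (norm_nonneg v)]))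
      refine Tendsto.sub ?_ (hc.continuousAt (hU.mem_nhds hz₀))
      exact (hc.continuousAt (hU.mem_nhds h2)).tendsto.comp
        (Continuous.tendsto (by fun_prop : Continuous fun z : E => z + (h : ℂ) • v) z₀)
    rw [Metric.tendsto_nhds] at hq
    filter_upwards [hq (h * (ε / 2)) (by positivity), Metric.ball_mem_nhds z₀ hr] with z hz1 hz2
    have e1 := est z hz2 ((h : ℂ) • v) (by rw [hnv]; exact hh1)
    have e2 := est z₀ (Metric.mem_ball_self hr) ((h : ℂ) • v) (by rw [hnv]; exact hh1)
    rw [hom, hnv] at e1 e2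
    rw [dist_eq_norm] at hz1 ⊢
    have e3 : (h : ℂ) * (L z v - L z₀ v) =
        (F (z + (h : ℂ) • v) - F z - (F (z₀ + (h : ℂ) • v) - F z₀))
        - (F (z + (h : ℂ) • v) - F z - (h : ℂ) * L z v)
        + (F (z₀ + (h : ℂ) • v) - F z₀ - (h : ℂ) * L z₀ v) := by ring
    have e4 : h * ‖L z v - L z₀ v‖ < h * ε := by
      calc h * ‖L z v - L z₀ v‖ = ‖(h : ℂ) * (L z v - L z₀ v)‖ := by
            rw [norm_mul, Complex.norm_real, Real.norm_of_nonneg hh.le]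
        _ ≤ ‖F (z + (h : ℂ) • v) - F z - (F (z₀ + (h : ℂ) • v) - F z₀)‖
            + ‖F (z + (h : ℂ) • v) - F z - (h : ℂ) * L z v‖
            + ‖F (z₀ + (h : ℂ) • v) - F z₀ - (h : ℂ) * L z₀ v‖ := by
          rw [e3]
          exact (norm_add_le _ _).trans (add_le_add (norm_sub_le _ _) le_rfl)
        _ < h * (ε / 2) + K * (h * ‖v‖) ^ 2 + K * (h * ‖v‖) ^ 2 := by linarith
        _ = h * (ε / 2 + 2 * (K * h * ‖v‖ ^ 2)) := by ring
        _ < h * ε := by gcongr; linarith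
    exact lt_of_mul_lt_mul_left e4 hh.le
  -- Compare the direct step from `z₀` to z₀ + h(u + v) with the detour through z₀ + h u. The
  -- derivative along v is then taken at a moved base point, which `hcont` brings back as h tends to
  -- 0.
  have hadd : ∀ u v, L z₀ (u + v) = L z₀ u + L z₀ v := by
    intro u v
    have t1 : Tendsto (fun h : ℝ => L z₀ (u + v) - L (z₀ + (h : ℂ) • u) v - L z₀ u) (𝓝[>] 0)
        (𝓝 (L z₀ (u + v) - L z₀ v - L z₀ u)) := by
      refine (tendsto_const_nhds.sub ((hcont v).comp ?_)).sub tendsto_const_nhds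
      have : Tendsto (fun h : ℝ => z₀ + (h : ℂ) • u) (𝓝[>] 0) (𝓝 (z₀ + ((0 : ℝ) : ℂ) • u)) :=
        tendsto_nhdsWithin_of_tendsto_nhds (Continuous.tendsto (by fun_prop) 0)
      simpa using this
    set C : ℝ := K * (‖u + v‖ ^ 2 + ‖v‖ ^ 2 + ‖u‖ ^ 2) with hC
    have t2 : Tendsto (fun h : ℝ => L z₀ (u + v) - L (z₀ + (h : ℂ) • u) v - L z₀ u) (𝓝[>] 0)
        (𝓝 0) := by
      have t3 : Tendsto (fun h : ℝ => h * C) (𝓝[>] 0) (𝓝 0) := by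
        have : Tendsto (fun h : ℝ => h * C) (𝓝[>] 0) (𝓝 (0 * C)) :=
          tendsto_nhdsWithin_of_tendsto_nhds (Continuous.tendsto (by fun_prop) 0)
        simpa using this
      refine squeeze_zero_norm' ?_ t3
      have small : ∀ w : E, ∀ᶠ h : ℝ in 𝓝[>] 0, 2 * (h * ‖w‖) < r := by
        intro w
        have e1 : Tendsto (fun h : ℝ => 2 * (h * ‖w‖)) (𝓝[>] 0) (𝓝 (2 * (0 * ‖w‖))) :=
          tendsto_nhdsWithin_of_tendsto_nhds (Continuous.tendsto (by fun_prop) 0)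
        exact e1.eventually_lt_const (by simpa using hr)
      filter_upwards [small u, small v, small (u + v), self_mem_nhdsWithin] with h h1 h2 h3 hh
      replace hh : 0 < h := hh
      have hn : ∀ w : E, ‖(h : ℂ) • w‖ = h * ‖w‖ := fun w => by
        rw [norm_smul, Complex.norm_real, Real.norm_of_nonneg hh.le]
      have hzu : z₀ + (h : ℂ) • u ∈ Metric.ball z₀ r := by
        rw [Metric.mem_ball, dist_eq_norm, add_sub_cancel_left, hn]
        nlinarith [mul_nonneg hh.le (norm_nonneg u)]
      have e1 := est z₀ (Metric.mem_ball_self hr) ((h : ℂ) • (u + v)) (by rw [hn]; exact h3.le)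
      have e2 := est z₀ (Metric.mem_ball_self hr) ((h : ℂ) • u) (by rw [hn]; exact h1.le)
      have e3 := est _ hzu ((h : ℂ) • v) (by rw [hn]; exact h2.le)
      rw [hom, hn] at e1 e2 e3
      rw [smul_add, ← add_assoc] at e1
      have e4 : (h : ℂ) * (L z₀ (u + v) - L (z₀ + (h : ℂ) • u) v - L z₀ u) =
          -(F (z₀ + (h : ℂ) • u + (h : ℂ) • v) - F z₀ - (h : ℂ) * L z₀ (u + v))
          + (F (z₀ + (h : ℂ) • u + (h : ℂ) • v) - F (z₀ + (h : ℂ) • u)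
            - (h : ℂ) * L (z₀ + (h : ℂ) • u) v)
          + (F (z₀ + (h : ℂ) • u) - F z₀ - (h : ℂ) * L z₀ u) := by ring
      refine le_of_mul_le_mul_left ?_ hh
      calc h * ‖L z₀ (u + v) - L (z₀ + (h : ℂ) • u) v - L z₀ u‖
          = ‖(h : ℂ) * (L z₀ (u + v) - L (z₀ + (h : ℂ) • u) v - L z₀ u)‖ := by
            rw [norm_mul, Complex.norm_real, Real.norm_of_nonneg hh.le]
        _ ≤ K * (h * ‖u + v‖) ^ 2 + K * (h * ‖v‖) ^ 2 + K * (h * ‖u‖) ^ 2 := by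
            rw [e4]
            refine (norm_add_le _ _).trans (add_le_add ((norm_add_le _ _).trans ?_) e2)
            rw [norm_neg]
            exact add_le_add e1 e3
        _ = h * (h * C) := by rw [hC]; ring
    have := tendsto_nhds_unique t1 t2
    linear_combination this
  have hbd : ∀ v, ‖L z₀ v‖ ≤ (2 * M / (r / 2)+ K * (r / 2)) * ‖v‖ := by
    intro v
    rcases eq_or_ne v 0 with rfl | hv0
    · simp [hL]
    have hvp : 0 < ‖v‖ := norm_pos_iff.2 hv0
    set c : ℝ := r / 2 / ‖v‖ with hc
    have hcp : 0 < c := by positivity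
    have hcv : ‖(c : ℂ) • v‖ = r / 2 := by
      rw [norm_smul, Complex.norm_real, Real.norm_of_nonneg hcp.le, hc]
      field_simp
    have e1 := est z₀ (Metric.mem_ball_self hr) ((c : ℂ) • v) (by rw [hcv]; linarith)
    have e2 := hM z₀ (Metric.mem_ball_self (by linarith))
    have e3 := hM _ (hline z₀ (Metric.mem_ball_self hr) ((c : ℂ) • v) (by rw [hcv]; linarith))
    rw [hcv] at e1
    have e4 : L z₀ ((c : ℂ) • v) = F (z₀ + (c : ℂ) • v) - F z₀
      - (F (z₀ + (c : ℂ) • v) - F z₀ - L z₀ ((c : ℂ) • v)) := by ring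
    have e5 : ‖L z₀ ((c : ℂ) • v)‖ ≤ 2 * M + K * (r / 2) ^ 2 := by
      rw [e4]
      refine (norm_sub_le _ _).trans (add_le_add ((norm_sub_le _ _).trans ?_) e1)
      linarith
    rw [hom, norm_mul, Complex.norm_real, Real.norm_of_nonneg hcp.le] at e5
    calc ‖L z₀ v‖ = c * ‖L z₀ v‖ / c := by field_simp
      _ ≤ (2 * M + K * (r / 2) ^ 2) / c := by gcongr
      _ = _ := by rw [hc]; field_simp
  let Lc : E →L[ℂ] ℂ := LinearMap.mkContinuous
    { toFun := L z₀, map_add' := hadd, map_smul' := fun c v => hom z₀ c v } _ hbd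
  have hF : HasFDerivAt F Lc z₀ := by
    rw [hasFDerivAt_iff_isLittleO_nhds_zero]
    have hO : (fun v : E => F (z₀ + v) - F z₀ - Lc v) =O[𝓝 0] fun v => ‖v‖ ^ 2 := by
      refine Asymptotics.IsBigO.of_bound K ?_
      filter_upwards [Metric.ball_mem_nhds (0 : E) (half_pos hr)] with v hv
      rw [mem_ball_zero_iff] at hv
      have := est z₀ (Metric.mem_ball_self hr) v (by linarith)
      rw [norm_pow, norm_norm]
      exact this
    exact hO.trans_isLittleO (Asymptotics.isLittleO_norm_pow_id one_lt_two)
  exact hF.differentiableAt.differentiableWithinAt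

/-! ### The simplex and its vertices -/

/-- The vertices of the simplex `Δ_n`; the last one is the origin. -/
def vtx {n : ℕ} (i : Fin (n + 1)) : Fin n → ℝ := fun j => if i ≤ j.castSucc then 1 else 0

/-- The left neighbour of position `i` among the coordinates of `u`, with `0` in front. -/
def lo {n : ℕ} (u : Fin n → ℝ) : Fin (n + 1) → ℝ := Fin.cons 0 u

/-- The right neighbour of position `i` among the coordinates of `u`, with `1` at the end. -/
def hi {n : ℕ} (u : Fin n → ℝ) : Fin (n + 1) → ℝ := Fin.snoc u 1

/-- The lengths of the intervals into which the coordinates of `u` divide `[0, 1]`. -/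
def gap {n : ℕ} (i : Fin (n + 1)) (u : Fin n → ℝ) : ℝ := hi u i - lo u i

@[simp] theorem lo_zero {n : ℕ} (u : Fin n → ℝ) : lo u 0 = 0 := rfl

@[simp] theorem lo_succ {n : ℕ} (u : Fin n → ℝ) (i : Fin n) : lo u i.succ = u i := rfl

@[simp] theorem hi_last {n : ℕ} (u : Fin n → ℝ) : hi u (Fin.last n) = 1 := by simp [hi]

@[simp] theorem hi_castSucc {n : ℕ} (u : Fin n → ℝ) (i : Fin n) : hi u i.castSucc = u i := by
  simp [hi]

theorem vtx_last {n : ℕ} : vtx (Fin.last n) = 0 := by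
  ext j
  simp only [vtx, Pi.zero_apply, ite_eq_right_iff, one_ne_zero, imp_false, not_le]
  exact Fin.castSucc_lt_last j

theorem mem_orderSimplex_iff {n : ℕ} {u : Fin n → ℝ} :
    u ∈ orderSimplex n ↔ ∀ i, 0 ≤ gap i u := by
  constructor
  · rintro ⟨hm, hb⟩ i
    rw [gap, sub_nonneg]
    refine Fin.cases ?_ (fun j => ?_) i
    · rw [lo_zero]
      refine Fin.lastCases (motive := fun k => 0 ≤ hi u k) ?_ (fun k => ?_) 0
      · simp
      · rw [hi_castSucc]; exact (hb k).1
    · rw [lo_succ]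
      have : ∀ k : Fin (n + 1), j.succ ≤ k → u j ≤ hi u k := by
        intro k
        refine Fin.lastCases (motive := fun k => j.succ ≤ k → u j ≤ hi u k) ?_ (fun k hk => ?_) k
        · intro _; rw [hi_last]; exact (hb j).2
        · rw [hi_castSucc]
          refine hm ?_
          rw [Fin.le_def] at hk ⊢
          simp at hk
          omega
      exact this _ le_rfl
  · intro h
    cases n with
    | zero => exact ⟨fun i => i.elim0, fun i => i.elim0⟩
    | succ m =>
      have hm : Monotone u := by
        rw [Fin.monotone_iff_le_succ]
        intro i
        have := h i.succ.castSucc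
        rw [gap, hi_castSucc, ← Fin.succ_castSucc, lo_succ] at this
        linarith
      have h0 : 0 ≤ u 0 := by
        have := h 0
        rw [gap, ← Fin.castSucc_zero, hi_castSucc, Fin.castSucc_zero, lo_zero] at this
        linarith
      have h1 : u (Fin.last m) ≤ 1 := by
        have := h (Fin.last (m + 1))
        rw [gap, hi_last, ← Fin.succ_last, lo_succ] at this
        linarith
      exact ⟨hm, fun i => ⟨h0.trans (hm (Fin.zero_le i)), (hm (Fin.le_last i)).trans h1⟩⟩

theorem sum_gap {n : ℕ} (u : Fin n → ℝ) : ∑ i, gap i u = 1 := by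
  simp only [gap, Finset.sum_sub_distrib]
  rw [Fin.sum_univ_castSucc, Fin.sum_univ_succ (lo u)]
  simp

/-- The gaps are the barycentric coordinates with respect to the vertices: in coordinate j only the
gaps up to j survive, and they telescope to u j. -/
theorem sum_gap_smul_vtx {n : ℕ} (u : Fin n → ℝ) : ∑ i, gap i u • vtx i = u := by
  ext j
  simp only [gap, vtx, Finset.sum_apply, Pi.smul_apply, smul_eq_mul, sub_mul,
    Finset.sum_sub_distrib]
  rw [Fin.sum_univ_castSucc, Fin.sum_univ_succ (fun i => lo u i * _)]
  simp only [hi_castSucc, lo_zero, lo_succ, hi_last, zero_mul, zero_add]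
  have h1 : ¬ Fin.last n ≤ j.castSucc := not_le.2 (Fin.castSucc_lt_last j)
  rw [if_neg h1, mul_zero, add_zero, ← Finset.sum_sub_distrib, Finset.sum_eq_single j]
  · simp [Fin.le_def]
  · intro k _ hk
    have : (k.castSucc ≤ j.castSucc) ↔ (k.succ ≤ j.castSucc) := by
      rw [Fin.le_def, Fin.le_def]
      have : (k : ℕ) ≠ j := fun h => hk (Fin.ext h)
      simp
      omega
    simp [this]
  · simp

theorem vtx_mem {n : ℕ} (i : Fin (n + 1)) : vtx i ∈ orderSimplex n := by
  refine ⟨fun j k hjk => ?_, fun j => ?_⟩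
  · simp only [vtx]
    split_ifs with h1 h2
    · exact le_rfl
    · exact absurd (h1.trans (Fin.castSucc_le_castSucc_iff.2 hjk)) h2
    · exact zero_le_one
    · exact le_rfl
  · simp only [vtx]
    split_ifs <;> simp

theorem convex_orderSimplex (n : ℕ) : Convex ℝ (orderSimplex n) := by
  rintro x ⟨hx, hx'⟩ y ⟨hy, hy'⟩ a b ha hb hab
  refine ⟨fun i j hij => ?_, fun i => ⟨?_, ?_⟩⟩ <;>
    simp only [Pi.add_apply, Pi.smul_apply, smul_eq_mul]
  · gcongr
    · exact hx hij
    · exact hy hij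
  · have := (hx' i).1; have := (hy' i).1; positivity
  · calc a * x i + b * y i ≤ a * 1 + b * 1 := by
          gcongr
          · exact (hx' i).2
          · exact (hy' i).2
      _ = 1 := by linarith

theorem zero_mem_orderSimplex (n : ℕ) : (0 : Fin n → ℝ) ∈ orderSimplex n :=
  ⟨monotone_const, fun _ => ⟨le_rfl, zero_le_one⟩⟩

theorem isClosed_orderSimplex (n : ℕ) : IsClosed (orderSimplex n) := by
  have : orderSimplex n =
      (⋂ (i : Fin n) (j : Fin n) (_ : i ≤ j), {u : Fin n → ℝ | u i ≤ u j}) ∩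
        ⋂ i : Fin n, {u : Fin n → ℝ | 0 ≤ u i ∧ u i ≤ 1} := by
    ext u
    simp [orderSimplex, Monotone]
  rw [this]
  refine IsClosed.inter ?_ ?_
  · refine isClosed_iInter fun i => isClosed_iInter fun j => isClosed_iInter fun _ => ?_
    exact isClosed_le (continuous_apply i) (continuous_apply j)
  · refine isClosed_iInter fun i => ?_
    exact (isClosed_le continuous_const (continuous_apply i)).inter
      (isClosed_le (continuous_apply i) continuous_const)

theorem isCompact_orderSimplex (n : ℕ) : IsCompact (orderSimplex n) := by
  refine (isCompact_univ_pi fun _ : Fin n => isCompact_Icc (a := (0 : ℝ)) (b := 1)).of_isClosed_subset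
    (isClosed_orderSimplex n) fun u hu i _ => hu.2 i

theorem smul_mem_orderSimplex {n : ℕ} {u : Fin n → ℝ} (hu : u ∈ orderSimplex n) {c : ℝ}
    (h0 : 0 ≤ c) (h1 : c ≤ 1) : c • u ∈ orderSimplex n := by
  have := (convex_orderSimplex n) hu (zero_mem_orderSimplex n) h0 (sub_nonneg.2 h1) (by ring)
  simpa using this

/-- This reduces the maximum principle on the tube to the vertices. -/
theorem orderSimplex_subset_of_convex {n : ℕ} {C : Set (Fin n → ℝ)} (hC : Convex ℝ C)
    (h : ∀ i, vtx i ∈ C) : orderSimplex n ⊆ C := by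
  intro u hu
  rw [← sum_gap_smul_vtx u]
  exact hC.sum_mem (fun i _ => mem_orderSimplex_iff.1 hu i) (sum_gap u) fun i _ => h i

/-! ### Functions on the tube -/

/-- The point `s + i u` of `ℂⁿ`. -/
def cpt {n : ℕ} (s u : Fin n → ℝ) : Fin n → ℂ := fun j => s j + u j * Complex.I

theorem cpt_mem_tube {n : ℕ} {s u : Fin n → ℝ} : cpt s u ∈ tube n ↔ u ∈ orderSimplex n := by
  simp [tube, cpt]

theorem cpt_re_im {n : ℕ} (z : Fin n → ℂ) :
    cpt (fun j => (z j).re) (fun j => (z j).im) = z := by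
  ext j; simp [cpt]

theorem cpt_zero {n : ℕ} (s : Fin n → ℝ) : cpt s 0 = fun j => (s j : ℂ) := by
  ext j; simp [cpt]

theorem isClosed_tube (n : ℕ) : IsClosed (tube n) :=
  (isClosed_orderSimplex n).preimage (by fun_prop)

theorem convex_tube (n : ℕ) : Convex ℝ (tube n) := by
  intro x hx y hy a b ha hb hab
  have := (convex_orderSimplex n) hx hy ha hb hab
  simpa [tube, Pi.add_def, Pi.smul_def] using this

/-- Functions that are continuous on the tube and holomorphic along all complex lines in it. -/
structure TubeHolo {n : ℕ} (F : (Fin n → ℂ) → ℂ) : Prop where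
  continuousOn : ContinuousOn F (tube n)
  lines : ∀ (a b : Fin n → ℂ) (U : Set ℂ), IsOpen U → (∀ w ∈ U, a + w • b ∈ tube n) →
    DifferentiableOn ℂ (fun w : ℂ => F (a + w • b)) U

namespace TubeHolo

variable {m n : ℕ} {F G : (Fin n → ℂ) → ℂ}

theorem of_differentiable (hF : Differentiable ℂ F) : TubeHolo F :=
  ⟨hF.continuous.continuousOn, fun a b _ _ _ =>
    (hF.comp (by fun_prop : Differentiable ℂ fun w : ℂ => a + w • b)).differentiableOn⟩

theorem mul (hF : TubeHolo F) (hG : TubeHolo G) : TubeHolo fun z => F z * G z :=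
  ⟨hF.1.mul hG.1, fun a b U hU h => (hF.2 a b U hU h).mul (hG.2 a b U hU h)⟩

theorem add (hF : TubeHolo F) (hG : TubeHolo G) : TubeHolo fun z => F z + G z :=
  ⟨hF.1.add hG.1, fun a b U hU h => (hF.2 a b U hU h).add (hG.2 a b U hU h)⟩

theorem sub (hF : TubeHolo F) (hG : TubeHolo G) : TubeHolo fun z => F z - G z :=
  ⟨hF.1.sub hG.1, fun a b U hU h => (hF.2 a b U hU h).sub (hG.2 a b U hU h)⟩

theorem const (c : ℂ) : TubeHolo fun _ : Fin n → ℂ => c :=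
  of_differentiable (differentiable_const c)

theorem const_mul (hF : TubeHolo F) (c : ℂ) : TubeHolo fun z => c * F z :=
  (const c).mul hF

theorem sum {ι : Type*} (s : Finset ι) {F : ι → (Fin n → ℂ) → ℂ} (hF : ∀ i, TubeHolo (F i)) :
    TubeHolo fun z => ∑ i ∈ s, F i z := by
  classical
  induction s using Finset.induction_on with
  | empty => simpa using const (n := n) 0
  | insert i s hi ih => simpa [Finset.sum_insert hi] using (hF i).add ih

/-- Affine pull-backs. The image may lie in the boundary of the tube, as it does for contractions
and faces; this is why lines are admitted in the closed tube. -/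
theorem comp (hF : TubeHolo F) {A : (Fin m → ℂ) → (Fin n → ℂ)} (hc : Continuous A)
    (hA : ∀ a b, ∃ a' b', ∀ w : ℂ, A (a + w • b) = a' + w • b')
    (hm : ∀ z ∈ tube m, A z ∈ tube n) : TubeHolo fun z => F (A z) := by
  refine ⟨hF.1.comp hc.continuousOn hm, fun a b U hU h => ?_⟩
  obtain ⟨a', b', hab⟩ := hA a b
  simp only [hab]
  refine hF.2 a' b' U hU fun w hw => ?_
  rw [← hab]
  exact hm _ (h w hw)

theorem strip_line (hF : TubeHolo F) {a b : Fin n → ℂ} (h : ∀ w ∈ strip, a + w • b ∈ tube n) :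
    ContinuousOn (fun w : ℂ => F (a + w • b)) strip ∧
      DifferentiableOn ℂ (fun w : ℂ => F (a + w • b)) (interior strip) :=
  ⟨hF.1.comp (by fun_prop) h, hF.2 a b _ isOpen_interior fun w hw => h w (interior_subset hw)⟩

/-- Functions of this kind are determined by their values on `ℝⁿ`. -/
theorem eqOn (hF : TubeHolo F) (hG : TubeHolo G)
    (h : ∀ s : Fin n → ℝ, F (fun j => (s j : ℂ)) = G fun j => (s j : ℂ)) :
    Set.EqOn F G (tube n) := by
  intro z hz
  -- The line a + w b with b = Im z passes through z at w = i and is real for real w; it stays in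
  -- the tube for w in the strip because the simplex is star-shaped about 0.
  set a : Fin n → ℂ := fun j => ((z j).re : ℂ)
  set b : Fin n → ℂ := fun j => ((z j).im : ℂ)
  have hab : ∀ w ∈ strip, a + w • b ∈ tube n := by
    intro w hw
    have := smul_mem_orderSimplex hz hw.1 hw.2
    simpa [tube, a, b, Pi.smul_def] using this
  obtain ⟨h1, h2⟩ := hF.strip_line hab
  obtain ⟨h3, h4⟩ := hG.strip_line hab
  have := eqOn_strip h1 h2 h3 h4 (fun t => by
    have e : a + (t : ℂ) • b = fun j => (((z j).re + t * (z j).im : ℝ) : ℂ) := by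
      ext j; simp [a, b]
    simp only [e]
    exact h _) (x := Complex.I) (by simp [strip])
  have e : a + Complex.I • b = z := by
    ext j
    simp only [a, b, Pi.add_apply, Pi.smul_apply, smul_eq_mul]
    rw [mul_comm, Complex.re_add_im]
  simpa only [e] using this

theorem differentiableOn (hF : TubeHolo F) : DifferentiableOn ℂ F (interior (tube n)) := by
  refine differentiableOn_of_lines isOpen_interior (hF.1.mono interior_subset) fun a b => ?_
  refine hF.2 a b _ (isOpen_interior.preimage (by fun_prop)) fun w hw => ?_
  exact interior_subset hw

theorem isTubeContinuation (hF : TubeHolo F) {f : (Fin n → ℝ) → ℂ}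
    (h : ∀ s : Fin n → ℝ, F (fun j => (s j : ℂ)) = f s) : IsTubeContinuation f F :=
  ⟨hF.1, hF.differentiableOn, h⟩

/-- The maximum principle: the vertices of the simplex dominate. -/
theorem norm_le (hF : TubeHolo F) {C M : ℝ} (hC : ∀ z ∈ tube n, ‖F z‖ ≤ C)
    (hM : ∀ (i : Fin (n + 1)) (s : Fin n → ℝ), ‖F (cpt s (vtx i))‖ ≤ M) :
    ∀ z ∈ tube n, ‖F z‖ ≤ M := by
  -- Convexity of this set is the three-lines theorem on the strip joining two imaginary parts. The
  -- constant C enters only as the growth condition of Phragmén-Lindelöf, not in the conclusion.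
  set S : Set (Fin n → ℝ) := {u | u ∈ orderSimplex n ∧ ∀ s, ‖F (cpt s u)‖ ≤ M} with hS
  have hconv : Convex ℝ S := by
    rintro x ⟨hx, hx'⟩ y ⟨hy, hy'⟩ a b ha hb hab
    refine ⟨convex_orderSimplex n hx hy ha hb hab, fun s => ?_⟩
    have hab' : ∀ w ∈ strip, cpt s x + w • (fun j => ((y j - x j : ℝ) : ℂ)) ∈ tube n := by
      intro w hw
      have := convex_orderSimplex n hx hy (sub_nonneg.2 hw.2) hw.1 (by ring)
      have e : cpt s x + w • (fun j => ((y j - x j : ℝ) : ℂ)) =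
          cpt (fun j => s j + w.re * (y j - x j)) ((1 - w.im) • x + w.im • y) := by
        ext j
        apply Complex.ext <;> simp [cpt]
        ring
      rw [e, cpt_mem_tube]
      exact this
    obtain ⟨h1, h2⟩ := hF.strip_line hab'
    have hbI : (b * Complex.I : ℂ) ∈ strip := by
      constructor
      · simpa using hb
      · simp; linarith
    have := norm_le_of_strip_of_bounded h1 h2 (C := C) (M := M) (fun w hw => hC _ (hab' w hw))
      (fun t => ?_) (fun t => ?_) (b * Complex.I) hbI
    · have e : cpt s x + (b * Complex.I) • (fun j => ((y j - x j : ℝ) : ℂ)) =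
          cpt s (a • x + b • y) := by
        have ha' : a = 1 - b := by linarith
        ext j
        simp [cpt, ha']
        ring
      rwa [e] at this
    · have e : cpt s x + (t : ℂ) • (fun j => ((y j - x j : ℝ) : ℂ)) =
          cpt (fun j => s j + t * (y j - x j)) x := by
        ext j; simp [cpt]; ring
      rw [e]; exact hx' _
    · have e : cpt s x + ((t : ℂ) + Complex.I) • (fun j => ((y j - x j : ℝ) : ℂ)) =
          cpt (fun j => s j + t * (y j - x j)) y := by
        ext j; simp [cpt]; ring
      rw [e]; exact hy' _
  have hsub := orderSimplex_subset_of_convex hconv fun i => ⟨vtx_mem i, hM i⟩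
  intro z hz
  have := (hsub hz).2 fun j => (z j).re
  rwa [cpt_re_im] at this

theorem of_tendstoUniformlyOn {Fn : ℕ → (Fin n → ℂ) → ℂ} (hn : ∀ N, TubeHolo (Fn N))
    (h : TendstoUniformlyOn Fn F atTop (tube n)) : TubeHolo F := by
  refine ⟨h.continuousOn (Filter.Frequently.of_forall fun N => (hn N).1), fun a b U hU hab => ?_⟩
  have h1 : TendstoUniformlyOn (fun N w => Fn N (a + w • b)) (fun w : ℂ => F (a + w • b))
      atTop U := (h.comp fun w : ℂ => a + w • b).mono hab
  exact h1.tendstoLocallyUniformlyOn.differentiableOn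
    (Filter.Eventually.of_forall fun N => (hn N).2 a b U hU hab) hU

/-- Integrals over compact sets of affine pull-backs. -/
theorem integral {T : Type*} [TopologicalSpace T] [MeasurableSpace T] [OpensMeasurableSpace T]
    {μ : Measure T} [IsFiniteMeasureOnCompacts μ] {K : Set T} (hK : IsCompact K)
    (hKm : MeasurableSet K) (hF : TubeHolo F) {A : (Fin m → ℂ) → T → (Fin n → ℂ)}
    (hc : Continuous A.uncurry)
    (hA : ∀ t a b, ∃ a' b', ∀ w : ℂ, A (a + w • b) t = a' + w • b')
    (hm : ∀ z ∈ tube m, ∀ t ∈ K, A z t ∈ tube n) :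
    TubeHolo fun z => ∫ t in K, F (A z t) ∂μ := by
  have hj : ContinuousOn (fun p : (Fin m → ℂ) × T => F (A p.1 p.2)) (tube m ×ˢ K) :=
    hF.1.comp hc.continuousOn fun p hp => hm _ hp.1 _ hp.2
  -- Joint continuity on a compact product gives the constant that dominates the integrand near z.
  have hbound : ∀ z : Fin m → ℂ, ∃ C : ℝ, ∀ x ∈ Metric.closedBall z 1 ∩ tube m,
      ∀ t ∈ K, ‖F (A x t)‖ ≤ C := by
    intro z
    have hcpt : IsCompact ((Metric.closedBall z 1 ∩ tube m) ×ˢ K) :=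
      ((isCompact_closedBall z 1).inter_right (isClosed_tube m)).prod hK
    obtain ⟨C, hC⟩ := hcpt.exists_bound_of_continuousOn
      (hj.mono (Set.prod_mono Set.inter_subset_right subset_rfl))
    exact ⟨C, fun x hx t ht => hC (x, t) ⟨hx, ht⟩⟩
  have hmeas : ∀ z ∈ tube m, AEStronglyMeasurable (fun t => F (A z t)) (μ.restrict K) := by
    intro z hz
    refine ContinuousOn.aestronglyMeasurable ?_ hKm
    exact hj.comp (f := fun t => (z, t)) (by fun_prop) fun t ht => ⟨hz, ht⟩
  have hfin : IsFiniteMeasure (μ.restrict K) := ⟨by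
    rw [Measure.restrict_apply_univ]; exact hK.measure_lt_top⟩
  constructor
  · intro z hz
    obtain ⟨C, hC⟩ := hbound z
    refine continuousWithinAt_of_dominated (bound := fun _ => C) ?_ ?_ (integrable_const C) ?_
    · filter_upwards [self_mem_nhdsWithin] with x hx using hmeas x hx
    · filter_upwards [self_mem_nhdsWithin, mem_nhdsWithin_of_mem_nhds
        (Metric.closedBall_mem_nhds z one_pos)] with x hx hx'
      filter_upwards [ae_restrict_mem hKm] with t ht
      exact hC x ⟨hx', hx⟩ t ht
    · filter_upwards [ae_restrict_mem hKm] with t ht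
      exact (hj.comp (f := fun x => (x, t)) (by fun_prop) fun x hx => ⟨hx, ht⟩) z hz
  · intro a b U hU hab
    refine differentiableOn_integral_of_dominated hU (f := fun w t => F (A (a + w • b) t))
      (fun w hw => hmeas _ (hab w hw)) ?_ ?_
    · filter_upwards [ae_restrict_mem hKm] with t ht
      obtain ⟨a', b', h'⟩ := hA t a b
      simp only [h']
      refine hF.2 a' b' U hU fun w hw => ?_
      rw [← h']
      exact hm _ (hab w hw) t ht
    · intro w hw
      obtain ⟨C, hC⟩ := hbound (a + w • b)
      have hcont : Continuous fun x : ℂ => a + x • b := by fun_prop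
      obtain ⟨r, hr, hrb⟩ := Metric.continuousAt_iff.1 (hcont.continuousAt (x := w)) 1 one_pos
      refine ⟨r, hr, fun _ => C, integrable_const C, ?_⟩
      filter_upwards [ae_restrict_mem hKm] with t ht x hx
      exact hC _ ⟨Metric.mem_closedBall.2 (hrb hx.1).le, hab x hx.2⟩ t ht

end TubeHolo

/-! ### Interior of the tube and uniqueness of continuations -/

theorem interior_tube (n : ℕ) :
    interior (tube n) = (fun z : Fin n → ℂ => fun i => (z i).im) ⁻¹' interior (orderSimplex n) := by
  have h1 : IsOpenMap (fun z : Fin n → ℂ => fun i => (z i).im) :=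
    IsOpenMap.piMap (f := fun _ : Fin n => Complex.im) (fun _ => Complex.isOpenMap_im)
      (by simp [Complex.im_surjective])
  exact (h1.preimage_interior_eq_interior_preimage (by fun_prop) _).symm

theorem interior_orderSimplex_nonempty (n : ℕ) : (interior (orderSimplex n)).Nonempty := by
  -- Equally spaced points: strictly increasing and strictly between 0 and 1, both open conditions.
  refine ⟨fun i => ((i : ℝ) + 1) / (n + 1), ?_⟩
  rw [mem_interior_iff_mem_nhds]
  have h : ∀ᶠ u in 𝓝 (fun i : Fin n => ((i : ℝ) + 1) / (n + 1)),
      (∀ i j : Fin n, i < j → u i < u j) ∧ ∀ i, 0 < u i ∧ u i < 1 := by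
    have hn : (0 : ℝ) < n + 1 := by positivity
    refine Filter.Eventually.and ?_ ?_
    · rw [Filter.eventually_all]; intro i
      rw [Filter.eventually_all]; intro j
      by_cases hij : i < j
      · have : ((i : ℝ) + 1) / (n + 1) < ((j : ℝ) + 1) / (n + 1) := by
          have : (i : ℝ) < j := by exact_mod_cast hij
          gcongr
        have h2 := ((continuous_apply i).tendsto (fun i : Fin n => ((i : ℝ) + 1) / (n + 1))).eventually_lt
          ((continuous_apply j).tendsto _) this
        filter_upwards [h2] with u hu _ using hu
      · exact Filter.Eventually.of_forall fun u h => absurd h hij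
    · rw [Filter.eventually_all]; intro i
      have h0 : 0 < ((i : ℝ) + 1) / (n + 1) := by positivity
      have h1 : ((i : ℝ) + 1) / (n + 1) < 1 := by
        rw [div_lt_one hn]
        have : (i : ℝ) < n := by exact_mod_cast i.2
        linarith
      exact (((continuous_apply i).tendsto _).eventually_const_lt h0).and
        (((continuous_apply i).tendsto _).eventually_lt_const h1)
  filter_upwards [h] with u hu
  refine ⟨fun i j hij => ?_, fun i => ⟨(hu.2 i).1.le, (hu.2 i).2.le⟩⟩
  rcases hij.eq_or_lt with rfl | hlt
  · exact le_rfl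
  · exact (hu.1 i j hlt).le

theorem tube_subset_closure (n : ℕ) : tube n ⊆ closure (interior (tube n)) := by
  obtain ⟨u, hu⟩ := interior_orderSimplex_nonempty n
  have hne : (interior (tube n)).Nonempty := ⟨cpt 0 u, by
    rw [interior_tube]
    simpa [cpt] using hu⟩
  rw [(convex_tube n).closure_interior_eq_closure_of_nonempty_interior hne]
  exact subset_closure

/-- Here holomorphy is only given in the interior, so the line through z may not run in the
boundary. For z in the interior, w Im z with 0 < Im w stays inside, since a proper combination of an
interior point with 0 is interior; closed-tube points follow by density. -/
theorem IsTubeContinuation.eqOn {n : ℕ} {f : (Fin n → ℝ) → ℂ} {F G : (Fin n → ℂ) → ℂ}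
    (hF : IsTubeContinuation f F) (hG : IsTubeContinuation f G) : Set.EqOn F G (tube n) := by
  suffices h : Set.EqOn F G (interior (tube n)) from
    h.of_subset_closure hF.1 hG.1 interior_subset (tube_subset_closure n)
  intro z hz
  set a : Fin n → ℂ := fun j => ((z j).re : ℂ)
  set b : Fin n → ℂ := fun j => ((z j).im : ℂ)
  rw [interior_tube] at hz
  have hab : ∀ w ∈ strip, a + w • b ∈ tube n := by
    intro w hw
    have := smul_mem_orderSimplex (interior_subset hz) hw.1 hw.2
    simpa [tube, a, b, Pi.smul_def] using this
  have hab' : ∀ w ∈ interior strip, a + w • b ∈ interior (tube n) := by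
    intro w hw
    rw [interior_strip] at hw
    rw [interior_tube]
    have := (convex_orderSimplex n).combo_interior_self_mem_interior hz (zero_mem_orderSimplex n)
      hw.1 (sub_nonneg.2 hw.2.le) (by ring)
    simpa [a, b, Pi.smul_def] using this
  have hl : ∀ {F : (Fin n → ℂ) → ℂ}, IsTubeContinuation f F →
      ContinuousOn (fun w : ℂ => F (a + w • b)) strip ∧
      DifferentiableOn ℂ (fun w : ℂ => F (a + w • b)) (interior strip) := fun hF =>
    ⟨hF.1.comp (by fun_prop) hab, hF.2.comp (by fun_prop) hab'⟩
  have := eqOn_strip (hl hF).1 (hl hF).2 (hl hG).1 (hl hG).2 (fun t => by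
    have e : a + (t : ℂ) • b = fun j => (((z j).re + t * (z j).im : ℝ) : ℂ) := by
      ext j; simp [a, b]
    simp only [e]
    rw [hF.3, hG.3]) (x := Complex.I) (by simp [strip])
  have e : a + Complex.I • b = z := by
    ext j
    simp only [a, b, Pi.add_apply, Pi.smul_apply, smul_eq_mul]
    rw [mul_comm, Complex.re_add_im]
  simpa only [e] using this

theorem IsStripContinuation.eqOn {f : ℝ → ℂ} {F G : ℂ → ℂ} (hF : IsStripContinuation f F)
    (hG : IsStripContinuation f G) : Set.EqOn F G strip :=
  eqOn_strip hF.1 hF.2 hG.1 hG.2 fun t => by rw [hF.3, hG.3]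

/-! ### Gaussian regularization -/

/-- The normalized Gaussian kernel of width `1 / N`, on `ℂⁿ`. -/
def gaussC {n : ℕ} (N : ℝ) (z : Fin n → ℂ) : ℂ :=
  ∏ j, (((N / √Real.pi : ℝ) : ℂ) * Complex.exp (-(N * z j) ^ 2))

/-- The normalized Gaussian kernel of width `1 / N`, on `ℝⁿ`. -/
def gaussR {n : ℕ} (N : ℝ) (s : Fin n → ℝ) : ℝ :=
  ∏ j, (N / √Real.pi * Real.exp (-(N * s j) ^ 2))

section Gauss

variable {n : ℕ} {N : ℝ}

theorem gaussC_ofReal (s : Fin n → ℝ) : gaussC N (fun j => (s j : ℂ)) = gaussR N s := by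
  simp [gaussC, gaussR]

theorem gaussR_nonneg (hN : 0 < N) (s : Fin n → ℝ) : 0 ≤ gaussR N s :=
  Finset.prod_nonneg fun _ _ => by positivity

theorem continuous_gaussR : Continuous (gaussR N : (Fin n → ℝ) → ℝ) := by
  unfold gaussR; fun_prop

theorem differentiable_gaussC : Differentiable ℂ (gaussC N : (Fin n → ℂ) → ℂ) := by
  unfold gaussC; fun_prop

theorem integrable_gauss_factor {a : ℝ} (ha : 0 < a) (A : ℝ) :
    Integrable (fun s : Fin n → ℝ => ∏ j, (A * Real.exp (-a * s j ^ 2))) :=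
  Integrable.fintype_prod (f := fun _ : Fin n => fun x : ℝ => A * Real.exp (-a * x ^ 2))
    fun _ => (integrable_exp_neg_mul_sq ha).const_mul A

theorem integrable_gaussR (hN : 0 < N) : Integrable (gaussR N : (Fin n → ℝ) → ℝ) := by
  have := integrable_gauss_factor (n := n) (a := N ^ 2) (by positivity) (N / √Real.pi)
  refine this.congr (Filter.Eventually.of_forall fun s => ?_)
  simp [gaussR, mul_pow]

theorem integral_gaussR (hN : 0 < N) : ∫ s : Fin n → ℝ, gaussR N s = 1 := by
  have h := integral_fintype_prod_volume_eq_prod (𝕜 := ℝ)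
    (fun _ : Fin n => fun x : ℝ => N / √Real.pi * Real.exp (-(N * x) ^ 2))
  unfold gaussR
  rw [h, Finset.prod_eq_one]
  intro j _
  have e : (fun x : ℝ => Real.exp (-(N * x) ^ 2)) = fun x : ℝ => Real.exp (-N ^ 2 * x ^ 2) := by
    ext x; ring_nf
  rw [integral_const_mul, e, integral_gaussian, Real.sqrt_div Real.pi_pos.le,
    Real.sqrt_sq hN.le]
  have := Real.sqrt_pos.2 Real.pi_pos
  field_simp

theorem norm_gaussC_cpt (hN : 0 < N) (s u : Fin n → ℝ) :
    ‖gaussC N (cpt s u)‖ = gaussR N s * Real.exp (N ^ 2 * ∑ j, u j ^ 2) := by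
  rw [gaussC, norm_prod, Finset.mul_sum, Real.exp_sum, gaussR, ← Finset.prod_mul_distrib]
  refine Finset.prod_congr rfl fun j _ => ?_
  rw [norm_mul, Complex.norm_real, Real.norm_of_nonneg (by positivity), Complex.norm_exp, mul_assoc,
    ← Real.exp_add]
  congr 2
  simp [cpt, pow_two]
  ring

/-- An integrable majorant uniform for ‖z‖ ≤ R, from y² - (x - s)² ≤ R² - s²/2 when x² + y² ≤ R². It
serves dominated convergence. -/
theorem norm_gaussC_sub_le (hN : 0 < N) {R : ℝ} {z : Fin n → ℂ} (hz : ‖z‖ ≤ R) (s : Fin n → ℝ) :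
    ‖gaussC N (fun j => z j - s j)‖ ≤ ∏ j, (N / √Real.pi * Real.exp (N ^ 2 * R ^ 2) *
      Real.exp (-(N ^ 2 / 2) * s j ^ 2)) := by
  rw [gaussC, norm_prod]
  refine Finset.prod_le_prod (fun _ _ => norm_nonneg _) fun j _ => ?_
  rw [norm_mul, Complex.norm_real, Real.norm_of_nonneg (by positivity), Complex.norm_exp, mul_assoc,
    ← Real.exp_add]
  gcongr
  have h1 : ‖z j‖ ≤ R := (norm_le_pi_norm z j).trans hz
  have h2 : (z j).re ^ 2 + (z j).im ^ 2 ≤ R ^ 2 := by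
    have : ‖z j‖ ^ 2 = (z j).re ^ 2 + (z j).im ^ 2 := by
      rw [← Complex.normSq_eq_norm_sq, Complex.normSq_apply]; ring
    rw [← this]
    exact pow_le_pow_left₀ (norm_nonneg _) h1 2
  have h3 : (-(N * (z j - (s j : ℂ))) ^ 2 : ℂ).re =
      N ^ 2 * ((z j).im ^ 2 - ((z j).re - s j) ^ 2) := by
    simp [pow_two]; ring
  rw [h3]
  have h4 : (z j).im ^ 2 - ((z j).re - s j) ^ 2 ≤ R ^ 2 - s j ^ 2 / 2 := by
    nlinarith [sq_nonneg (2 * (z j).re - s j)]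
  calc N ^ 2 * ((z j).im ^ 2 - ((z j).re - s j) ^ 2) ≤ N ^ 2 * (R ^ 2 - s j ^ 2 / 2) := by gcongr
    _ = _ := by ring

/-- The convolution of `g` with the Gaussian kernel, as a function on `ℂⁿ`. -/
def gaussConv (g : (Fin n → ℝ) → ℂ) (N : ℝ) (z : Fin n → ℂ) : ℂ :=
  ∫ s, g s * gaussC N (fun j => z j - s j)

theorem gaussConv_ofReal (g : (Fin n → ℝ) → ℂ) (x : Fin n → ℝ) :
    gaussConv g N (fun j => (x j : ℂ)) = ∫ u, g (x - u) * gaussR N u := by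
  rw [← integral_sub_left_eq_self (fun u => g (x - u) * (gaussR N u : ℂ)) volume x, gaussConv]
  refine integral_congr_ae (Filter.Eventually.of_forall fun s => ?_)
  simp only [sub_sub_cancel, ← gaussC_ofReal]
  congr 2
  ext j
  simp

variable {g : (Fin n → ℝ) → ℂ} {M : ℝ}

/-- A crude bound that explodes with N; it only provides the boundedness required by
`TubeHolo.norm_le`. -/
theorem norm_gaussConv_le (hN : 0 < N) (hb : ∀ s, ‖g s‖ ≤ M) :
    ∀ z ∈ tube n, ‖gaussConv g N z‖ ≤ M * Real.exp (N ^ 2 * n) := by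
  intro z hz
  have hM : 0 ≤ M := (norm_nonneg _).trans (hb 0)
  set x : Fin n → ℝ := fun j => (z j).re
  set u : Fin n → ℝ := fun j => (z j).im
  have hu : ∑ j, u j ^ 2 ≤ n := by
    calc ∑ j, u j ^ 2 ≤ ∑ j : Fin n, (1 : ℝ) := by
          refine Finset.sum_le_sum fun j _ => ?_
          exact pow_le_one₀ (hz.2 j).1 (hz.2 j).2
      _ = n := by simp
  have hint : Integrable (fun s : Fin n → ℝ => gaussR N (x - s)) :=
    (integrable_gaussR hN).comp_sub_left x
  calc ‖gaussConv g N z‖ ≤ ∫ s, M * Real.exp (N ^ 2 * n) * gaussR N (x - s) := by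
        refine norm_integral_le_of_norm_le (hint.const_mul _)
          (Filter.Eventually.of_forall fun s => ?_)
        have e : (fun j => z j - (s j : ℂ)) = cpt (x - s) u := by
          ext j
          apply Complex.ext <;> simp [cpt, x, u]
        rw [norm_mul, e, norm_gaussC_cpt hN]
        calc ‖g s‖ * (gaussR N (x - s) * Real.exp (N ^ 2 * ∑ j, u j ^ 2))
            ≤ M * (gaussR N (x - s) * Real.exp (N ^ 2 * n)) := by
              have := gaussR_nonneg hN (x - s)
              gcongr
              exact hb s
          _ = _ := by ring
    _ = M * Real.exp (N ^ 2 * n) := by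
        rw [integral_const_mul, integral_sub_left_eq_self (fun s => gaussR N s) volume x,
          integral_gaussR hN, mul_one]

theorem tubeHolo_gaussConv (hN : 0 < N) (hg : Continuous g) (hb : ∀ s, ‖g s‖ ≤ M) :
    TubeHolo (gaussConv g N) := by
  have hM : 0 ≤ M := (norm_nonneg _).trans (hb 0)
  have hcont : Continuous fun p : (Fin n → ℂ) × (Fin n → ℝ) =>
      g p.2 * gaussC N (fun j => p.1 j - p.2 j) :=
    (hg.comp continuous_snd).mul (differentiable_gaussC.continuous.comp (by fun_prop))
  have hmeas : ∀ z : Fin n → ℂ,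
      AEStronglyMeasurable (fun s : Fin n → ℝ => g s * gaussC N (fun j => z j - s j)) volume :=
    fun z => (hcont.comp (by fun_prop : Continuous fun s : Fin n → ℝ => (z, s))).aestronglyMeasurable
  set b : ℝ → (Fin n → ℝ) → ℝ := fun R s =>
    M * ∏ j, (N / √Real.pi * Real.exp (N ^ 2 * R ^ 2) * Real.exp (-(N ^ 2 / 2) * s j ^ 2))
  have hbi : ∀ R, Integrable (b R) := fun R =>
    (integrable_gauss_factor (n := n) (a := N ^ 2 / 2) (by positivity)
      (N / √Real.pi * Real.exp (N ^ 2 * R ^ 2))).const_mul M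
  have hle : ∀ (z : Fin n → ℂ) (R : ℝ), ‖z‖ ≤ R → ∀ s : Fin n → ℝ,
      ‖g s * gaussC N (fun j => z j - s j)‖ ≤ b R s := by
    intro z R hz s
    rw [norm_mul]
    exact mul_le_mul (hb s) (norm_gaussC_sub_le hN hz s) (norm_nonneg _) hM
  have hball : ∀ z x : Fin n → ℂ, x ∈ Metric.ball z 1 → ‖x‖ ≤ ‖z‖ + 1 := by
    intro z x hx
    rw [Metric.mem_ball, dist_eq_norm] at hx
    have := norm_le_norm_add_norm_sub' x z
    linarith
  constructor
  · refine Continuous.continuousOn (continuous_iff_continuousAt.2 fun z => ?_)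
    refine continuousAt_of_dominated (bound := b (‖z‖ + 1))
      (Filter.Eventually.of_forall fun x => hmeas x) ?_ (hbi _) ?_
    · filter_upwards [Metric.ball_mem_nhds z one_pos] with x hx
      exact Filter.Eventually.of_forall fun s => hle x _ (hball z x hx) s
    · refine Filter.Eventually.of_forall fun s => ?_
      exact (hcont.comp (by fun_prop : Continuous fun x : Fin n → ℂ => (x, s))).continuousAt
  · intro a v U hU _
    refine differentiableOn_integral_of_dominated hU
      (f := fun w s => g s * gaussC N (fun j => (a + w • v) j - s j)) (fun w _ => hmeas _) ?_ ?_
    · refine Filter.Eventually.of_forall fun s => Differentiable.differentiableOn ?_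
      refine (differentiable_const _).mul (differentiable_gaussC.comp ?_)
      simp only [Pi.add_apply, Pi.smul_apply]
      fun_prop
    · intro w _
      have hc : Continuous fun x : ℂ => a + x • v := by fun_prop
      obtain ⟨r, hr, hrb⟩ := Metric.continuousAt_iff.1 (hc.continuousAt (x := w)) 1 one_pos
      exact ⟨r, hr, b (‖a + w • v‖ + 1), hbi _, Filter.Eventually.of_forall fun s x hx =>
        hle _ _ (hball _ _ (hrb hx.1)) s⟩

/-- With the kernel fixed and the width moved into the argument of h, one integrable majorant works
for all N. -/
theorem integral_mul_gaussR_scale (hN : 0 < N) (h : (Fin n → ℝ) → ℂ) :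
    ∫ u, h u * gaussR N u = ∫ v : Fin n → ℝ, h (N⁻¹ • v) * gaussR 1 v := by
  have := Measure.integral_comp_smul (volume : Measure (Fin n → ℝ))
    (fun u => h u * (gaussR N u : ℂ)) N⁻¹
  have e : ∀ v : Fin n → ℝ, gaussR N (N⁻¹ • v) = N ^ n * gaussR 1 v := by
    intro v
    simp only [gaussR, Pi.smul_apply, smul_eq_mul, mul_inv_cancel_left₀ hN.ne', one_mul]
    rw [← Fin.prod_const, ← Finset.prod_mul_distrib]
    exact Finset.prod_congr rfl fun j _ => by ring
  simp only [e, Module.finrank_fintype_fun_eq_card, Fintype.card_fin, inv_pow, inv_inv] at this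
  rw [abs_of_pos (by positivity)] at this
  have hNn : (N : ℂ) ^ n ≠ 0 := pow_ne_zero _ (by exact_mod_cast hN.ne')
  have e2 : (fun v : Fin n → ℝ => h (N⁻¹ • v) * ((N ^ n * gaussR 1 v : ℝ) : ℂ)) =
      fun v => (N : ℂ) ^ n * (h (N⁻¹ • v) * (gaussR 1 v : ℂ)) := by
    ext v; push_cast; ring
  rw [e2, integral_const_mul] at this
  have e3 : (N ^ n : ℝ) • ∫ u, h u * (gaussR N u : ℂ) = (N : ℂ) ^ n * ∫ u, h u * (gaussR N u : ℂ) := by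
    rw [Complex.real_smul]; push_cast; rfl
  rw [e3] at this
  exact (mul_left_cancel₀ hNn this).symm

/-- Gaussian regularizations converge uniformly. -/
theorem eventually_norm_gauss_sub_le (hg : UniformContinuous g) (hb : ∀ s, ‖g s‖ ≤ M) {ε : ℝ}
    (hε : 0 < ε) : ∀ᶠ k : ℕ in atTop, ∀ x,
      ‖(∫ u, g (x - u) * gaussR ((k : ℝ) + 1) u) - g x‖ ≤ ε := by
  -- Uniformity by contradiction: along a sequence of bad points x k dominated convergence still
  -- applies, since uniform continuity makes the integrand small regardless of where x k lies.
  by_contra hcon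
  rw [Filter.not_eventually] at hcon
  have hex : ∀ k : ℕ, ∃ x, (¬ ∀ x, ‖(∫ u, g (x - u) * gaussR ((k : ℝ) + 1) u) - g x‖ ≤ ε) →
      ε < ‖(∫ u, g (x - u) * gaussR ((k : ℝ) + 1) u) - g x‖ := by
    intro k
    by_cases h : ∀ x, ‖(∫ u, g (x - u) * gaussR ((k : ℝ) + 1) u) - g x‖ ≤ ε
    -- A dummy point for the good k, so that a whole sequence can be chosen.
    · exact ⟨0, fun h' => absurd h h'⟩
    · push Not at h
      obtain ⟨x, hx⟩ := h
      exact ⟨x, fun _ => hx⟩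
  choose x hx using hex
  have hgi := integrable_gaussR (n := n) one_pos
  have hlim : Tendsto (fun k : ℕ => ∫ v : Fin n → ℝ,
      (g (x k - ((k : ℝ) + 1)⁻¹ • v) - g (x k)) * gaussR 1 v) atTop
      (𝓝 (∫ v : Fin n → ℝ, (0 : ℂ))) := by
    refine tendsto_integral_of_dominated_convergence (fun v => 2 * M * gaussR 1 v) ?_
      (hgi.const_mul _) ?_ ?_
    · intro k
      refine Continuous.aestronglyMeasurable ?_
      have := continuous_gaussR (n := n) (N := 1)
      have := hg.continuous
      fun_prop
    · refine fun k => Filter.Eventually.of_forall fun v => ?_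
      rw [norm_mul, Complex.norm_real, Real.norm_of_nonneg (gaussR_nonneg one_pos v)]
      refine mul_le_mul_of_nonneg_right ((norm_sub_le _ _).trans ?_) (gaussR_nonneg one_pos v)
      linarith [hb (x k - ((k : ℝ) + 1)⁻¹ • v), hb (x k)]
    · refine Filter.Eventually.of_forall fun v => ?_
      have h0 : Tendsto (fun k : ℕ => g (x k - ((k : ℝ) + 1)⁻¹ • v) - g (x k)) atTop (𝓝 0) := by
        rw [Metric.tendsto_nhds]
        intro η hη
        obtain ⟨δ, hδ, hδ'⟩ := Metric.uniformContinuous_iff.1 hg η hη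
        have h1 : Tendsto (fun k : ℕ => ((k : ℝ) + 1)⁻¹ • v) atTop (𝓝 ((0 : ℝ) • v)) :=
          Tendsto.smul_const (by
            simpa using tendsto_one_div_add_atTop_nhds_zero_nat (𝕜 := ℝ)) v
        rw [zero_smul] at h1
        filter_upwards [(Metric.tendsto_nhds.1 h1) δ hδ] with k hk
        rw [dist_zero_right] at hk ⊢
        rw [← dist_eq_norm]
        apply hδ'
        rw [dist_eq_norm, sub_sub_cancel_left, norm_neg]
        exact hk
      simpa using h0.mul_const (gaussR 1 v : ℂ)
  rw [integral_zero] at hlim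
  have hev := (Metric.tendsto_nhds.1 hlim) ε hε
  obtain ⟨k, hk1, hk2⟩ := (hcon.and_eventually hev).exists
  have h1 := hx k hk1
  have hkp : (0 : ℝ) < (k : ℝ) + 1 := by positivity
  rw [integral_mul_gaussR_scale hkp (fun u => g (x k - u))] at h1
  have hi1 : Integrable fun v : Fin n → ℝ => g (x k - ((k : ℝ) + 1)⁻¹ • v) * (gaussR 1 v : ℂ) := by
    refine (hgi.const_mul M).mono' ?_ ?_
    · refine Continuous.aestronglyMeasurable ?_
      have := continuous_gaussR (n := n) (N := 1)
      have := hg.continuous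
      fun_prop
    · refine Filter.Eventually.of_forall fun v => ?_
      rw [norm_mul, Complex.norm_real, Real.norm_of_nonneg (gaussR_nonneg one_pos v)]
      exact mul_le_mul_of_nonneg_right (hb _) (gaussR_nonneg one_pos v)
  have hi2 : Integrable fun v : Fin n → ℝ => g (x k) * (gaussR 1 v : ℂ) := hgi.ofReal.const_mul _
  have e : ∫ v : Fin n → ℝ, g (x k) * (gaussR 1 v : ℂ) = g (x k) := by
    rw [integral_const_mul, integral_complex_ofReal, integral_gaussR one_pos]; simp
  rw [dist_zero_right] at hk2
  simp only [sub_mul] at hk2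
  rw [integral_sub hi1 hi2, e] at hk2
  exact absurd h1 (not_lt.2 hk2.le)

/-! ### Continuation along the edges of the simplex -/

/-- Continuation of `g` from `ℝⁿ` to `ℝⁿ + i v` along the direction `v`. -/
def HasEdge (v : Fin n → ℝ) (g g' : (Fin n → ℝ) → ℂ) : Prop :=
  ∀ s, ∃ f : ℂ → ℂ, ContinuousOn f strip ∧ DifferentiableOn ℂ f (interior strip) ∧
    (∀ t : ℝ, f t = g (s + t • v)) ∧ (∀ t : ℝ, f (t + Complex.I) = g' (s + t • v)) ∧
    ∃ (C : ℝ) (p : ℕ), ∀ z ∈ strip, ‖f z‖ ≤ C * (1 + |z.re|) ^ p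

/-- Two functions of w in the strip agree for real w, hence at w = i: the entire function at x + w
v, and the Gaussian average over u of the edge continuations based at x - u. -/
theorem gaussConv_cpt_of_hasEdge (hN : 0 < N) {g' : (Fin n → ℝ) → ℂ} (hg : UniformContinuous g)
    (hg' : UniformContinuous g') (hb : ∀ s, ‖g s‖ ≤ M) (hb' : ∀ s, ‖g' s‖ ≤ M) {v : Fin n → ℝ}
    (hv : v ∈ orderSimplex n) (hedge : HasEdge v g g') (x : Fin n → ℝ) :
    gaussConv g N (cpt x v) = ∫ u, g' (x - u) * gaussR N u := by
  choose f hfc hfd hf0 hf1 C p hfg using hedge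
  have hfb : ∀ s, ∀ w ∈ strip, ‖f s w‖ ≤ M := fun s =>
    norm_le_of_strip (hfc s) (hfd s) (hfg s) (fun t => by rw [hf0]; exact hb _)
      (fun t => by rw [hf1]; exact hb' _)
  -- Continuity in the base point, not assumed of the edge continuations: Phragmén-Lindelöf bounds
  -- the difference of two of them by its values on the two boundary lines, where uniform continuity
  -- of g and g' applies.
  have hcont : ∀ w ∈ strip, Continuous fun s => f s w := by
    intro w hw
    rw [Metric.continuous_iff]
    intro s ε hε
    obtain ⟨δ, hδ, h⟩ := Metric.uniformContinuous_iff.1 hg (ε / 2) (half_pos hε)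
    obtain ⟨δ', hδ', h'⟩ := Metric.uniformContinuous_iff.1 hg' (ε / 2) (half_pos hε)
    refine ⟨min δ δ', lt_min hδ hδ', fun s' hs' => ?_⟩
    have hdist : ∀ t : ℝ, dist (s' + t • v) (s + t • v) = dist s' s := fun t => dist_add_right _ _ _
    rw [dist_eq_norm]
    refine lt_of_le_of_lt (norm_le_of_strip_of_bounded ((hfc s').sub (hfc s))
      ((hfd s').sub (hfd s)) (C := 2 * M) (M := ε / 2) ?_ ?_ ?_ w hw) (half_lt_self hε)
    · intro z hz
      exact (norm_sub_le _ _).trans (by linarith [hfb s' z hz, hfb s z hz])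
    · intro t
      rw [Pi.sub_apply, hf0, hf0, ← dist_eq_norm]
      exact (h (by rw [hdist]; exact hs'.trans_le (min_le_left _ _))).le
    · intro t
      rw [Pi.sub_apply, hf1, hf1, ← dist_eq_norm]
      exact (h' (by rw [hdist]; exact hs'.trans_le (min_le_right _ _))).le
  have hgi := integrable_gaussR (n := n) hN
  have hgc := continuous_gaussR (n := n) (N := N)
  have hmeas : ∀ w ∈ strip,
      AEStronglyMeasurable (fun u => f (x - u) w * (gaussR N u : ℂ)) volume := by
    intro w hw
    refine Continuous.aestronglyMeasurable ?_
    exact ((hcont w hw).comp (by fun_prop)).mul (Complex.continuous_ofReal.comp hgc)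
  have hbd : ∀ w ∈ strip, ∀ u, ‖f (x - u) w * (gaussR N u : ℂ)‖ ≤ M * gaussR N u := by
    intro w hw u
    rw [norm_mul, Complex.norm_real, Real.norm_of_nonneg (gaussR_nonneg hN u)]
    exact mul_le_mul_of_nonneg_right (hfb _ w hw) (gaussR_nonneg hN u)
  have hQc : ContinuousOn (fun w => ∫ u, f (x - u) w * (gaussR N u : ℂ)) strip := by
    refine continuousOn_of_dominated (bound := fun u => M * gaussR N u) hmeas
      (fun w hw => Filter.Eventually.of_forall (hbd w hw)) (hgi.const_mul M) ?_
    exact Filter.Eventually.of_forall fun u => (hfc _).mul continuousOn_const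
  have hQd : DifferentiableOn ℂ (fun w => ∫ u, f (x - u) w * (gaussR N u : ℂ))
      (interior strip) := by
    refine differentiableOn_integral_of_dominated isOpen_interior
      (fun w hw => hmeas w (interior_subset hw)) ?_ ?_
    · exact Filter.Eventually.of_forall fun u => (hfd _).mul (differentiableOn_const _)
    · exact fun w _ => ⟨1, one_pos, _, hgi.const_mul M, Filter.Eventually.of_forall
        fun u w hw => hbd w (interior_subset hw.2) u⟩
  have hab : ∀ w ∈ strip, (fun j => (x j : ℂ)) + w • (fun j => (v j : ℂ)) ∈ tube n := by
    intro w hw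
    have := smul_mem_orderSimplex hv hw.1 hw.2
    simpa [tube, Pi.smul_def] using this
  obtain ⟨hPc, hPd⟩ := (tubeHolo_gaussConv hN hg.continuous hb).strip_line hab
  have := eqOn_strip hPc hPd hQc hQd (fun t => ?_) (x := Complex.I) (by simp [strip])
  · have e : (fun j => (x j : ℂ)) + Complex.I • (fun j => (v j : ℂ)) = cpt x v := by
      ext j; simp [cpt, mul_comm]
    simp only [e] at this
    rw [this]
    refine integral_congr_ae (Filter.Eventually.of_forall fun u => ?_)
    have h := hf1 (x - u) 0
    simp only [Complex.ofReal_zero, zero_add, zero_smul, add_zero] at h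
    simp only [h]
  · have e : (fun j => (x j : ℂ)) + (t : ℂ) • (fun j => (v j : ℂ)) =
        fun j => (((x + t • v) j : ℝ) : ℂ) := by
      ext j; simp
    simp only [e, gaussConv_ofReal, hf0]
    refine integral_congr_ae (Filter.Eventually.of_forall fun u => ?_)
    simp only [add_sub_right_comm]

end Gauss

/-- A function on `ℝⁿ` that continues along all edges of the simplex from the origin continues to
the tube. -/
theorem exists_tubeHolo_of_hasEdge {n : ℕ} {M : ℝ} (g : Fin (n + 1) → (Fin n → ℝ) → ℂ)
    (hg : ∀ i, UniformContinuous (g i)) (hb : ∀ i s, ‖g i s‖ ≤ M)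
    (hedge : ∀ i, HasEdge (vtx i) (g (Fin.last n)) (g i)) :
    ∃ F : (Fin n → ℂ) → ℂ, TubeHolo F ∧ (∀ i s, F (cpt s (vtx i)) = g i s) ∧
      ∀ z ∈ tube n, ‖F z‖ ≤ M := by
  have hM : 0 ≤ M := (norm_nonneg _).trans (hb 0 0)
  set Fn : ℕ → (Fin n → ℂ) → ℂ := fun k => gaussConv (g (Fin.last n)) ((k : ℝ) + 1) with hFn
  have hk : ∀ k : ℕ, (0 : ℝ) < (k : ℝ) + 1 := fun k => by positivity
  have hholo : ∀ k, TubeHolo (Fn k) := fun k =>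
    tubeHolo_gaussConv (hk k) (hg _).continuous (hb _)
  have hvert : ∀ k i s, Fn k (cpt s (vtx i)) = ∫ u, g i (s - u) * gaussR ((k : ℝ) + 1) u :=
    fun k i s => gaussConv_cpt_of_hasEdge (hk k) (hg _) (hg i) (hb _) (hb i) (vtx_mem i)
      (hedge i) s
  -- Over a vertex the regularization averages values bounded by M, so the bound does not depend on
  -- k.
  have hbdd : ∀ k, ∀ z ∈ tube n, ‖Fn k z‖ ≤ M := by
    intro k
    refine (hholo k).norm_le (norm_gaussConv_le (hk k) (hb _)) fun i s => ?_
    rw [hvert]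
    calc _ ≤ ∫ u : Fin n → ℝ, M * gaussR ((k : ℝ) + 1) u := by
          refine norm_integral_le_of_norm_le ((integrable_gaussR (hk k)).const_mul M)
            (Filter.Eventually.of_forall fun u => ?_)
          rw [norm_mul, Complex.norm_real, Real.norm_of_nonneg (gaussR_nonneg (hk k) u)]
          exact mul_le_mul_of_nonneg_right (hb i _) (gaussR_nonneg (hk k) u)
      _ = M := by rw [integral_const_mul, integral_gaussR (hk k), mul_one]
  have hconv : ∀ ε > 0, ∀ᶠ k : ℕ in atTop, ∀ i s, ‖Fn k (cpt s (vtx i)) - g i s‖ ≤ ε := by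
    intro ε hε
    rw [Filter.eventually_all]
    intro i
    filter_upwards [eventually_norm_gauss_sub_le (hg i) (hb i) hε] with k hk s
    rw [hvert]
    exact hk s
  have hcauchy : UniformCauchySeqOn Fn atTop (tube n) := by
    rw [Metric.uniformCauchySeqOn_iff]
    intro ε hε
    obtain ⟨K, hK⟩ := Filter.eventually_atTop.1 (hconv (ε / 4) (by linarith))
    refine ⟨K, fun k hk l hl z hz => ?_⟩
    rw [dist_eq_norm]
    -- Uniform convergence over the finitely many vertices becomes a uniform Cauchy estimate on the
    -- whole tube.
    refine lt_of_le_of_lt (((hholo k).sub (hholo l)).norm_le (C := 2 * M) (M := ε / 2) ?_ ?_ z hz)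
      (half_lt_self hε)
    · intro z hz
      exact (norm_sub_le _ _).trans (by linarith [hbdd k z hz, hbdd l z hz])
    · intro i s
      have e : Fn k (cpt s (vtx i)) - Fn l (cpt s (vtx i)) =
          (Fn k (cpt s (vtx i)) - g i s) - (Fn l (cpt s (vtx i)) - g i s) := by ring
      rw [e]
      exact (norm_sub_le _ _).trans (by linarith [hK k hk i s, hK l hl i s])
  have hlim : ∀ z ∈ tube n, ∃ y, Tendsto (fun k => Fn k z) atTop (𝓝 y) := fun z hz =>
    cauchySeq_tendsto_of_complete (hcauchy.cauchySeq hz)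
  choose! F hF using hlim
  have hunif := hcauchy.tendstoUniformlyOn_of_tendsto hF
  refine ⟨F, TubeHolo.of_tendstoUniformlyOn hholo hunif, fun i s => ?_, fun z hz => ?_⟩
  · refine tendsto_nhds_unique (hF _ (cpt_mem_tube.2 (vtx_mem i))) ?_
    rw [Metric.tendsto_nhds]
    intro ε hε
    filter_upwards [hconv (ε / 2) (half_pos hε)] with k hk
    rw [dist_eq_norm]
    exact (hk i s).trans_lt (half_lt_self hε)
  · exact le_of_tendsto (hF z hz).norm (Filter.Eventually.of_forall fun k => hbdd k z hz)

/-! ### Integration over the simplex -/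

section Simplex

variable {n : ℕ}

theorem measurableSet_orderSimplex (n : ℕ) : MeasurableSet (orderSimplex n) :=
  (isClosed_orderSimplex n).measurableSet

theorem lo_le_hi {u : Fin n → ℝ} (hu : u ∈ orderSimplex n) (k : Fin (n + 1)) : lo u k ≤ hi u k :=
  sub_nonneg.1 (mem_orderSimplex_iff.1 hu k)

/-- The fibres of the simplex in the direction of the k-th coordinate are the intervals between its
neighbours, with 0 and 1 as outermost neighbours. -/
theorem insertNth_mem_orderSimplex {k : Fin (n + 1)} {t : ℝ} {v : Fin n → ℝ} :
    (Fin.insertNth k t v : Fin (n + 1) → ℝ) ∈ orderSimplex (n + 1) ↔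
      v ∈ orderSimplex n ∧ t ∈ Set.Icc (lo v k) (hi v k) := by
  set s : Fin (n + 1) → ℝ := Fin.insertNth k t v with hs
  have hsk : s k = t := by simp [hs]
  have hsv : ∀ j, s (k.succAbove j) = v j := fun j => by simp [hs]
  constructor
  · rintro ⟨hm, hb⟩
    refine ⟨⟨fun i j hij => ?_, fun j => ?_⟩, ?_, ?_⟩
    · rw [← hsv, ← hsv]
      exact hm (Fin.succAbove_le_succAbove_iff.2 hij)
    · rw [← hsv]; exact hb _
    · revert hsk hsv
      refine Fin.cases ?_ (fun j => ?_) k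
      · intro h1 _; rw [lo_zero, ← h1]; exact (hb _).1
      · intro h1 h2
        rw [lo_succ, ← h1, ← h2, Fin.succAbove_succ_self]
        exact hm (Fin.castSucc_lt_succ).le
    · revert hsk hsv
      refine Fin.lastCases ?_ (fun j => ?_) k
      · intro h1 _; rw [hi_last, ← h1]; exact (hb _).2
      · intro h1 h2
        rw [hi_castSucc, ← h1, ← h2, Fin.succAbove_castSucc_self]
        exact hm (Fin.castSucc_lt_succ).le
  · rintro ⟨hv, h1, h2⟩
    have hlo : ∀ p : Fin n, p.castSucc < k → v p ≤ lo v k := by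
      intro p
      refine Fin.cases ?_ (fun j => ?_) k
      · intro h; exact absurd h (Fin.not_lt_zero _)
      · intro h; rw [lo_succ]
        exact hv.1 (Fin.castSucc_lt_succ_iff.1 h)
    have hhi : ∀ p : Fin n, k ≤ p.castSucc → hi v k ≤ v p := by
      intro p
      refine Fin.lastCases ?_ (fun j => ?_) k
      · intro h; exact absurd h (not_le.2 (Fin.castSucc_lt_last p))
      · intro h; rw [hi_castSucc]
        exact hv.1 (Fin.castSucc_le_castSucc_iff.1 h)
    have hlo0 : 0 ≤ lo v k := by
      refine Fin.cases ?_ (fun j => ?_) k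
      · simp
      · rw [lo_succ]; exact (hv.2 j).1
    have hhi1 : hi v k ≤ 1 := by
      refine Fin.lastCases ?_ (fun j => ?_) k
      · simp
      · rw [hi_castSucc]; exact (hv.2 j).2
    refine ⟨fun a b hab => ?_, fun a => ?_⟩
    · rcases Fin.eq_self_or_eq_succAbove k a with rfl | ⟨p, rfl⟩
      · rcases Fin.eq_self_or_eq_succAbove a b with rfl | ⟨q, rfl⟩
        · exact le_rfl
        · rw [hsk, hsv]
          refine h2.trans (hhi q ?_)
          have : a < a.succAbove q := lt_of_le_of_ne hab (Fin.succAbove_ne a q).symm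
          exact (Fin.lt_succAbove_iff_le_castSucc _ _).1 this
      · rcases Fin.eq_self_or_eq_succAbove k b with rfl | ⟨q, rfl⟩
        · rw [hsk, hsv]
          refine (hlo p ?_).trans h1
          have : b.succAbove p < b := lt_of_le_of_ne hab (Fin.succAbove_ne b p)
          exact (Fin.succAbove_lt_iff_castSucc_lt _ _).1 this
        · rw [hsv, hsv]
          exact hv.1 (Fin.succAbove_le_succAbove_iff.1 hab)
    · rcases Fin.eq_self_or_eq_succAbove k a with rfl | ⟨p, rfl⟩
      · rw [hsk]; exact ⟨hlo0.trans h1, h2.trans hhi1⟩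
      · rw [hsv]; exact hv.2 p

/-- Fubini's theorem on the simplex, with the `k`-th coordinate integrated first. -/
theorem setIntegral_orderSimplex_succ (k : Fin (n + 1)) {f : (Fin (n + 1) → ℝ) → ℂ}
    (hf : IntegrableOn f (orderSimplex (n + 1))) :
    ∫ s in orderSimplex (n + 1), f s =
      ∫ v in orderSimplex n, ∫ t in (lo v k)..(hi v k), f (Fin.insertNth k t v) := by
  have he := (volume_preserving_piFinSuccAbove (fun _ : Fin (n + 1) => ℝ) k).symm
  have hsymm : ∀ p : ℝ × (Fin n → ℝ),
      (MeasurableEquiv.piFinSuccAbove (fun _ : Fin (n + 1) => ℝ) k).symm p =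
        Fin.insertNth k p.1 p.2 := fun p => rfl
  set g : (Fin (n + 1) → ℝ) → ℂ := (orderSimplex (n + 1)).indicator f with hg
  have hgi : Integrable g := hf.integrable_indicator (measurableSet_orderSimplex _)
  rw [← integral_indicator (measurableSet_orderSimplex _), ← hg,
    ← he.integral_comp (MeasurableEquiv.measurableEmbedding _)]
  simp only [hsymm]
  have hgi' : Integrable (fun p : ℝ × (Fin n → ℝ) => g (Fin.insertNth k p.1 p.2))
      ((volume : Measure ℝ).prod volume) :=
    (he.integrable_comp_emb (MeasurableEquiv.measurableEmbedding _)).2 hgi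
  change ∫ p : ℝ × (Fin n → ℝ), g (Fin.insertNth k p.1 p.2) ∂((volume : Measure ℝ).prod volume) = _
  rw [integral_prod_symm _ hgi', ← integral_indicator (measurableSet_orderSimplex _)]
  refine integral_congr_ae (Filter.Eventually.of_forall fun v => ?_)
  simp only
  by_cases hv : v ∈ orderSimplex n
  · rw [Set.indicator_of_mem hv, intervalIntegral.integral_of_le (lo_le_hi hv k),
      ← integral_Icc_eq_integral_Ioc, ← integral_indicator measurableSet_Icc]
    refine integral_congr_ae (Filter.Eventually.of_forall fun t => ?_)
    by_cases ht : t ∈ Set.Icc (lo v k) (hi v k)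
    · rw [Set.indicator_of_mem ht]
      exact Set.indicator_of_mem (insertNth_mem_orderSimplex.2 ⟨hv, ht⟩) f
    · rw [Set.indicator_of_notMem ht]
      exact Set.indicator_of_notMem (fun h => ht (insertNth_mem_orderSimplex.1 h).2) f
  · rw [Set.indicator_of_notMem hv]
    simp [hg, insertNth_mem_orderSimplex, hv]

theorem continuous_lo (k : Fin (n + 1)) : Continuous fun u : Fin n → ℝ => lo u k := by
  refine Fin.cases ?_ (fun j => ?_) k
  · simpa using continuous_const
  · simpa using continuous_apply j

theorem continuous_hi (k : Fin (n + 1)) : Continuous fun u : Fin n → ℝ => hi u k := by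
  refine Fin.lastCases ?_ (fun j => ?_) k
  · simpa using continuous_const
  · simpa using continuous_apply j

theorem continuous_gap (k : Fin (n + 1)) : Continuous (gap k : (Fin n → ℝ) → ℝ) :=
  (continuous_hi k).sub (continuous_lo k)

/-- Functions that do not depend on the last coordinate. -/
theorem setIntegral_orderSimplex_init {f : (Fin (n + 1) → ℝ) → ℂ}
    (hf : IntegrableOn f (orderSimplex (n + 1))) {g : (Fin n → ℝ) → ℂ}
    (h : ∀ s ∈ orderSimplex (n + 1), f s = g (fun j => s j.castSucc)) :
    ∫ s in orderSimplex (n + 1), f s = ∫ v in orderSimplex n, gap (Fin.last n) v * g v := by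
  rw [setIntegral_orderSimplex_succ (Fin.last n) hf]
  refine setIntegral_congr_fun (measurableSet_orderSimplex n) fun v hv => ?_
  have : ∫ t in (lo v (Fin.last n))..(hi v (Fin.last n)), f (Fin.insertNth (Fin.last n) t v) =
      ∫ _t in (lo v (Fin.last n))..(hi v (Fin.last n)), g v := by
    refine intervalIntegral.integral_congr fun t ht => ?_
    rw [Set.uIcc_of_le (lo_le_hi hv _)] at ht
    rw [h _ (insertNth_mem_orderSimplex.2 ⟨hv, ht⟩)]
    congr 1
    ext j
    simp [Fin.insertNth_last']
  simp only [this]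
  rw [intervalIntegral.integral_const, Complex.real_smul, gap]

/-! ### The cyclic rotation of the simplex -/

/-- The linear part of the rotation of the simplex. -/
def rotLin (n : ℕ) : (Fin n → ℝ) →ₗ[ℝ] (Fin n → ℝ) where
  toFun u j := lo u j.castSucc - lo u (Fin.last n)
  map_add' u v := by
    have h : ∀ i, lo (u + v) i = lo u i + lo v i := fun i => by
      refine Fin.cases ?_ (fun j => ?_) i <;> simp
    ext j; simp only [h, Pi.add_apply]; ring
  map_smul' c u := by
    have h : ∀ i, lo (c • u) i = c * lo u i := fun i => by
      refine Fin.cases ?_ (fun j => ?_) i <;> simp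
    ext j; simp only [h, Pi.smul_apply, smul_eq_mul, RingHom.id_apply]; ring

/-- The rotation of the simplex that permutes the gaps cyclically. -/
def rot (u : Fin n → ℝ) : Fin n → ℝ := fun j => 1 - lo u (Fin.last n) + lo u j.castSucc

/-- With the time 0 put in front, the rotation is a cyclic shift of indices followed by a
translation that makes the entry at 0 vanish again; index -1 is the last one. -/
theorem lo_rotLin (u : Fin n → ℝ) (i : Fin (n + 1)) :
    lo (rotLin n u) i = lo u (i - 1) - lo u (-1) := by
  refine Fin.cases ?_ (fun j => ?_) i
  · simp
  · have h1 : (j.succ - 1 : Fin (n + 1)) = j.castSucc := by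
      rw [← Fin.coeSucc_eq_succ, add_sub_cancel_right]
    have h2 : (-1 : Fin (n + 1)) = Fin.last n :=
      neg_eq_of_add_eq_zero_left (Fin.last_add_one n)
    rw [lo_succ, h1, h2]
    rfl

theorem lo_rotLin_pow (u : Fin n → ℝ) (k : ℕ) (i : Fin (n + 1)) :
    lo ((rotLin n ^ k) u) i = lo u (i - k • 1) - lo u (-(k • 1)) := by
  induction k generalizing i with
  | zero => rw [pow_zero, zero_smul, sub_zero, neg_zero, lo_zero, sub_zero]; rfl
  | succ k ih =>
    rw [pow_succ', Module.End.mul_apply, lo_rotLin, ih, ih]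
    have e1 : i - 1 - k • (1 : Fin (n + 1)) = i - (k + 1) • 1 := by rw [succ_nsmul]; abel
    have e2 : (-1 : Fin (n + 1)) - k • (1 : Fin (n + 1)) = -((k + 1) • 1) := by
      rw [succ_nsmul]; abel
    rw [e1, e2]
    ring

theorem rotLin_pow (n : ℕ) : rotLin n ^ (n + 1) = 1 := by
  refine LinearMap.ext fun u => funext fun j => ?_
  have h0 : (n + 1) • (1 : Fin (n + 1)) = 0 := by
    simpa using card_nsmul_eq_zero (x := (1 : Fin (n + 1)))
  have := lo_rotLin_pow u (n + 1) j.succ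
  rw [h0, sub_zero, neg_zero, lo_zero, sub_zero, lo_succ, lo_succ] at this
  exact this

theorem injective_rotLin (n : ℕ) : Function.Injective (rotLin n) := by
  intro u v h
  have : (rotLin n ^ (n + 1)) u = (rotLin n ^ (n + 1)) v := by
    rw [pow_succ, Module.End.mul_apply, Module.End.mul_apply, h]
  simpa [rotLin_pow] using this

theorem rot_eq (u : Fin n → ℝ) : rot u = rotLin n u + fun _ => 1 := by
  ext j
  simp only [rot, rotLin, LinearMap.coe_mk, AddHom.coe_mk, Pi.add_apply]
  ring

theorem continuous_rot : Continuous (rot : (Fin n → ℝ) → Fin n → ℝ) :=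
  continuous_pi fun _ => (continuous_const.sub (continuous_lo _)).add (continuous_lo _)

theorem injective_rot : Function.Injective (rot : (Fin n → ℝ) → Fin n → ℝ) := by
  intro u v h
  rw [rot_eq, rot_eq] at h
  exact injective_rotLin n (add_right_cancel h)

/-- The linear part has finite order n + 1, so its determinant has absolute value 1. -/
theorem measurePreserving_rot :
    MeasurePreserving (rot : (Fin n → ℝ) → Fin n → ℝ) volume volume := by
  have hdet : |LinearMap.det (rotLin n)| = 1 := by
    have : |LinearMap.det (rotLin n)| ^ (n + 1) = 1 := by
      rw [← abs_pow, ← map_pow, rotLin_pow, map_one, abs_one]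
    exact (pow_eq_one_iff_of_nonneg (abs_nonneg _) (Nat.succ_ne_zero n)).1 this
  have hdet0 : LinearMap.det (rotLin n) ≠ 0 := by
    intro h; rw [h] at hdet; simp at hdet
  have h1 : MeasurePreserving (rotLin n) volume volume := by
    refine ⟨(LinearMap.continuous_of_finiteDimensional _).measurable, ?_⟩
    rw [Real.map_linearMap_volume_pi_eq_smul_volume_pi hdet0, abs_inv, hdet]
    simp
  have h2 := measurePreserving_add_right (volume : Measure (Fin n → ℝ)) (fun _ => (1 : ℝ))
  have e : (rot : (Fin n → ℝ) → Fin n → ℝ) = (fun x => x + fun _ => (1 : ℝ)) ∘ rotLin n := by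
    ext u; simp [rot_eq]
  rw [e]
  exact h2.comp h1

theorem hi_rot (u : Fin n → ℝ) (i : Fin (n + 1)) :
    hi (rot u) i = 1 - lo u (Fin.last n) + lo u i := by
  refine Fin.lastCases ?_ (fun j => ?_) i
  · simp
  · rw [hi_castSucc]; rfl

theorem gap_rot (u : Fin n → ℝ) (i : Fin (n + 1)) : gap (i + 1) (rot u) = gap i u := by
  rw [gap, hi_rot]
  refine Fin.lastCases ?_ (fun j => ?_) i
  · rw [Fin.last_add_one, lo_zero, lo_zero, gap, hi_last]; ring
  · rw [Fin.coeSucc_eq_succ, lo_succ, lo_succ, gap, hi_castSucc, rot]; ring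

theorem rot_mem_orderSimplex {u : Fin n → ℝ} : rot u ∈ orderSimplex n ↔ u ∈ orderSimplex n := by
  rw [mem_orderSimplex_iff, mem_orderSimplex_iff]
  constructor
  · intro h i; rw [← gap_rot]; exact h _
  · intro h i
    have := gap_rot u (i - 1)
    rw [sub_add_cancel] at this
    rw [this]; exact h _

theorem setIntegral_rot (h : (Fin n → ℝ) → ℂ) :
    ∫ u in orderSimplex n, h (rot u) = ∫ u in orderSimplex n, h u := by
  have := (measurePreserving_rot (n := n)).setIntegral_preimage_emb
    (continuous_rot.measurableEmbedding injective_rot) h (orderSimplex n)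
  rw [← this]
  congr 2
  ext u
  exact rot_mem_orderSimplex.symm

theorem setIntegral_gap_rot (i : Fin (n + 1)) (h : (Fin n → ℝ) → ℂ) :
    ∫ u in orderSimplex n, gap i u * h (rot u) = ∫ u in orderSimplex n, gap (i + 1) u * h u := by
  rw [← setIntegral_rot fun u => (gap (i + 1) u : ℂ) * h u]
  simp only [gap_rot]

theorem integrableOn_orderSimplex {f : (Fin n → ℝ) → ℂ} (hf : ContinuousOn f (orderSimplex n)) :
    IntegrableOn f (orderSimplex n) :=
  hf.integrableOn_compact (isCompact_orderSimplex n)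

theorem sum_setIntegral_gap {h : (Fin n → ℝ) → ℂ} (hh : ContinuousOn h (orderSimplex n)) :
    ∑ i, ∫ u in orderSimplex n, gap i u * h u = ∫ u in orderSimplex n, h u := by
  rw [← integral_finsetSum]
  · refine integral_congr_ae (Filter.Eventually.of_forall fun u => ?_)
    simp only [← Finset.sum_mul, ← Complex.ofReal_sum, sum_gap, Complex.ofReal_one, one_mul]
  · intro i _
    exact integrableOn_orderSimplex
      ((Complex.continuous_ofReal.comp (continuous_gap i)).continuousOn.mul hh)

/-- The rotation preserves volume and permutes the gaps transitively. -/
theorem setIntegral_gap_const (i : Fin (n + 1)) :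
    ∫ u in orderSimplex n, (gap i u : ℂ) = ∫ u in orderSimplex n, (gap 0 u : ℂ) := by
  have hstep : ∀ i : Fin (n + 1), ∫ u in orderSimplex n, (gap (i + 1) u : ℂ) =
      ∫ u in orderSimplex n, (gap i u : ℂ) := fun i => by
    simpa using (setIntegral_gap_rot i (fun _ => 1)).symm
  induction i using Fin.induction with
  | zero => rfl
  | succ i ih => rw [← Fin.coeSucc_eq_succ, hstep, ih]

/-- Integrating out the last coordinate of the simplex in dimension n + 1 leaves the integral of one
gap. The n + 1 gaps have equal integrals and sum to 1, so each step divides the volume by n + 1. -/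
theorem setIntegral_orderSimplex_one (n : ℕ) :
    ∫ _u in orderSimplex n, (1 : ℂ) = 1 / (n.factorial : ℂ) := by
  induction n with
  | zero =>
    have : orderSimplex 0 = Set.univ := by
      ext u; simp only [Set.mem_univ, iff_true]
      exact ⟨fun i => i.elim0, fun i => i.elim0⟩
    rw [this]
    simp [Measure.real, volume_pi, Measure.pi_empty_univ]
  | succ n ih =>
    have h1 := setIntegral_orderSimplex_init (n := n) (f := fun _ => 1) (g := fun _ => 1)
      (integrableOn_orderSimplex continuousOn_const) fun _ _ => rfl
    simp only [mul_one] at h1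
    have h2 := sum_setIntegral_gap (n := n) (h := fun _ => 1) continuousOn_const
    simp only [mul_one, setIntegral_gap_const, Finset.sum_const, Finset.card_univ,
      Fintype.card_fin, nsmul_eq_mul] at h2
    rw [h1, setIntegral_gap_const]
    rw [ih] at h2
    rw [Nat.factorial_succ]
    have h3 : ((n + 1 : ℕ) : ℂ) ≠ 0 := by exact_mod_cast Nat.succ_ne_zero n
    have h4 : (n.factorial : ℂ) ≠ 0 := by exact_mod_cast n.factorial_ne_zero
    rw [Nat.cast_mul, eq_div_iff (mul_ne_zero h3 h4)]
    rw [eq_div_iff h4] at h2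
    linear_combination h2

theorem volume_real_orderSimplex (n : ℕ) :
    (volume : Measure (Fin n → ℝ)).real (orderSimplex n) = 1 / n.factorial := by
  have := setIntegral_orderSimplex_one n
  rw [setIntegral_const] at this
  have h : (((volume : Measure (Fin n → ℝ)).real (orderSimplex n) : ℝ) : ℂ) =
      ((1 / n.factorial : ℝ) : ℂ) := by
    push_cast
    rw [← this]; simp
  exact_mod_cast h

theorem norm_setIntegral_orderSimplex_le {f : (Fin n → ℝ) → ℂ} {C : ℝ}
    (h : ∀ u ∈ orderSimplex n, ‖f u‖ ≤ C) :
    ‖∫ u in orderSimplex n, f u‖ ≤ C / n.factorial := by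
  refine (norm_setIntegral_le_of_norm_le_const (isCompact_orderSimplex n).measure_lt_top
    h).trans (le_of_eq ?_)
  rw [volume_real_orderSimplex]
  ring

end Simplex

/-! ### Translations, grading and local algebras -/

section Operators

variable {H : Type*} [NormedAddCommGroup H] [InnerProductSpace ℂ H] [CompleteSpace H]

namespace GradedNet

variable (N : GradedNet H)

theorem U_neg_mul (t : ℝ) : N.U (-t) * N.U t = 1 := by
  rw [← N.U_add, neg_add_cancel, N.U_zero]

theorem norm_U_le (t : ℝ) : ‖N.U t‖ ≤ 1 := by
  have h : ‖N.U t‖ * ‖N.U t‖ ≤ 1 := by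
    rw [← CStarRing.norm_star_mul_self, N.U_star, N.U_neg_mul]
    exact ContinuousLinearMap.norm_id_le
  nlinarith [norm_nonneg (N.U t)]

theorem norm_Γ_le : ‖N.Γ‖ ≤ 1 := by
  have h : ‖N.Γ‖ * ‖N.Γ‖ ≤ 1 := by
    rw [← CStarRing.norm_star_mul_self, N.Γ_star, N.Γ_sq]
    exact ContinuousLinearMap.norm_id_le
  nlinarith [norm_nonneg N.Γ]

theorem norm_α_le (t : ℝ) (x : H →L[ℂ] H) : ‖N.α t x‖ ≤ ‖x‖ := by
  calc ‖N.α t x‖ ≤ ‖N.U t‖ * ‖x‖ * ‖N.U (-t)‖ :=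
        (norm_mul_le _ _).trans (mul_le_mul_of_nonneg_right (norm_mul_le _ _) (norm_nonneg _))
    _ ≤ 1 * ‖x‖ * 1 := by
        gcongr
        · exact N.norm_U_le t
        · exact N.norm_U_le (-t)
    _ = ‖x‖ := by ring

theorem norm_γ_le (x : H →L[ℂ] H) : ‖N.γ x‖ ≤ ‖x‖ := by
  calc ‖N.γ x‖ ≤ ‖N.Γ‖ * ‖x‖ * ‖N.Γ‖ :=
        (norm_mul_le _ _).trans (mul_le_mul_of_nonneg_right (norm_mul_le _ _) (norm_nonneg _))
    _ ≤ 1 * ‖x‖ * 1 := by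
        gcongr
        · exact N.norm_Γ_le
        · exact N.norm_Γ_le
    _ = ‖x‖ := by ring

theorem α_one (t : ℝ) : N.α t 1 = 1 := by
  have := N.U_neg_mul (-t)
  rw [neg_neg] at this
  rw [α, mul_one, this]

theorem α_mul (t : ℝ) (x y : H →L[ℂ] H) : N.α t (x * y) = N.α t x * N.α t y := by
  have h := N.U_neg_mul t
  calc N.α t (x * y) = N.U t * x * 1 * y * N.U (-t) := by simp [α, mul_assoc]
    _ = N.U t * x * (N.U (-t) * N.U t) * y * N.U (-t) := by rw [h]
    _ = _ := by simp only [α, mul_assoc]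

theorem α_add (t : ℝ) (x y : H →L[ℂ] H) : N.α t (x + y) = N.α t x + N.α t y := by
  simp [α, mul_add, add_mul]

theorem α_smul (t : ℝ) (c : ℂ) (x : H →L[ℂ] H) : N.α t (c • x) = c • N.α t x := by simp [α]

theorem α_zero (x : H →L[ℂ] H) : N.α 0 x = x := by simp [α, N.U_zero]

theorem α_α (s t : ℝ) (x : H →L[ℂ] H) : N.α s (N.α t x) = N.α (s + t) x := by
  simp only [α]
  rw [N.U_add, neg_add_rev, N.U_add]
  simp only [mul_assoc]

theorem γ_γ (x : H →L[ℂ] H) : N.γ (N.γ x) = x := by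
  calc N.γ (N.γ x) = (N.Γ * N.Γ) * x * (N.Γ * N.Γ) := by simp only [γ, mul_assoc]
    _ = x := by rw [N.Γ_sq]; simp

theorem γ_α (t : ℝ) (x : H →L[ℂ] H) : N.γ (N.α t x) = N.α t (N.γ x) := by
  simp only [γ, α]
  calc N.Γ * (N.U t * x * N.U (-t)) * N.Γ = (N.Γ * N.U t) * x * (N.U (-t) * N.Γ) := by
        simp only [mul_assoc]
    _ = _ := by rw [← N.U_Γ t, N.U_Γ (-t)]; simp only [mul_assoc]

theorem α_mem_alg {I : BddInterval} {x : H →L[ℂ] H} (hx : x ∈ N.alg I) (t : ℝ) :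
    N.α t x ∈ N.alg (I.translate t) := by
  have : N.α t x ∈ (fun x => N.U t * x * N.U (-t)) '' (N.alg I : Set (H →L[ℂ] H)) := ⟨x, hx, rfl⟩
  rw [N.covariance] at this
  exact this

theorem continuous_α_apply (x : H →L[ℂ] H) (ξ : H) : Continuous fun t => N.α t x ξ := by
  rw [continuous_iff_continuousAt]
  intro t₀
  have h1 : Tendsto (fun t => x (N.U (-t) ξ)) (𝓝 t₀) (𝓝 (x (N.U (-t₀) ξ))) :=
    (x.continuous.comp ((N.U_continuous ξ).comp continuous_neg)).tendsto t₀
  have h2 := (N.U_continuous (x (N.U (-t₀) ξ))).tendsto t₀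
  have h3 : Tendsto (fun t => N.U t (x (N.U (-t) ξ) - x (N.U (-t₀) ξ))) (𝓝 t₀) (𝓝 0) := by
    refine squeeze_zero_norm (a := fun t => ‖x (N.U (-t) ξ) - x (N.U (-t₀) ξ)‖) (fun t => ?_) ?_
    · refine ((N.U t).le_opNorm _).trans ?_
      exact mul_le_of_le_one_left (norm_nonneg _) (N.norm_U_le t)
    · have := (h1.sub_const (x (N.U (-t₀) ξ))).norm
      simpa using this
  have := h3.add h2
  rw [zero_add] at this
  refine this.congr fun t => ?_
  rw [map_sub, sub_add_cancel]
  rfl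

end GradedNet

namespace BddInterval

theorem abs_le_radius (I : BddInterval) {x : ℝ} (hx : x ∈ I.toSet) : |x| ≤ I.radius := by
  refine le_csSup ⟨max |I.left| |I.right|, ?_⟩ ⟨x, hx, rfl⟩
  rintro _ ⟨y, hy, rfl⟩
  exact abs_le_max_abs_abs hy.1.le hy.2.le

theorem toSet_subset_Icc (I : BddInterval) : Set.Icc I.left I.right ⊆ Set.Icc (-I.radius) I.radius := by
  rw [← closure_Ioo I.lt.ne]
  exact closure_minimal (fun x hx => abs_le.1 (I.abs_le_radius hx)) isClosed_Icc

theorem radius_pos (I : BddInterval) : 0 < I.radius := by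
  have h1 := (I.toSet_subset_Icc (Set.left_mem_Icc.2 I.lt.le)).1
  have h2 := (I.toSet_subset_Icc (Set.right_mem_Icc.2 I.lt.le)).2
  linarith [I.lt]

/-- The interval `(-r, r)`. -/
def symm (r : ℝ) (hr : 0 < r) : BddInterval := ⟨-r, r, by linarith⟩

theorem radius_symm_le {r : ℝ} (hr : 0 < r) : (symm r hr).radius ≤ r := by
  refine csSup_le ⟨|0|, 0, ⟨by simpa [symm] using hr, hr⟩, rfl⟩ ?_
  rintro _ ⟨y, hy, rfl⟩
  exact abs_le.2 ⟨hy.1.le, hy.2.le⟩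

theorem translate_subset_symm (I : BddInterval) {t r : ℝ} (hr : 0 < r) (h : I.radius + |t| ≤ r) :
    (I.translate t).toSet ⊆ (symm r hr).toSet := by
  have h1 := (I.toSet_subset_Icc (Set.left_mem_Icc.2 I.lt.le)).1
  have h2 := (I.toSet_subset_Icc (Set.right_mem_Icc.2 I.lt.le)).2
  have h3 := neg_abs_le t
  have h4 := le_abs_self t
  refine Set.Ioo_subset_Ioo ?_ ?_ <;> simp only [symm, translate] <;> linarith

end BddInterval

/-! ### Multi-point functions and their boundary values -/

namespace SKMSFunctional

variable {N : GradedNet H} {D : Superderivation N} (Φ : SKMSFunctional D)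

/-- `α_t` as an algebra homomorphism of `dom(φ)`. -/
def αHom (t : ℝ) : Φ.dom →ₐ[ℂ] Φ.dom :=
  AlgHom.ofLinearMap
    { toFun := Φ.αD t
      map_add' := fun _ _ => Subtype.ext (N.α_add t _ _)
      map_smul' := fun _ _ => Subtype.ext (N.α_smul t _ _) }
    (Subtype.ext (N.α_one t)) fun _ _ => Subtype.ext (N.α_mul t _ _)

/-- `γ` as an algebra homomorphism of `dom(φ)`. -/
def γHom : Φ.dom →ₐ[ℂ] Φ.dom :=
  AlgHom.ofLinearMap
    { toFun := fun x => ⟨N.γ x, Φ.γ_mem x x.2⟩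
      map_add' := fun _ _ => Subtype.ext (N.γ_add _ _)
      map_smul' := fun _ _ => Subtype.ext (N.γ_smul _ _) }
    (Subtype.ext N.γ_one) fun _ _ => Subtype.ext (N.γ_mul _ _)

@[simp] theorem coe_αHom (t : ℝ) (x : Φ.dom) : (Φ.αHom t x : H →L[ℂ] H) = N.α t x := rfl

@[simp] theorem coe_γHom (x : Φ.dom) : (Φ.γHom x : H →L[ℂ] H) = N.γ x := rfl

theorem αHom_zero (x : Φ.dom) : Φ.αHom 0 x = x := Subtype.ext (N.α_zero _)

theorem αHom_αHom (s t : ℝ) (x : Φ.dom) : Φ.αHom s (Φ.αHom t x) = Φ.αHom (s + t) x :=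
  Subtype.ext (N.α_α _ _ _)

/-- The functional is invariant under the grading. -/
theorem φ_γHom (x : Φ.dom) : Φ.φ (Φ.γHom x) = Φ.φ x := by
  -- With y = 1 the function in the strip is constant on the real line, hence everywhere; its value
  -- at i is φ(γ(x)).
  obtain ⟨F, hc, hd, h0, h1, -⟩ := Φ.sKMS x 1
  have e : ∀ t : ℝ, Φ.αHom t 1 = 1 := fun t => map_one _
  have h0' : ∀ t : ℝ, F t = Φ.φ x := fun t => by
    rw [h0]; change Φ.φ (x * Φ.αHom t 1) = _; rw [e, mul_one]
  have h1' : F Complex.I = Φ.φ (Φ.γHom x) := by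
    have := h1 0
    rw [Complex.ofReal_zero, zero_add] at this
    rw [this]; change Φ.φ (Φ.αHom 0 1 * Φ.γHom x) = _; rw [e, one_mul]
  have := eqOn_strip hc hd continuousOn_const (differentiableOn_const (Φ.φ x)) h0'
    (x := Complex.I) (by simp [strip])
  rw [← h1', this]

/-- The factors `α_{s_j}(x_j)`, where `s_0 = 0`. -/
def factors {n : ℕ} (x : Fin (n + 1) → Φ.dom) (s : Fin n → ℝ) : Fin (n + 1) → Φ.dom :=
  fun j => Φ.αHom (lo s j) (x j)

theorem multiPoint_eq {n : ℕ} (x : Fin (n + 1) → Φ.dom) (s : Fin n → ℝ) :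
    Φ.multiPoint x s = Φ.φ (List.ofFn (Φ.factors x s)).prod := by
  rw [List.ofFn_succ, List.prod_cons]
  simp only [factors, lo_zero, lo_succ, αHom_zero]
  rfl

/-- The boundary values at the vertices of the simplex. -/
def vertexFn {n : ℕ} (i : Fin (n + 1)) (x : Fin (n + 1) → Φ.dom) (s : Fin n → ℝ) : ℂ :=
  Φ.φ (((List.ofFn (Φ.factors x s)).drop (i + 1)).prod *
    Φ.γHom ((List.ofFn (Φ.factors x s)).take (i + 1)).prod)

/-- The last vertex is the origin: no factor is moved, and the γ on the full product drops out by
invariance. -/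
theorem vertexFn_last {n : ℕ} (x : Fin (n + 1) → Φ.dom) (s : Fin n → ℝ) :
    Φ.vertexFn (Fin.last n) x s = Φ.multiPoint x s := by
  rw [vertexFn, multiPoint_eq, List.drop_of_length_le (by simp), List.take_of_length_le (by simp),
    List.prod_nil, one_mul, φ_γHom]

theorem lo_add_smul_vtx {n : ℕ} (s : Fin n → ℝ) (t : ℝ) (i j : Fin (n + 1)) :
    lo (s + t • vtx i) j = if i < j then t + lo s j else lo s j := by
  refine Fin.cases ?_ (fun k => ?_) j
  · simp
  · simp only [lo_succ, Pi.add_apply, Pi.smul_apply, vtx, smul_eq_mul, Fin.le_castSucc_iff]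
    split_ifs <;> ring

theorem factors_add_smul_vtx {n : ℕ} (x : Fin (n + 1) → Φ.dom) (s : Fin n → ℝ) (t : ℝ)
    (i j : Fin (n + 1)) : Φ.factors x (s + t • vtx i) j =
      if i < j then Φ.αHom t (Φ.factors x s j) else Φ.factors x s j := by
  simp only [factors, lo_add_smul_vtx]
  split_ifs
  · rw [αHom_αHom]
  · rfl

theorem take_factors {n : ℕ} (x : Fin (n + 1) → Φ.dom) (s : Fin n → ℝ) (t : ℝ)
    (i : Fin (n + 1)) : (List.ofFn (Φ.factors x (s + t • vtx i))).take (i + 1) =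
      (List.ofFn (Φ.factors x s)).take (i + 1) := by
  refine List.ext_getElem (by simp) fun k h1 h2 => ?_
  simp only [List.length_take, List.length_ofFn] at h1
  simp only [List.getElem_take, List.getElem_ofFn, factors_add_smul_vtx]
  rw [if_neg]
  rw [Fin.lt_def]
  simp only
  omega

theorem drop_factors {n : ℕ} (x : Fin (n + 1) → Φ.dom) (s : Fin n → ℝ) (t : ℝ)
    (i : Fin (n + 1)) : (List.ofFn (Φ.factors x (s + t • vtx i))).drop (i + 1) =
      ((List.ofFn (Φ.factors x s)).drop (i + 1)).map (Φ.αHom t) := by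
  refine List.ext_getElem (by simp) fun k h1 h2 => ?_
  simp only [List.getElem_drop, List.getElem_map, List.getElem_ofFn, factors_add_smul_vtx]
  rw [if_pos]
  rw [Fin.lt_def]
  simp only
  omega

/-- Moving s by t along a vertex applies α_t to the factors behind position i and to no others, so
the edge is the sKMS condition for the product of the first i + 1 factors and the product of the
rest. -/
theorem hasEdge_vertexFn {n : ℕ} (x : Fin (n + 1) → Φ.dom) (i : Fin (n + 1)) :
    HasEdge (vtx i) (Φ.multiPoint x) (Φ.vertexFn i x) := by
  intro s
  obtain ⟨F, hc, hd, h0, h1, C, p, -, -, hg⟩ := Φ.sKMS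
    ((List.ofFn (Φ.factors x s)).take (i + 1)).prod ((List.ofFn (Φ.factors x s)).drop (i + 1)).prod
  refine ⟨F, hc, hd, fun t => ?_, fun t => ?_, C, p, hg⟩
  · rw [h0, multiPoint_eq, ← List.prod_take_mul_prod_drop (List.ofFn (Φ.factors x (s + t • vtx i))) (i + 1), take_factors, drop_factors,
      ← map_list_prod]
    rfl
  · rw [h1, vertexFn, take_factors, drop_factors, ← map_list_prod]
    rfl

/-! ### Continuity -/

/-- Strong continuity with uniform bounds. -/
def StronglyCont {X : Type*} [TopologicalSpace X] (y : X → Φ.dom) : Prop :=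
  (∀ ξ : H, Continuous fun s => (y s : H →L[ℂ] H) ξ) ∧ ∃ K, ∀ s, ‖(y s : H →L[ℂ] H)‖ ≤ K

section

variable {Φ} {X : Type*} [TopologicalSpace X]

/-- Multiplication is jointly strongly continuous only on bounded sets; hence the uniform bound in
`StronglyCont`. -/
theorem StronglyCont.mul {y z : X → Φ.dom} (hy : Φ.StronglyCont y) (hz : Φ.StronglyCont z) :
    Φ.StronglyCont fun s => y s * z s := by
  obtain ⟨hy, K, hK⟩ := hy
  obtain ⟨hz, L, hL⟩ := hz
  refine ⟨fun ξ => ?_, K * L, fun s => ?_⟩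
  · rw [continuous_iff_continuousAt]
    intro s₀
    have h2 := (hy ((z s₀ : H →L[ℂ] H) ξ)).tendsto s₀
    have h3 : Tendsto (fun s => (y s : H →L[ℂ] H) ((z s : H →L[ℂ] H) ξ - (z s₀ : H →L[ℂ] H) ξ))
        (𝓝 s₀) (𝓝 0) := by
      refine squeeze_zero_norm
        (a := fun s => K * ‖(z s : H →L[ℂ] H) ξ - (z s₀ : H →L[ℂ] H) ξ‖) (fun s => ?_) ?_
      · refine ((y s : H →L[ℂ] H).le_opNorm _).trans ?_
        exact mul_le_mul_of_nonneg_right (hK s) (norm_nonneg _)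
      · have := ((((hz ξ).tendsto s₀).sub_const ((z s₀ : H →L[ℂ] H) ξ)).norm).const_mul K
        simpa using this
    have := h3.add h2
    rw [zero_add] at this
    refine this.congr fun s => ?_
    rw [map_sub, sub_add_cancel]
    rfl
  · refine (norm_mul_le (y s : H →L[ℂ] H) (z s : H →L[ℂ] H)).trans ?_
    exact mul_le_mul (hK s) (hL s) (norm_nonneg _) ((norm_nonneg _).trans (hK s))

theorem StronglyCont.γHom {y : X → Φ.dom} (hy : Φ.StronglyCont y) :
    Φ.StronglyCont fun s => Φ.γHom (y s) := by
  obtain ⟨hy, K, hK⟩ := hy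
  exact ⟨fun ξ => N.Γ.continuous.comp (hy (N.Γ ξ)), K, fun s => (N.norm_γ_le _).trans (hK s)⟩

theorem StronglyCont.list_prod {L : List (X → Φ.dom)} (hL : ∀ y ∈ L, Φ.StronglyCont y) :
    Φ.StronglyCont fun s => (L.map fun y => y s).prod := by
  induction L with
  | nil => exact ⟨fun ξ => continuous_const, ‖(1 : H →L[ℂ] H)‖, fun _ => le_rfl⟩
  | cons y L ih =>
    simp only [List.map_cons, List.prod_cons]
    exact (hL y (by simp)).mul (ih fun z hz => hL z (by simp [hz]))

/-- Strongly continuous local families are mapped to continuous functions. -/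
theorem StronglyCont.continuous_φ {y : X → Φ.dom} (hy : Φ.StronglyCont y)
    (hloc : ∀ s₀, ∃ J : BddInterval, ∀ᶠ s in 𝓝 s₀, (y s : H →L[ℂ] H) ∈ N.alg J) :
    Continuous fun s => Φ.φ (y s) := by
  obtain ⟨hy, K, hK⟩ := hy
  rw [continuous_iff_continuousAt]
  intro s₀
  obtain ⟨J, hJ⟩ := hloc s₀
  obtain ⟨ψ, hψ, hψφ⟩ := Φ.locally_normal J
  set V : Set X := {s | (y s : H →L[ℂ] H) ∈ N.alg J}
  suffices h : ContinuousOn (fun s => Φ.φ (y s)) V from h.continuousAt hJ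
  rw [continuousOn_iff_continuous_domRestrict]
  let f : V → (N.alg J).toStarSubalgebra := fun s => ⟨y s, s.2⟩
  -- Bounded strongly continuous families are σ-weakly continuous: each defining functional is a
  -- series of continuous functions dominated by K(‖ξ n‖² + ‖η n‖²).
  have hf : @Continuous _ _ _ (TopologicalSpace.induced Subtype.val (sigmaWeak H)) f := by
    rw [continuous_induced_rng]
    refine continuous_iInf_rng.2 fun p => continuous_induced_rng.2 ?_
    obtain ⟨⟨ξ, η⟩, hξ, hη⟩ := p
    simp only at hξ hη
    refine continuous_tsum (u := fun n => K * (‖ξ n‖ ^ 2 + ‖η n‖ ^ 2)) (fun n => ?_)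
      ((hξ.add hη).mul_left K) fun n s => ?_
    · exact continuous_const.inner ((hy (η n)).comp continuous_subtype_val)
    · have hK0 : 0 ≤ K := (norm_nonneg _).trans (hK s)
      calc ‖⟪ξ n, (y s : H →L[ℂ] H) (η n)⟫_ℂ‖ ≤ ‖ξ n‖ * ‖(y s : H →L[ℂ] H) (η n)‖ :=
            norm_inner_le_norm _ _
        _ ≤ ‖ξ n‖ * (K * ‖η n‖) := by
            gcongr
            exact ((y s : H →L[ℂ] H).le_opNorm _).trans
              (mul_le_mul_of_nonneg_right (hK s) (norm_nonneg _))
        _ = K * (‖ξ n‖ * ‖η n‖) := by ring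
        _ ≤ K * (‖ξ n‖ ^ 2 + ‖η n‖ ^ 2) := by
            gcongr
            nlinarith [sq_nonneg (‖ξ n‖ - ‖η n‖), sq_nonneg (‖ξ n‖), sq_nonneg (‖η n‖)]
  have := @Continuous.comp V (N.alg J).toStarSubalgebra ℂ _
    (TopologicalSpace.induced Subtype.val (sigmaWeak H)) _ f ψ hψ hf
  refine this.congr fun s => ?_
  exact hψφ (y s) s.2

end

theorem norm_list_prod_le (l : List Φ.dom) :
    ‖(l.prod : H →L[ℂ] H)‖ ≤ (l.map fun y : Φ.dom => ‖(y : H →L[ℂ] H)‖).prod := by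
  induction l with
  | nil => exact ContinuousLinearMap.norm_id_le
  | cons a l ih =>
    rw [List.prod_cons, List.map_cons, List.prod_cons]
    exact (norm_mul_le (a : H →L[ℂ] H) (l.prod : H →L[ℂ] H)).trans
      (mul_le_mul_of_nonneg_left ih (norm_nonneg _))

theorem list_prod_mem_alg {J : BddInterval} {l : List Φ.dom}
    (h : ∀ y ∈ l, (y : H →L[ℂ] H) ∈ N.alg J) : (l.prod : H →L[ℂ] H) ∈ N.alg J := by
  induction l with
  | nil => exact one_mem (N.alg J).toStarSubalgebra
  | cons a l ih =>
    rw [List.prod_cons]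
    exact (N.alg J).toStarSubalgebra.mul_mem (h a (by simp)) (ih fun y hy => h y (by simp [hy]))

variable {n : ℕ} {I : BddInterval} {x : Fin (n + 1) → Φ.dom}

theorem abs_lo_le (s : Fin n → ℝ) (j : Fin (n + 1)) : |lo s j| ≤ ‖s‖ := by
  refine Fin.cases ?_ (fun k => ?_) j
  · simp
  · rw [lo_succ]; exact norm_le_pi_norm s k

theorem factors_mem {R : ℝ} (hR : 0 < R) (hx : ∀ i, (x i : H →L[ℂ] H) ∈ N.alg I)
    {s : Fin n → ℝ} (hs : I.radius + ‖s‖ ≤ R) (j : Fin (n + 1)) :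
    (Φ.factors x s j : H →L[ℂ] H) ∈ N.alg (BddInterval.symm R hR) :=
  N.isotony _ _ (I.translate_subset_symm hR (by linarith [abs_lo_le s j]))
    (N.α_mem_alg (hx j) _)

theorem vertex_mem {R : ℝ} (hR : 0 < R) (hx : ∀ i, (x i : H →L[ℂ] H) ∈ N.alg I)
    {s : Fin n → ℝ} (hs : I.radius + ‖s‖ ≤ R) (k : ℕ) :
    ((((List.ofFn (Φ.factors x s)).drop k).prod *
      Φ.γHom ((List.ofFn (Φ.factors x s)).take k).prod : Φ.dom) : H →L[ℂ] H) ∈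
        N.alg (BddInterval.symm R hR) := by
  have h : ∀ y ∈ List.ofFn (Φ.factors x s),
      (y : H →L[ℂ] H) ∈ N.alg (BddInterval.symm R hR) := by
    intro y hy
    obtain ⟨j, rfl⟩ := (List.mem_ofFn' _ _).1 hy
    exact Φ.factors_mem hR hx hs j
  refine (N.alg (BddInterval.symm R hR)).toStarSubalgebra.mul_mem
    (Φ.list_prod_mem_alg fun y hy => h y (List.mem_of_mem_drop hy)) ?_
  exact N.γ_mem (Φ.list_prod_mem_alg fun y hy => h y (List.mem_of_mem_take hy))

theorem norm_vertex_le (s : Fin n → ℝ) (k : ℕ) :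
    ‖((((List.ofFn (Φ.factors x s)).drop k).prod *
      Φ.γHom ((List.ofFn (Φ.factors x s)).take k).prod : Φ.dom) : H →L[ℂ] H)‖ ≤
        ∏ i, ‖(x i : H →L[ℂ] H)‖ := by
  set L := List.ofFn (Φ.factors x s) with hL
  set ν : Φ.dom → ℝ := fun y => ‖(y : H →L[ℂ] H)‖
  have h0 : ∀ l : List Φ.dom, 0 ≤ (l.map ν).prod := fun l => (norm_nonneg _).trans
    (Φ.norm_list_prod_le l)
  calc _ ≤ ‖((L.drop k).prod : H →L[ℂ] H)‖ * ‖N.γ ((L.take k).prod : H →L[ℂ] H)‖ :=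
        norm_mul_le _ _
    _ ≤ ((L.drop k).map ν).prod * ((L.take k).map ν).prod :=
        mul_le_mul (Φ.norm_list_prod_le _) ((N.norm_γ_le _).trans (Φ.norm_list_prod_le _))
          (norm_nonneg _) (h0 _)
    _ = (L.map ν).prod := by
        rw [mul_comm, List.map_take, List.map_drop, List.prod_take_mul_prod_drop]
    _ = ∏ i, ‖(Φ.factors x s i : H →L[ℂ] H)‖ := by
        rw [hL, List.map_ofFn, List.prod_ofFn]; rfl
    _ ≤ _ := Finset.prod_le_prod (fun _ _ => norm_nonneg _) fun i _ => N.norm_α_le _ _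

/-- All translated factors lie in the algebra of the symmetric interval of radius |I| + ‖s‖,
whatever the vertex; there the local-exponential bound applies. -/
theorem norm_vertexFn_le {C₁ C₂ : ℝ} (hC₁ : 0 < C₁) (hC₂ : 0 < C₂)
    (hΦ : Φ.LocallyExpBounded C₁ C₂) (hx : ∀ i, (x i : H →L[ℂ] H) ∈ N.alg I) (i : Fin (n + 1))
    (s : Fin n → ℝ) : ‖Φ.vertexFn i x s‖ ≤
      C₁ * Real.exp (C₂ * (I.radius + ‖s‖) ^ 2) * ∏ i, ‖(x i : H →L[ℂ] H)‖ := by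
  have hR : 0 < I.radius + ‖s‖ := add_pos_of_pos_of_nonneg I.radius_pos (norm_nonneg _)
  refine (hΦ _ _ (Φ.vertex_mem hR hx le_rfl (i + 1))).trans ?_
  have h1 := BddInterval.radius_symm_le hR
  have h2 := (BddInterval.symm _ hR).radius_pos
  gcongr
  exact Φ.norm_vertex_le s _

theorem stronglyCont_factors (x : Fin (n + 1) → Φ.dom) (j : Fin (n + 1)) :
    Φ.StronglyCont fun s : Fin n → ℝ => Φ.factors x s j :=
  ⟨fun ξ => (N.continuous_α_apply _ ξ).comp (continuous_lo j), _, fun _ => N.norm_α_le _ _⟩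

theorem continuous_vertexFn (hx : ∀ i, (x i : H →L[ℂ] H) ∈ N.alg I) (i : Fin (n + 1)) :
    Continuous (Φ.vertexFn i x) := by
  set L : List ((Fin n → ℝ) → Φ.dom) := List.ofFn fun j s => Φ.factors x s j with hL
  have hLs : ∀ s, List.ofFn (Φ.factors x s) = L.map fun y => y s := fun s => by
    rw [hL, List.map_ofFn]; rfl
  have hLc : ∀ y ∈ L, Φ.StronglyCont y := by
    intro y hy
    obtain ⟨j, rfl⟩ := (List.mem_ofFn' _ _).1 hy
    exact Φ.stronglyCont_factors x j
  have hsc : Φ.StronglyCont fun s => ((List.ofFn (Φ.factors x s)).drop (i + 1)).prod *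
      Φ.γHom ((List.ofFn (Φ.factors x s)).take (i + 1)).prod := by
    simp only [hLs, ← List.map_take, ← List.map_drop]
    exact (StronglyCont.list_prod fun y hy => hLc y (List.mem_of_mem_drop hy)).mul
      (StronglyCont.list_prod fun y hy => hLc y (List.mem_of_mem_take hy)).γHom
  refine hsc.continuous_φ fun s₀ => ?_
  have hR : 0 < I.radius + (‖s₀‖ + 1) := by
    linarith [I.radius_pos, norm_nonneg s₀]
  refine ⟨BddInterval.symm _ hR, ?_⟩
  filter_upwards [Metric.ball_mem_nhds s₀ one_pos] with s hs
  refine Φ.vertex_mem hR hx ?_ _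
  rw [Metric.mem_ball, dist_eq_norm] at hs
  linarith [norm_le_norm_add_norm_sub' s s₀]

/-! ### Continuation of the multi-point functions -/

/-- The Gaussian weight `exp (-K ∑ z_j²)`. -/
def weight (K : ℝ) (z : Fin n → ℂ) : ℂ := Complex.exp (-(K * ∑ j, z j ^ 2))

theorem differentiable_weight (K : ℝ) : Differentiable ℂ (weight K : (Fin n → ℂ) → ℂ) := by
  unfold weight; fun_prop

theorem norm_weight (K : ℝ) (z : Fin n → ℂ) :
    ‖weight K z‖ = Real.exp (-(K * ∑ j, ((z j).re ^ 2 - (z j).im ^ 2))) := by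
  rw [weight, Complex.norm_exp]
  congr 1
  simp [pow_two]

theorem norm_weight_le {K : ℝ} (hK : 0 ≤ K) {z : Fin n → ℂ} (hz : z ∈ tube n) :
    ‖weight K z‖ ≤ Real.exp (K * (n - ‖fun j => (z j).re‖ ^ 2)) := by
  rw [norm_weight, Real.exp_le_exp, ← mul_neg]
  refine mul_le_mul_of_nonneg_left ?_ hK
  have h1 : ∑ j, (z j).im ^ 2 ≤ n := by
    calc ∑ j, (z j).im ^ 2 ≤ ∑ j : Fin n, (1 : ℝ) :=
          Finset.sum_le_sum fun j _ => pow_le_one₀ (hz.2 j).1 (hz.2 j).2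
      _ = n := by simp
  have h2 : ‖fun j => (z j).re‖ ^ 2 ≤ ∑ j, (z j).re ^ 2 := by
    have h3 : ‖fun j => (z j).re‖ ≤ √(∑ j, (z j).re ^ 2) := by
      refine (pi_norm_le_iff_of_nonneg (Real.sqrt_nonneg _)).2 fun j => ?_
      rw [Real.norm_eq_abs]
      refine Real.abs_le_sqrt ?_
      exact Finset.single_le_sum (f := fun j => (z j).re ^ 2) (fun j _ => sq_nonneg _)
        (Finset.mem_univ j)
    calc _ ≤ √(∑ j, (z j).re ^ 2) ^ 2 := pow_le_pow_left₀ (norm_nonneg _) h3 2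
      _ = _ := Real.sq_sqrt (Finset.sum_nonneg fun _ _ => sq_nonneg _)
  rw [Finset.sum_sub_distrib]
  linarith

theorem HasEdge.mul_weight {K : ℝ} (hK : 0 ≤ K) {v : Fin n → ℝ} (hv : v ∈ orderSimplex n)
    {g g' : (Fin n → ℝ) → ℂ} (h : HasEdge v g g') :
    HasEdge v (fun s => g s * weight K (cpt s 0)) (fun s => g' s * weight K (cpt s v)) := by
  intro s
  obtain ⟨f, hc, hd, h0, h1, C, p, hg⟩ := h s
  have hw : Differentiable ℂ fun w : ℂ => weight K (cpt s 0 + w • cpt v 0) :=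
    (differentiable_weight K).comp (by fun_prop)
  have hC : 0 ≤ C := by
    have := (norm_nonneg _).trans (hg 0 (by simpa using real_mem_strip 0))
    simpa using this
  refine ⟨fun w => f w * weight K (cpt s 0 + w • cpt v 0), hc.mul hw.continuous.continuousOn,
    hd.mul hw.differentiableOn, fun t => ?_, fun t => ?_, C * Real.exp (K * n), p,
    fun w hws => ?_⟩
  · simp only [h0]
    congr 2
    ext j; simp [cpt]
  · simp only [h1]
    congr 2
    ext j; simp [cpt]; ring
  · have hmem : cpt s 0 + w • cpt v 0 ∈ tube n := by
      have := smul_mem_orderSimplex hv hws.1 hws.2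
      simpa [tube, cpt, Pi.smul_def] using this
    have h2 : ‖weight K (cpt s 0 + w • cpt v 0)‖ ≤ Real.exp (K * n) := by
      refine (norm_weight_le hK hmem).trans (Real.exp_le_exp.2 ?_)
      refine mul_le_mul_of_nonneg_left ?_ hK
      linarith [sq_nonneg ‖fun j => ((cpt s 0 + w • cpt v 0) j).re‖]
    rw [norm_mul]
    calc ‖f w‖ * ‖weight K (cpt s 0 + w • cpt v 0)‖
        ≤ (C * (1 + |w.re|) ^ p) * Real.exp (K * n) := by
          gcongr
          exact hg w hws
      _ = _ := by ring

/-- A weight with twice the rate of the growth wins: (r + m)² - 2m² = m(2r - m) + r². -/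
theorem tendsto_exp_quadratic {C r : ℝ} (hC : 0 < C) :
    Tendsto (fun s : Fin n → ℝ => Real.exp (C * ((r + ‖s‖) ^ 2 - 2 * ‖s‖ ^ 2)))
      (cocompact (Fin n → ℝ)) (𝓝 0) := by
  have h1 : Tendsto (fun m : ℝ => Real.exp (C * ((r + m) ^ 2 - 2 * m ^ 2))) atTop (𝓝 0) := by
    refine Real.tendsto_exp_atBot.comp (Tendsto.const_mul_atBot hC ?_)
    have h2 : Tendsto (fun m : ℝ => m * (2 * r - m) + r ^ 2) atTop atBot := by
      refine tendsto_atBot_add_const_right _ _ ?_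
      refine tendsto_id.atTop_mul_atBot₀ ?_
      exact tendsto_atBot_add_const_left _ _ tendsto_neg_atTop_atBot
    refine h2.congr fun m => by ring
  exact h1.comp tendsto_norm_cocompact_atTop

/-- The multi-point functions continue to the tube. -/
theorem exists_tubeHolo {C₁ C₂ : ℝ} (hC₁ : 0 < C₁) (hC₂ : 0 < C₂)
    (hΦ : Φ.LocallyExpBounded C₁ C₂) (hx : ∀ i, (x i : H →L[ℂ] H) ∈ N.alg I) :
    ∃ F : (Fin n → ℂ) → ℂ, TubeHolo F ∧ (∀ i s, F (cpt s (vtx i)) = Φ.vertexFn i x s) ∧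
      ∀ z ∈ tube n, ‖F z‖ ≤ C₁ * Real.exp (2 * C₂ * (I.radius + 1) ^ 2 * (n + 1)) *
        Real.exp (2 * C₂ * (I.radius + 1) * ∑ k, ‖z k‖ ^ 2) * ∏ i, ‖(x i : H →L[ℂ] H)‖ := by
  set r := I.radius with hr
  have hr0 : 0 < r := I.radius_pos
  set P : ℝ := ∏ i, ‖(x i : H →L[ℂ] H)‖ with hP
  have hP0 : 0 ≤ P := Finset.prod_nonneg fun _ _ => norm_nonneg _
  -- Any rate above C₂ would make the weighted boundary values decay; 2C₂ is the one of the asserted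
  -- bound.
  set K : ℝ := 2 * C₂ with hK
  have hK0 : 0 ≤ K := by positivity
  set g : Fin (n + 1) → (Fin n → ℝ) → ℂ := fun i s =>
    Φ.vertexFn i x s * weight K (cpt s (vtx i)) with hg
  have hbd : ∀ i s, ‖g i s‖ ≤ C₁ * P * Real.exp (K * n) *
      Real.exp (C₂ * ((r + ‖s‖) ^ 2 - 2 * ‖s‖ ^ 2)) := by
    intro i s
    have h1 := Φ.norm_vertexFn_le hC₁ hC₂ hΦ hx i s
    have h2 := norm_weight_le hK0 (cpt_mem_tube.2 (vtx_mem i) : cpt s (vtx i) ∈ tube n)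
    have e : (fun j => (cpt s (vtx i) j).re) = s := by ext j; simp [cpt]
    rw [e] at h2
    calc ‖g i s‖ = ‖Φ.vertexFn i x s‖ * ‖weight K (cpt s (vtx i))‖ := norm_mul _ _
      _ ≤ (C₁ * Real.exp (C₂ * (r + ‖s‖) ^ 2) * P) * Real.exp (K * (n - ‖s‖ ^ 2)) :=
          mul_le_mul h1 h2 (norm_nonneg _) (by positivity)
      _ = C₁ * P * (Real.exp (C₂ * (r + ‖s‖) ^ 2) * Real.exp (K * (n - ‖s‖ ^ 2))) := by ring
      _ = C₁ * P * (Real.exp (K * n) * Real.exp (C₂ * ((r + ‖s‖) ^ 2 - 2 * ‖s‖ ^ 2))) := by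
          rw [← Real.exp_add, ← Real.exp_add]
          congr 2
          rw [hK]; ring
      _ = _ := by ring
  set M : ℝ := C₁ * P * Real.exp (K * n) * Real.exp (K * r ^ 2) with hM
  have hbM : ∀ i s, ‖g i s‖ ≤ M := by
    intro i s
    refine (hbd i s).trans ?_
    -- The difference of the two sides is C₂(r - ‖s‖)².
    have h1 : C₂ * ((r + ‖s‖) ^ 2 - 2 * ‖s‖ ^ 2) ≤ K * r ^ 2 := by
      rw [hK]; nlinarith [mul_nonneg hC₂.le (sq_nonneg (r - ‖s‖))]
    rw [hM]
    gcongr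
  have hcont : ∀ i, Continuous (g i) := fun i =>
    (Φ.continuous_vertexFn hx i).mul ((differentiable_weight K).continuous.comp
      (by unfold cpt; fun_prop))
  -- Continuity together with decay at infinity.
  have huc : ∀ i, UniformContinuous (g i) := by
    intro i
    refine (hcont i).uniformContinuous_of_tendsto_cocompact (x := 0) ?_
    refine squeeze_zero_norm (hbd i) ?_
    simpa using (tendsto_exp_quadratic (n := n) (r := r) hC₂).const_mul
      (C₁ * P * Real.exp (K * n))
  have hlast : g (Fin.last n) = fun s => Φ.multiPoint x s * weight K (cpt s 0) := by
    ext s; simp only [hg, vertexFn_last, vtx_last]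
  obtain ⟨F, hF, hFv, hFb⟩ := exists_tubeHolo_of_hasEdge g huc hbM (fun i => by
    rw [hlast]
    exact HasEdge.mul_weight hK0 (vtx_mem i) (Φ.hasEdge_vertexFn x i))
  -- The inverse weight is entire too, so it can be restored after the continuation.
  have hwt : ∀ z : Fin n → ℂ, weight K z * weight (-K) z = 1 := by
    intro z
    rw [weight, weight, ← Complex.exp_add]
    simp
  refine ⟨fun z => F z * weight (-K) z, hF.mul (.of_differentiable (differentiable_weight _)),
    fun i s => ?_, fun z hz => ?_⟩
  · simp only [hFv, hg]
    rw [mul_assoc, hwt, mul_one]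
  · rw [norm_mul, norm_weight]
    set S : ℝ := ∑ k, ‖z k‖ ^ 2 with hS
    have h1 : ∑ j, ((z j).re ^ 2 - (z j).im ^ 2) ≤ S := by
      refine Finset.sum_le_sum fun j _ => ?_
      have : ‖z j‖ ^ 2 = (z j).re ^ 2 + (z j).im ^ 2 := by
        rw [← Complex.normSq_eq_norm_sq, Complex.normSq_apply]; ring
      rw [this]
      linarith [sq_nonneg (z j).im]
    have hS0 : 0 ≤ S := Finset.sum_nonneg fun _ _ => sq_nonneg _
    calc ‖F z‖ * Real.exp (-(-K * ∑ j, ((z j).re ^ 2 - (z j).im ^ 2)))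
        ≤ M * Real.exp (K * (r + 1) * S) := by
          refine mul_le_mul (hFb z hz) (Real.exp_le_exp.2 ?_) (Real.exp_pos _).le
            ((norm_nonneg _).trans (hFb z hz))
          calc -(-K * ∑ j, ((z j).re ^ 2 - (z j).im ^ 2))
              = K * ∑ j, ((z j).re ^ 2 - (z j).im ^ 2) := by ring
            _ ≤ K * S := mul_le_mul_of_nonneg_left h1 hK0
            _ ≤ K * (r + 1) * S := by nlinarith [mul_nonneg hK0 hS0, mul_nonneg (mul_nonneg hK0 hS0) hr0.le]
      _ = C₁ * P * Real.exp (K * n + K * r ^ 2) * Real.exp (K * (r + 1) * S) := by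
          rw [hM, Real.exp_add]; ring
      _ ≤ C₁ * P * Real.exp (K * (r + 1) ^ 2 * (n + 1)) * Real.exp (K * (r + 1) * S) := by
          gcongr
          have hn : (0 : ℝ) ≤ n := Nat.cast_nonneg n
          have : (n : ℝ) + r ^ 2 ≤ (r + 1) ^ 2 * (n + 1) := by
            nlinarith [mul_nonneg hr0.le hn, mul_nonneg (sq_nonneg r) hn]
          calc K * n + K * r ^ 2 = K * (n + r ^ 2) := by ring
            _ ≤ K * ((r + 1) ^ 2 * (n + 1)) := by gcongr
            _ = _ := by ring
      _ = _ := by ring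

end SKMSFunctional

end Operators

section Smooth

variable {H : Type*} [NormedAddCommGroup H] [InnerProductSpace ℂ H] [CompleteSpace H]

/-! ### The algebra of smooth elements -/

theorem exists_common_interval (N : GradedNet H) {n : ℕ} (x : Fin n → (H →L[ℂ] H))
    (h : ∀ i, ∃ I, x i ∈ N.alg I) : ∃ I, ∀ i, x i ∈ N.alg I := by
  induction n with
  | zero => exact ⟨⟨0, 1, zero_lt_one⟩, fun i => i.elim0⟩
  | succ n ih =>
    obtain ⟨I, hI⟩ := ih (fun i => x i.succ) fun i => h i.succ
    obtain ⟨J, hJ⟩ := h 0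
    refine ⟨I.hull J, Fin.cases ?_ fun i => ?_⟩
    · exact N.isotony _ _ (I.subset_hull_right J) hJ
    · exact N.isotony _ _ (I.subset_hull_left J) (hI i)

namespace Superderivation

variable {N : GradedNet H} (D : Superderivation N)

theorem γ_mem_smooth {x : H →L[ℂ] H} (hx : x ∈ D.smooth) : N.γ x ∈ D.smooth := by
  obtain ⟨I, hI⟩ := D.mem_smooth.1 hx
  exact D.mem_smooth.2 ⟨I, D.mem_smoothLocal.2 fun n => D.domPow_γ I n (D.mem_smoothLocal.1 hI n)⟩

theorem exists_mem_alg (x : D.smooth) : ∃ I, (x : H →L[ℂ] H) ∈ N.alg I := by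
  obtain ⟨I, hI⟩ := D.mem_smooth.1 x.2
  exact ⟨I, D.mem_smoothLocal.1 hI 0⟩

/-- `α_t` as an algebra homomorphism of `C^∞(δ)_c`. -/
def αHom (t : ℝ) : D.smooth →ₐ[ℂ] D.smooth :=
  AlgHom.ofLinearMap
    { toFun := D.αS t
      map_add' := fun _ _ => Subtype.ext (N.α_add t _ _)
      map_smul' := fun _ _ => Subtype.ext (N.α_smul t _ _) }
    (Subtype.ext (N.α_one t)) fun _ _ => Subtype.ext (N.α_mul t _ _)

/-- `γ` as an algebra homomorphism of `C^∞(δ)_c`. -/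
def γHom : D.smooth →ₐ[ℂ] D.smooth :=
  AlgHom.ofLinearMap
    { toFun := fun x => ⟨N.γ x, D.γ_mem_smooth x.2⟩
      map_add' := fun _ _ => Subtype.ext (N.γ_add _ _)
      map_smul' := fun _ _ => Subtype.ext (N.γ_smul _ _) }
    (Subtype.ext N.γ_one) fun _ _ => Subtype.ext (N.γ_mul _ _)

/-- `δ` as a linear map of `C^∞(δ)_c`. -/
def δLin : D.smooth →ₗ[ℂ] D.smooth where
  toFun := D.δS
  map_add' x y := Subtype.ext
    (D.δ.map_add ⟨x, D.smooth_le_dom x.2⟩ ⟨y, D.smooth_le_dom y.2⟩)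
  map_smul' c x := Subtype.ext (D.δ.map_smul c ⟨x, D.smooth_le_dom x.2⟩)

theorem αHom_zero (x : D.smooth) : D.αHom 0 x = x := Subtype.ext (N.α_zero _)

theorem αHom_αHom (s t : ℝ) (x : D.smooth) : D.αHom s (D.αHom t x) = D.αHom (s + t) x :=
  Subtype.ext (N.α_α _ _ _)

theorem γHom_αHom (t : ℝ) (x : D.smooth) : D.γHom (D.αHom t x) = D.αHom t (D.γHom x) :=
  Subtype.ext (N.γ_α _ _)

theorem δLin_αHom (t : ℝ) (x : D.smooth) : D.δLin (D.αHom t x) = D.αHom t (D.δLin x) :=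
  Subtype.ext (D.δ_α t ⟨x, D.smooth_le_dom x.2⟩).symm

theorem γHom_δLin (x : D.smooth) : D.γHom (D.δLin x) = -D.δLin (D.γHom x) :=
  Subtype.ext (D.δ_γ ⟨x, D.smooth_le_dom x.2⟩)

theorem δLin_mul (x y : D.smooth) :
    D.δLin (x * y) = D.δLin x * y + D.γHom x * D.δLin y :=
  Subtype.ext (D.δ_mul ⟨x, D.smooth_le_dom x.2⟩ ⟨y, D.smooth_le_dom y.2⟩)

theorem δLin_one : D.δLin 1 = 0 := Subtype.ext D.δ_one

theorem γHom_toSmooth (x : D.evenSmooth) : D.γHom (D.toSmooth x) = D.toSmooth x :=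
  Subtype.ext x.2.2

/-- `γ` on the entries to the left of `j`, `δ` on the entry `j`. -/
def leibniz {n : ℕ} (y : Fin n → D.smooth) (j : Fin n) : Fin n → D.smooth :=
  fun i => if i < j then D.γHom (y i) else if i = j then D.δLin (y i) else y i

theorem δLin_prod {n : ℕ} (y : Fin n → D.smooth) :
    D.δLin (List.ofFn y).prod = ∑ j, (List.ofFn (D.leibniz y j)).prod := by
  induction n with
  | zero => simp [δLin_one]
  | succ n ih =>
    rw [List.ofFn_succ, List.prod_cons, δLin_mul, ih, Fin.sum_univ_succ, Finset.mul_sum]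
    congr 1
    · rw [List.ofFn_succ, List.prod_cons]
      simp [leibniz]
    · refine Finset.sum_congr rfl fun j _ => ?_
      rw [List.ofFn_succ (f := D.leibniz y j.succ), List.prod_cons]
      congr 1
      · congr 2
        ext i
        simp [leibniz]

end Superderivation

theorem prod_ofFn_update {M : Type*} [Monoid M] {n : ℕ} (f : Fin n → M) (i : Fin n) (a : M) :
    (List.ofFn (Function.update f i a)).prod =
      ((List.ofFn f).take i).prod * a * ((List.ofFn f).drop (i + 1)).prod := by
  simp [List.ofFn_eq_map, (List.nodup_finRange n).map_update, List.prod_set]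

theorem prod_ofFn_contractNth {M : Type*} [Monoid M] {n : ℕ} (f : Fin (n + 2) → M)
    (k : Fin (n + 1)) : (List.ofFn (Fin.contractNth k.castSucc (· * ·) f)).prod =
      (List.ofFn f).prod := by
  have h := congrFun (Fin.partialProd_contractNth f k.castSucc) (Fin.last (n + 1))
  have e : k.castSucc.succ.succAbove (Fin.last (n + 1)) = Fin.last (n + 2) := by
    rw [Fin.succAbove_of_le_castSucc, Fin.succ_last]
    rw [Fin.le_def]
    simp
    omega
  rw [Function.comp_apply, e] at h
  simp only [Fin.partialProd, Fin.val_last] at h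
  rwa [List.take_of_length_le (by simp), List.take_of_length_le (by simp)] at h

namespace SKMSFunctional

variable {N : GradedNet H} {D : Superderivation N} (Φ : SKMSFunctional D)

/-- The restriction of the functional to `C^∞(δ)_c`. -/
def ω : D.smooth →ₗ[ℂ] ℂ := Φ.φ.comp (StarSubalgebra.inclusion Φ.smooth_le).toAlgHom.toLinearMap

theorem ω_γHom (x : D.smooth) : Φ.ω (D.γHom x) = Φ.ω x := Φ.φ_γHom (Φ.ofSmooth x)

theorem ω_δLin (x : D.smooth) : Φ.ω (D.δLin x) = 0 := Φ.φ_δ x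

theorem hasDerivAt_ω (x y z : D.smooth) :
    HasDerivAt (fun t : ℝ => Φ.ω (x * D.αHom t y * z))
      (Complex.I * Φ.ω (x * D.δLin (D.δLin y) * z)) 0 :=
  Φ.supersymmetry (Φ.ofSmooth x) (Φ.ofSmooth z) (D.exists_mem_alg x) (D.exists_mem_alg z) y

/-- Since δ commutes with α, the derivative at t₀ is the one at 0 for the translated element. -/
theorem hasDerivAt_ω' (x y z : D.smooth) (t₀ : ℝ) :
    HasDerivAt (fun t : ℝ => Φ.ω (x * D.αHom t y * z))
      (Complex.I * Φ.ω (x * D.αHom t₀ (D.δLin (D.δLin y)) * z)) t₀ := by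
  have h := Φ.hasDerivAt_ω x (D.αHom t₀ y) z
  rw [D.δLin_αHom, D.δLin_αHom] at h
  have h2 : HasDerivAt (fun t : ℝ => t - t₀) 1 t₀ := (hasDerivAt_id t₀).sub_const t₀
  have h3 := HasDerivAt.scomp (h := fun t : ℝ => t - t₀) t₀ (by simpa using h) h2
  simp only [one_smul] at h3
  refine h3.congr_of_eventuallyEq (Filter.Eventually.of_forall fun t => ?_)
  simp only [Function.comp_apply, D.αHom_αHom, sub_add_cancel]

/-- Translation invariance on `C^∞(δ)_c`. -/
theorem ω_αHom (t : ℝ) (x : D.smooth) : Φ.ω (D.αHom t x) = Φ.ω x := by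
  -- The derivative is i ω(α_t(δ²(x))) = i ω(δ(⋯)), which vanishes by invariance under δ.
  have h : ∀ t, HasDerivAt (fun t : ℝ => Φ.ω (D.αHom t x)) 0 t := fun t => by
    have := Φ.hasDerivAt_ω' 1 x 1 t
    simpa [← D.δLin_αHom, Φ.ω_δLin] using this
  have := is_const_of_deriv_eq_zero (fun t => (h t).differentiableAt) (fun t => (h t).deriv) t 0
  simpa [D.αHom_zero] using this

/-- The multi-point functions of smooth elements. -/
def npt {n : ℕ} (y : Fin (n + 1) → D.smooth) (s : Fin n → ℝ) : ℂ :=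
  Φ.ω (List.ofFn fun j => D.αHom (lo s j) (y j)).prod

/-- The vertex functions of smooth elements. -/
def nptVertex {n : ℕ} (i : Fin (n + 1)) (y : Fin (n + 1) → D.smooth) (s : Fin n → ℝ) : ℂ :=
  Φ.ω (((List.ofFn fun j => D.αHom (lo s j) (y j)).drop (i + 1)).prod *
    D.γHom ((List.ofFn fun j => D.αHom (lo s j) (y j)).take (i + 1)).prod)

theorem coe_list_prod (l : List D.smooth) :
    Φ.ofSmooth l.prod = (l.map Φ.ofSmooth).prod :=
  map_list_prod (StarSubalgebra.inclusion Φ.smooth_le) l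

theorem vertexFn_ofSmooth {n : ℕ} (i : Fin (n + 1)) (y : Fin (n + 1) → D.smooth) (s : Fin n → ℝ) :
    Φ.vertexFn i (fun j => Φ.ofSmooth (y j)) s = Φ.nptVertex i y s := by
  have e : List.ofFn (Φ.factors (fun j => Φ.ofSmooth (y j)) s) =
      (List.ofFn fun j => D.αHom (lo s j) (y j)).map Φ.ofSmooth := by
    rw [List.map_ofFn]; rfl
  rw [vertexFn, e, ← List.map_drop, ← List.map_take, ← coe_list_prod, ← coe_list_prod]
  rfl

theorem multiPoint_ofSmooth {n : ℕ} (y : Fin (n + 1) → D.smooth) (s : Fin n → ℝ) :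
    Φ.multiPoint (fun j => Φ.ofSmooth (y j)) s = Φ.npt y s := by
  have e : List.ofFn (Φ.factors (fun j => Φ.ofSmooth (y j)) s) =
      (List.ofFn fun j => D.αHom (lo s j) (y j)).map Φ.ofSmooth := by
    rw [List.map_ofFn]; rfl
  rw [multiPoint_eq, e, ← coe_list_prod]
  rfl

/-- The multi-point function as a multilinear form. -/
def nptMultilinear {n : ℕ} (s : Fin n → ℝ) :
    MultilinearMap ℂ (fun _ : Fin (n + 1) => D.smooth) ℂ :=
  Φ.ω.compMultilinearMap ((MultilinearMap.mkPiAlgebraFin ℂ (n + 1) D.smooth).compLinearMap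
    fun j => (D.αHom (lo s j)).toLinearMap)

theorem nptMultilinear_apply {n : ℕ} (s : Fin n → ℝ) (y : Fin (n + 1) → D.smooth) :
    Φ.nptMultilinear s y = Φ.npt y s := rfl

/-- The multi-point functions of smooth elements continue to the tubes. -/
def HasContinuations : Prop :=
  ∀ (n : ℕ) (y : Fin (n + 1) → D.smooth), ∃ F : (Fin n → ℂ) → ℂ, TubeHolo F ∧
    ∀ i s, F (cpt s (vtx i)) = Φ.nptVertex i y s

theorem hasContinuations {C₁ C₂ : ℝ} (hC₁ : 0 < C₁) (hC₂ : 0 < C₂)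
    (hΦ : Φ.LocallyExpBounded C₁ C₂) : Φ.HasContinuations := by
  intro n y
  obtain ⟨I, hI⟩ := exists_common_interval N (fun i => (y i : H →L[ℂ] H))
    fun i => D.exists_mem_alg (y i)
  obtain ⟨F, hF, hv, -⟩ := Φ.exists_tubeHolo (x := fun j => Φ.ofSmooth (y j)) hC₁ hC₂ hΦ hI
  exact ⟨F, hF, fun i s => by rw [hv, vertexFn_ofSmooth]⟩

open Classical in
/-- The continuation of the multi-point functions of smooth elements. -/
def tubeFn {n : ℕ} (y : Fin (n + 1) → D.smooth) : (Fin n → ℂ) → ℂ :=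
  if h : ∃ F : (Fin n → ℂ) → ℂ, TubeHolo F ∧ ∀ i s, F (cpt s (vtx i)) = Φ.nptVertex i y s then
    h.choose else 0

namespace HasContinuations

variable {Φ}

theorem tubeHolo (hΦ : Φ.HasContinuations) {n : ℕ} (y : Fin (n + 1) → D.smooth) : TubeHolo (Φ.tubeFn y) := by
  rw [tubeFn, dif_pos (hΦ n y)]
  exact (hΦ n y).choose_spec.1

theorem apply_vtx (hΦ : Φ.HasContinuations) {n : ℕ} (y : Fin (n + 1) → D.smooth) (i : Fin (n + 1)) (s : Fin n → ℝ) :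
    Φ.tubeFn y (cpt s (vtx i)) = Φ.nptVertex i y s := by
  rw [tubeFn, dif_pos (hΦ n y)]
  exact (hΦ n y).choose_spec.2 i s

theorem apply_real (hΦ : Φ.HasContinuations) {n : ℕ} (y : Fin (n + 1) → D.smooth) (s : Fin n → ℝ) :
    Φ.tubeFn y (fun j => (s j : ℂ)) = Φ.npt y s := by
  have h := hΦ.apply_vtx y (Fin.last n) s
  rw [vtx_last, cpt_zero] at h
  rw [h, ← vertexFn_ofSmooth, vertexFn_last, multiPoint_ofSmooth]

/-- The transport principle for the identities below: a candidate that is `TubeHolo` has to be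
compared with the multi-point function at real times only. -/
theorem eqOn (hΦ : Φ.HasContinuations) {n : ℕ} {y : Fin (n + 1) → D.smooth} {F : (Fin n → ℂ) → ℂ} (hF : TubeHolo F)
    (h : ∀ s : Fin n → ℝ, F (fun j => (s j : ℂ)) = Φ.npt y s) :
    ∀ z ∈ tube n, Φ.tubeFn y z = F z :=
  (hΦ.tubeHolo y).eqOn hF fun s => by rw [hΦ.apply_real, h]

end HasContinuations

end SKMSFunctional

end Smooth

section TubeIdentities

variable {H : Type*} [NormedAddCommGroup H] [InnerProductSpace ℂ H] [CompleteSpace H]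

/-! ### Affine maps between tubes -/

/-- The complex version of `lo`. -/
def loC {n : ℕ} (z : Fin n → ℂ) : Fin (n + 1) → ℂ := Fin.cons 0 z

@[simp] theorem loC_zero {n : ℕ} (z : Fin n → ℂ) : loC z 0 = 0 := rfl

@[simp] theorem loC_succ {n : ℕ} (z : Fin n → ℂ) (i : Fin n) : loC z i.succ = z i := rfl

theorem loC_im {n : ℕ} (z : Fin n → ℂ) (i : Fin (n + 1)) :
    (loC z i).im = lo (fun j => (z j).im) i := by
  refine Fin.cases ?_ (fun j => ?_) i <;> simp

theorem loC_ofReal {n : ℕ} (s : Fin n → ℝ) (i : Fin (n + 1)) :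
    loC (fun j => (s j : ℂ)) i = lo s i := by
  refine Fin.cases ?_ (fun j => ?_) i <;> simp

theorem loC_cpt_zero {n : ℕ} (u : Fin n → ℝ) (i : Fin (n + 1)) :
    loC (cpt 0 u) i = lo u i * Complex.I := by
  refine Fin.cases ?_ (fun j => ?_) i <;> simp [cpt]

theorem loC_line {n : ℕ} (a b : Fin n → ℂ) (w : ℂ) (i : Fin (n + 1)) :
    loC (a + w • b) i = loC a i + w * loC b i := by
  refine Fin.cases ?_ (fun j => ?_) i <;> simp

theorem continuous_loC {n : ℕ} (i : Fin (n + 1)) : Continuous fun z : Fin n → ℂ => loC z i := by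
  refine Fin.cases ?_ (fun j => ?_) i
  · simpa using continuous_const
  · simpa using continuous_apply j

theorem cpt_mem_tube_of {n : ℕ} {u : Fin n → ℝ} (hu : u ∈ orderSimplex n) (s : Fin n → ℝ) :
    cpt s u ∈ tube n := cpt_mem_tube.2 hu

theorem im_mem_orderSimplex {n : ℕ} {z : Fin n → ℂ} (hz : z ∈ tube n) :
    (fun j => (z j).im) ∈ orderSimplex n := hz

theorem cpt_zero_insertNth {n : ℕ} (k : Fin (n + 1)) (t : ℝ) (v : Fin n → ℝ) :
    cpt 0 (Fin.insertNth k t v : Fin (n + 1) → ℝ) =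
      Fin.insertNth k (t * Complex.I : ℂ) (cpt 0 v) := by
  ext j
  refine Fin.succAboveCases k ?_ (fun i => ?_) j <;> simp [cpt]

theorem ofReal_insertNth {n : ℕ} (k : Fin (n + 1)) (t : ℝ) (v : Fin n → ℝ) :
    (fun j => ((Fin.insertNth k t v : Fin (n + 1) → ℝ) j : ℂ)) =
      Fin.insertNth k (t : ℂ) (fun j => (v j : ℂ)) := by
  ext j
  refine Fin.succAboveCases k ?_ (fun i => ?_) j <;> simp

theorem im_insertNth {n : ℕ} (k : Fin (n + 1)) (t : ℂ) (v : Fin n → ℂ) :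
    (fun j => ((Fin.insertNth k t v : Fin (n + 1) → ℂ) j).im) =
      Fin.insertNth k t.im (fun j => (v j).im) := by
  ext j
  refine Fin.succAboveCases k ?_ (fun i => ?_) j <;> simp

theorem insertNth_line {n : ℕ} (k : Fin (n + 1)) (t t' w : ℂ) (a b : Fin n → ℂ) :
    (Fin.insertNth k (t + w * t') (a + w • b) : Fin (n + 1) → ℂ) =
      Fin.insertNth k t a + w • Fin.insertNth k t' b := by
  ext j
  refine Fin.succAboveCases k ?_ (fun i => ?_) j <;> simp

theorem insertNth_mem_tube {n : ℕ} {k : Fin (n + 1)} {t : ℂ} {v : Fin n → ℂ} (hv : v ∈ tube n)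
    (h1 : lo (fun j => (v j).im) k ≤ t.im) (h2 : t.im ≤ hi (fun j => (v j).im) k) :
    (Fin.insertNth k t v : Fin (n + 1) → ℂ) ∈ tube (n + 1) := by
  change (fun j => ((Fin.insertNth k t v : Fin (n + 1) → ℂ) j).im) ∈ orderSimplex (n + 1)
  rw [im_insertNth, insertNth_mem_orderSimplex]
  exact ⟨hv, h1, h2⟩

/-- Inserting the left neighbour doubles one time; the index map collapses the two copies. -/
theorem lo_insertNth_lo {n : ℕ} (k : Fin (n + 1)) (s : Fin n → ℝ) (j : Fin (n + 2)) :
    lo (Fin.insertNth k (lo s k) s : Fin (n + 1) → ℝ) j = lo s (k.predAbove j) := by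
  refine Fin.cases ?_ (fun i => ?_) j
  · rw [lo_zero, Fin.predAbove_right_zero, lo_zero]
  · rw [lo_succ]
    refine Fin.succAboveCases k ?_ (fun i => ?_) i
    · simp
    · rw [Fin.insertNth_apply_succAbove]
      rcases lt_or_ge i.castSucc k with h | h
      · rw [Fin.succAbove_of_castSucc_lt _ _ h, Fin.succ_castSucc,
          Fin.predAbove_castSucc_of_le _ _ (Fin.castSucc_lt_iff_succ_le.1 h), lo_succ]
      · rw [Fin.succAbove_of_le_castSucc _ _ h, Fin.predAbove_succ_of_le _ _ (by
          rw [Fin.le_def] at h ⊢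
          simp at h ⊢
          omega), lo_succ]

theorem succ_succAbove_of_ne {n : ℕ} {k j : Fin n} (h : j ≠ k) :
    k.succ.succAbove j = k.castSucc.succAbove j := by
  have h' : (j : ℕ) ≠ k := fun e => h (Fin.ext e)
  ext
  simp only [Fin.succAbove, Fin.lt_def, Fin.val_castSucc, Fin.val_succ]
  split_ifs <;> simp <;> omega

namespace SKMSFunctional

variable {N : GradedNet H} {D : Superderivation N} (Φ : SKMSFunctional D)

/-- Two neighbouring factors at the same time multiply to one, since α is multiplicative. -/
theorem npt_contractNth {n : ℕ} (y : Fin (n + 2) → D.smooth) (k : Fin (n + 1)) (s : Fin n → ℝ) :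
    Φ.npt y (Fin.insertNth k (lo s k) s) = Φ.npt (Fin.contractNth k.castSucc (· * ·) y) s := by
  rw [npt, npt, ← prod_ofFn_contractNth _ k]
  congr 3
  ext1 j
  simp only [Fin.contractNth, lo_insertNth_lo]
  rcases lt_trichotomy (j : ℕ) k with h | h | h
  · have e : k.predAbove j.castSucc = j :=
      Fin.predAbove_castSucc_of_le _ _ (Fin.le_def.2 h.le)
    simp [h, e]
  · have hk : j = k := Fin.ext h
    subst hk
    simp
  · have e : k.predAbove j.succ = j := Fin.predAbove_succ_of_le _ _ (Fin.le_def.2 h.le)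
    simp [h.not_gt, h.ne', e]

theorem npt_snoc_one {n : ℕ} (y : Fin (n + 1) → D.smooth) (s : Fin (n + 1) → ℝ) :
    Φ.npt (Fin.snoc y 1 : Fin (n + 2) → D.smooth) s = Φ.npt y (fun j => s j.castSucc) := by
  rw [npt, npt, List.ofFn_succ', List.concat_eq_append, List.prod_append]
  simp only [Fin.snoc_last, Fin.snoc_castSucc, map_one, List.prod_singleton, mul_one]
  congr 3
  ext1 j
  congr 2
  refine Fin.cases ?_ (fun i => ?_) j
  · rfl
  · rw [Fin.castSucc_succ, lo_succ, lo_succ]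

theorem sum_npt_leibniz {n : ℕ} (y : Fin (n + 1) → D.smooth) (s : Fin n → ℝ) :
    ∑ j, Φ.npt (D.leibniz y j) s = 0 := by
  have h := Φ.ω_δLin (List.ofFn fun j => D.αHom (lo s j) (y j)).prod
  rw [D.δLin_prod, map_sum] at h
  rw [← h]
  refine Finset.sum_congr rfl fun j _ => ?_
  rw [npt]
  congr 3
  ext1 i
  simp only [Superderivation.leibniz]
  split_ifs
  · rw [D.γHom_αHom]
  · rw [D.δLin_αHom]
  · rfl

/-- At the vertex (0, …, 0, 1) the last factor alone is moved by i: it passes to the front and the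
others receive γ. This is the source of the cyclic term in b. -/
theorem nptVertex_insertNth_last {n : ℕ} (y : Fin (n + 2) → D.smooth) (s : Fin n → ℝ) :
    Φ.nptVertex (Fin.last n).castSucc y (Fin.insertNth (Fin.last n) 0 s) =
      Φ.npt (Fin.cons (y (Fin.last (n + 1)) * D.γHom (y 0))
        fun i : Fin n => D.γHom (y i.succ.castSucc)) s := by
  have hlo : ∀ j : Fin (n + 1), lo (Fin.insertNth (Fin.last n) 0 s : Fin (n + 1) → ℝ) j.castSucc
      = lo s j := by
    intro j
    refine Fin.cases rfl (fun i => ?_) j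
    rw [Fin.castSucc_succ, lo_succ, lo_succ, ← Fin.succAbove_last_apply,
      Fin.insertNth_apply_succAbove]
  have hlast : lo (Fin.insertNth (Fin.last n) 0 s : Fin (n + 1) → ℝ) (Fin.last (n + 1)) = 0 := by
    rw [← Fin.succ_last, lo_succ, Fin.insertNth_apply_same]
  rw [nptVertex, List.ofFn_succ', hlast, List.concat_eq_append]
  simp only [hlo]
  rw [List.drop_left' (by simp), List.take_left' (by simp), npt, List.ofFn_succ (n := n),
    List.ofFn_succ (n := n)]
  simp only [List.prod_nil, mul_one, List.prod_cons, lo_zero, lo_succ, D.αHom_zero, map_mul,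
    Fin.cons_zero, Fin.cons_succ, Fin.castSucc_zero, mul_assoc, map_list_prod, List.map_ofFn]
  congr 5
  ext1 j
  simp [D.γHom_αHom]

/-- Cyclicity of the multi-point functions. -/
theorem nptVertex_zero_rotate {n : ℕ} (y : Fin (n + 1) → D.smooth) (s : Fin n → ℝ) :
    Φ.nptVertex 0 (Fin.cons (y (Fin.last n)) fun j : Fin n => D.γHom (y j.castSucc))
      (fun j => lo s j.castSucc - lo s (Fin.last n)) = Φ.npt y s := by
  have hγ : ∀ x : D.smooth, D.γHom (D.γHom x) = x := fun x => Subtype.ext (N.γ_γ _)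
  rw [nptVertex, List.ofFn_succ]
  simp only [Fin.val_zero, zero_add, List.drop_succ_cons, List.drop_zero, List.take_succ_cons,
    List.take_zero, List.prod_singleton, lo_zero, lo_succ, Fin.cons_zero, Fin.cons_succ,
    D.αHom_zero]
  -- Invariance under γ removes the twist, and invariance under translation by the last time
  -- restores the original times.
  rw [← Φ.ω_γHom, ← Φ.ω_αHom (lo s (Fin.last n)), npt, List.ofFn_succ', List.concat_eq_append,
    List.prod_append, List.prod_singleton]
  simp only [map_mul, hγ, map_list_prod, List.map_ofFn]
  congr 4
  ext1 j
  simp [D.γHom_αHom, hγ, D.αHom_αHom]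

end SKMSFunctional

end TubeIdentities

section TubeFunctionIdentities

variable {H : Type*} [NormedAddCommGroup H] [InnerProductSpace ℂ H] [CompleteSpace H]

theorem lo_insertNth_castSucc {n : ℕ} (k : Fin (n + 1)) (t : ℝ) (v : Fin n → ℝ) :
    lo (Fin.insertNth k t v : Fin (n + 1) → ℝ) k.castSucc = lo v k := by
  cases n with
  | zero =>
    rw [Fin.fin_one_eq_zero k]
    rfl
  | succ n =>
    refine Fin.cases rfl (fun i => ?_) k
    have h : i.succ.succAbove i = i.castSucc := Fin.succAbove_succ_self i
    rw [Fin.castSucc_succ, lo_succ, lo_succ, ← h, Fin.insertNth_apply_succAbove]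

/-! ### Identities between the continued multi-point functions -/

namespace SKMSFunctional

variable {N : GradedNet H} {D : Superderivation N} (Φ : SKMSFunctional D)

/-- The k-th time occurs in one factor only; the factors on either side are fixed elements x and z
in the supersymmetry condition. -/
theorem hasDerivAt_npt_insertNth {n : ℕ} (y : Fin (n + 2) → D.smooth) (k : Fin (n + 1))
    (r : Fin n → ℝ) (t₀ : ℝ) :
    HasDerivAt (fun t : ℝ => Φ.npt y (Fin.insertNth k t r))
      (Complex.I * Φ.npt (Function.update y k.succ (D.δLin (D.δLin (y k.succ))))
        (Fin.insertNth k t₀ r)) t₀ := by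
  have key : ∀ (y' : Fin (n + 2) → D.smooth) (t : ℝ), (∀ j, j ≠ k.succ → y' j = y j) →
      (fun j => D.αHom (lo (Fin.insertNth k t r : Fin (n + 1) → ℝ) j) (y' j)) =
      Function.update
        (fun j => D.αHom (lo (Fin.insertNth k 0 r : Fin (n + 1) → ℝ) j) (y j)) k.succ
        (D.αHom t (y' k.succ)) := by
    intro y' t hy'
    ext1 j
    by_cases hj : j = k.succ
    · subst hj
      rw [Function.update_self, lo_succ, Fin.insertNth_apply_same]
    · rw [Function.update_of_ne hj, hy' j hj]
      congr 2
      refine Fin.cases (fun _ => rfl) (fun i hi => ?_) j hj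
      have hik : i ≠ k := fun e => hi (by rw [e])
      obtain ⟨l, rfl⟩ := Fin.exists_succAbove_eq hik
      rw [lo_succ, lo_succ, Fin.insertNth_apply_succAbove, Fin.insertNth_apply_succAbove]
  have e : (fun t : ℝ => Φ.npt y (Fin.insertNth k t r)) = 
      fun t => Φ.ω (List.ofFn (Function.update
        (fun j => D.αHom (lo (Fin.insertNth k 0 r : Fin (n + 1) → ℝ) j) (y j)) k.succ
        (D.αHom t (y k.succ)))).prod := by
    funext t
    rw [npt, key y _ fun _ _ => rfl]
  simp only [prod_ofFn_update] at e
  rw [e, npt, key (Function.update y k.succ (D.δLin (D.δLin (y k.succ)))) t₀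
    fun j hj => Function.update_of_ne hj _ _, prod_ofFn_update, Function.update_self]
  exact Φ.hasDerivAt_ω' _ _ _ t₀

namespace HasContinuations

variable {Φ}

theorem continuousOn_cpt_zero (hΦ : Φ.HasContinuations) {n : ℕ} (y : Fin (n + 1) → D.smooth) :
    ContinuousOn (fun u => Φ.tubeFn y (cpt 0 u)) (orderSimplex n) :=
  (hΦ.tubeHolo y).1.comp (by unfold cpt; fun_prop) fun _ hu => cpt_mem_tube.2 hu

theorem continuous_npt (hΦ : Φ.HasContinuations) {n : ℕ} (y : Fin (n + 1) → D.smooth) : Continuous (Φ.npt y) := by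
  have h : ContinuousOn (fun s : Fin n → ℝ => Φ.tubeFn y fun j => (s j : ℂ)) Set.univ :=
    (hΦ.tubeHolo y).1.comp (by fun_prop) fun s _ => by
      rw [← cpt_zero]; exact cpt_mem_tube.2 (zero_mem_orderSimplex n)
  rw [← continuousOn_univ]
  simpa only [hΦ.apply_real] using h

theorem tubeFn_update_add (hΦ : Φ.HasContinuations) {n : ℕ} (y : Fin (n + 1) → D.smooth) (i : Fin (n + 1)) (a b : D.smooth)
    {z : Fin n → ℂ} (hz : z ∈ tube n) : Φ.tubeFn (Function.update y i (a + b)) z =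
      Φ.tubeFn (Function.update y i a) z + Φ.tubeFn (Function.update y i b) z :=
  hΦ.eqOn ((hΦ.tubeHolo (Function.update y i a)).add (hΦ.tubeHolo (Function.update y i b)))
    (fun s => by
      simp only [hΦ.apply_real, ← nptMultilinear_apply, MultilinearMap.map_update_add]) z hz

theorem tubeFn_update_smul (hΦ : Φ.HasContinuations) {n : ℕ} (y : Fin (n + 1) → D.smooth) (i : Fin (n + 1)) (c : ℂ)
    (a : D.smooth) {z : Fin n → ℂ} (hz : z ∈ tube n) :
    Φ.tubeFn (Function.update y i (c • a)) z = c * Φ.tubeFn (Function.update y i a) z :=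
  hΦ.eqOn ((hΦ.tubeHolo (Function.update y i a)).const_mul c) (fun s => by
      simp only [hΦ.apply_real, ← nptMultilinear_apply, MultilinearMap.map_update_smul,
        smul_eq_mul]) z hz

/-- The value at a point of the tube as a multilinear form. -/
def multilinear (hΦ : Φ.HasContinuations) {n : ℕ} (z : Fin n → ℂ) (hz : z ∈ tube n) :
    MultilinearMap ℂ (fun _ : Fin (n + 1) => D.smooth) ℂ :=
  MultilinearMap.mk' (fun y => Φ.tubeFn y z)
    (fun y i a b => hΦ.tubeFn_update_add y i a b hz)
    (fun y i c a => hΦ.tubeFn_update_smul y i c a hz)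

/-- The contracted function is the restriction to the face where the k-th time equals its left
neighbour, with 0 as left neighbour of the first. -/
theorem tubeFn_contractNth (hΦ : Φ.HasContinuations) {n : ℕ} (y : Fin (n + 2) → D.smooth) (k : Fin (n + 1))
    {z : Fin n → ℂ} (hz : z ∈ tube n) :
    Φ.tubeFn (Fin.contractNth k.castSucc (· * ·) y) z = Φ.tubeFn y (Fin.insertNth k (loC z k) z) := by
  refine hΦ.eqOn (F := fun z => Φ.tubeFn y (Fin.insertNth k (loC z k) z))
    ((hΦ.tubeHolo y).comp ?_ (fun a b => ?_) fun z hz => ?_) (fun s => ?_) z hz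
  · exact (continuous_loC k).finInsertNth k continuous_id
  · exact ⟨_, _, fun w => by rw [loC_line, insertNth_line]⟩
  · refine insertNth_mem_tube hz (loC_im z k).ge ?_
    rw [loC_im]
    exact lo_le_hi hz k
  · rw [loC_ofReal, ← ofReal_insertNth, hΦ.apply_real, npt_contractNth]

theorem tubeFn_last_face (hΦ : Φ.HasContinuations) {n : ℕ} (y : Fin (n + 2) → D.smooth) {z : Fin n → ℂ} (hz : z ∈ tube n) :
    Φ.tubeFn (Fin.cons (y (Fin.last (n + 1)) * D.γHom (y 0))
        fun i : Fin n => D.γHom (y i.succ.castSucc)) z =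
      Φ.tubeFn y (Fin.insertNth (Fin.last n) Complex.I z) := by
  refine hΦ.eqOn (F := fun z => Φ.tubeFn y (Fin.insertNth (Fin.last n) Complex.I z))
    ((hΦ.tubeHolo y).comp ?_ (fun a b => ?_) fun z hz => ?_) (fun s => ?_) z hz
  · exact continuous_const.finInsertNth _ continuous_id
  · refine ⟨Fin.insertNth (Fin.last n) Complex.I a, Fin.insertNth (Fin.last n) 0 b, fun w => ?_⟩
    rw [← insertNth_line, mul_zero, add_zero]
  · have := lo_le_hi hz (Fin.last n)
    rw [hi_last] at this
    refine insertNth_mem_tube hz (by simpa using this) (by simp)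
  · rw [← nptVertex_insertNth_last, ← hΦ.apply_vtx]
    congr 1
    ext j
    refine Fin.succAboveCases (Fin.last n) ?_ (fun i => ?_) j
    · simp [cpt, vtx]
    · have : ¬ (Fin.last n).castSucc ≤ i.castSucc.castSucc := by
        rw [Fin.castSucc_le_castSucc_iff, not_le]
        exact Fin.castSucc_lt_last i
      simp [cpt, vtx, this, -Fin.castSucc_le_castSucc_iff]

/-- Vertex 0 is (1, …, 1), so the boundary value shifts all times by i. On imaginary parts the map
of times is `rot`, hence it preserves the tube. -/
theorem tubeFn_rotate (hΦ : Φ.HasContinuations) {n : ℕ} (y : Fin (n + 1) → D.smooth) {z : Fin n → ℂ} (hz : z ∈ tube n) :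
    Φ.tubeFn y z = Φ.tubeFn (Fin.cons (y (Fin.last n)) fun j : Fin n => D.γHom (y j.castSucc))
      (fun j => Complex.I - loC z (Fin.last n) + loC z j.castSucc) := by
  set y' : Fin (n + 1) → D.smooth :=
    Fin.cons (y (Fin.last n)) fun j : Fin n => D.γHom (y j.castSucc)
  refine hΦ.eqOn (F := fun z => Φ.tubeFn y' fun j : Fin n =>
      Complex.I - loC z (Fin.last n) + loC z j.castSucc)
    ((hΦ.tubeHolo y').comp (A := fun z j => Complex.I - loC z (Fin.last n) + loC z j.castSucc)
      ?_ (fun a b => ?_) fun z hz => ?_) (fun s => ?_) z hz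
  · exact continuous_pi fun j => (continuous_const.sub (continuous_loC _)).add (continuous_loC _)
  · refine ⟨fun j => Complex.I - loC a (Fin.last n) + loC a j.castSucc,
      fun j => - loC b (Fin.last n) + loC b j.castSucc, fun w => ?_⟩
    ext j
    simp only [loC_line, Pi.add_apply, Pi.smul_apply, smul_eq_mul]
    ring
  · have := rot_mem_orderSimplex.2 (im_mem_orderSimplex hz)
    change (fun j : Fin n => (Complex.I - loC z (Fin.last n) + loC z j.castSucc).im) ∈ orderSimplex n
    convert this using 1
    ext j
    simp [loC_im, rot]
  · rw [← nptVertex_zero_rotate, ← hΦ.apply_vtx]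
    congr 1
    ext j
    simp only [loC_ofReal, cpt, vtx]
    simp
    ring

theorem sum_tubeFn_leibniz (hΦ : Φ.HasContinuations) {n : ℕ} (y : Fin (n + 1) → D.smooth) {z : Fin n → ℂ}
    (hz : z ∈ tube n) : ∑ j, Φ.tubeFn (D.leibniz y j) z = 0 :=
  (TubeHolo.sum Finset.univ fun j => hΦ.tubeHolo (D.leibniz y j)).eqOn (TubeHolo.const 0)
    (fun s => by simp only [hΦ.apply_real, sum_npt_leibniz]) hz

theorem tubeFn_snoc_one (hΦ : Φ.HasContinuations) {n : ℕ} (y : Fin (n + 1) → D.smooth) {z : Fin (n + 1) → ℂ}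
    (hz : z ∈ tube (n + 1)) :
    Φ.tubeFn (Fin.snoc y 1 : Fin (n + 2) → D.smooth) z = Φ.tubeFn y (fun j => z j.castSucc) := by
  refine hΦ.eqOn (F := fun z => Φ.tubeFn y fun j => z j.castSucc)
    ((hΦ.tubeHolo y).comp (A := fun z j => z j.castSucc) (by fun_prop)
      (fun a b => ⟨fun j => a j.castSucc, fun j => b j.castSucc, fun w => rfl⟩)
      fun z hz => ?_) (fun s => ?_) z hz
  · exact ⟨fun i j hij => hz.1 (Fin.castSucc_le_castSucc_iff.2 hij), fun i => hz.2 _⟩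
  · rw [hΦ.apply_real y fun j => s j.castSucc, npt_snoc_one]

/-- The fundamental theorem of calculus in one variable, for all pairs of points of the tube that
differ in a single coordinate. -/
theorem tubeFn_sub_tubeFn (hΦ : Φ.HasContinuations) {n : ℕ} (y : Fin (n + 2) → D.smooth) (k : Fin (n + 1))
    {ζ : Fin (n + 2) → ℂ} (hζ : ζ ∈ tube (n + 2)) :
    Φ.tubeFn y (fun j => ζ (k.castSucc.succAbove j)) - Φ.tubeFn y (fun j => ζ (k.succ.succAbove j)) =
      (Complex.I * (ζ k.succ - ζ k.castSucc)) * ∫ t in Set.Icc (0 : ℝ) 1,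
        Φ.tubeFn (Function.update y k.succ (D.δLin (D.δLin (y k.succ))))
          (fun j => (1 - t) * ζ (k.succ.succAbove j) + t * ζ (k.castSucc.succAbove j)) := by
  set y' := Function.update y k.succ (D.δLin (D.δLin (y k.succ)))
  -- A pair of points that differ in one coordinate is encoded by a single point of a larger tube:
  -- omitting one or the other of two adjacent coordinates gives the pair. Both sides thus become
  -- functions on one tube, to be compared at real points.
  have hdel : ∀ (p : Fin (n + 2)) (ζ : Fin (n + 2) → ℂ), ζ ∈ tube (n + 2) →
      (fun j => ζ (p.succAbove j)) ∈ tube (n + 1) := fun p ζ hζ =>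
    ⟨fun i j hij => hζ.1 ((Fin.strictMono_succAbove p).monotone hij), fun i => hζ.2 _⟩
  have hF : ∀ p : Fin (n + 2), TubeHolo fun ζ : Fin (n + 2) → ℂ =>
      Φ.tubeFn y fun j => ζ (p.succAbove j) := fun p =>
    (hΦ.tubeHolo y).comp (A := fun ζ j => ζ (p.succAbove j)) (by fun_prop)
      (fun a b => ⟨fun j => a (p.succAbove j), fun j => b (p.succAbove j), fun w => rfl⟩) (hdel p)
  have hG : TubeHolo fun ζ : Fin (n + 2) → ℂ => ∫ t in Set.Icc (0 : ℝ) 1,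
        Φ.tubeFn y'
          (fun j => (1 - t) * ζ (k.succ.succAbove j) + t * ζ (k.castSucc.succAbove j)) := by
    refine TubeHolo.integral isCompact_Icc measurableSet_Icc (hΦ.tubeHolo y')
      (A := fun ζ (t : ℝ) j => (1 - t) * ζ (k.succ.succAbove j) + t * ζ (k.castSucc.succAbove j))
      ?_ (fun t a b => ?_) fun ζ hζ t ht => ?_
    · refine continuous_pi fun j => ?_
      simp only [Function.uncurry]
      fun_prop
    · refine ⟨fun j => (1 - t) * a (k.succ.succAbove j) + t * a (k.castSucc.succAbove j),
        fun j => (1 - t) * b (k.succ.succAbove j) + t * b (k.castSucc.succAbove j), fun w => ?_⟩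
      ext j
      simp only [Pi.add_apply, Pi.smul_apply, smul_eq_mul]
      ring
    · have := convex_tube (n + 1) (hdel k.succ ζ hζ) (hdel k.castSucc ζ hζ)
        (sub_nonneg.2 ht.2) ht.1 (by ring)
      convert this using 1
      ext j
      simp
  refine ((hF k.castSucc).sub (hF k.succ)).eqOn (G := fun ζ : Fin (n + 2) → ℂ =>
      (Complex.I * (ζ k.succ - ζ k.castSucc)) * ∫ t in Set.Icc (0 : ℝ) 1, Φ.tubeFn y'
          (fun j => (1 - t) * ζ (k.succ.succAbove j) + t * ζ (k.castSucc.succAbove j)))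
    ((TubeHolo.of_differentiable (by fun_prop)).mul hG) (fun s => ?_) hζ
  set r : Fin n → ℝ := fun i => s (k.castSucc.succAbove (k.succAbove i)) with hr
  have hins : ∀ t : ℝ, (fun j => ((1 - t) * s (k.succ.succAbove j) +
      t * s (k.castSucc.succAbove j) : ℝ)) =
      Fin.insertNth k (s k.castSucc + (s k.succ - s k.castSucc) * t) r := by
    intro t
    ext j
    refine Fin.succAboveCases k ?_ (fun i => ?_) j
    · rw [Fin.insertNth_apply_same, Fin.succAbove_succ_self, Fin.succAbove_castSucc_self]
      ring
    · rw [Fin.insertNth_apply_succAbove, succ_succAbove_of_ne (Fin.succAbove_ne k i)]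
      ring
  have h0 := hins 0
  have h1 := hins 1
  simp only [sub_zero, one_mul, zero_mul, add_zero, mul_zero, mul_one, sub_self, zero_add,
    add_sub_cancel] at h0 h1
  have hint : ∀ t : ℝ, Φ.tubeFn y' (fun j => (1 - (t : ℂ)) * (s (k.succ.succAbove j) : ℂ) +
      t * (s (k.castSucc.succAbove j) : ℂ)) =
      Φ.npt y' (Fin.insertNth k (s k.castSucc + (s k.succ - s k.castSucc) * t) r) := by
    intro t
    rw [← hins, ← hΦ.apply_real]
    push_cast
    rfl
  -- At real times the claim is the usual fundamental theorem of calculus, by supersymmetry.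
  have hFTC : ∫ t in (s k.castSucc)..(s k.succ), Complex.I * Φ.npt y' (Fin.insertNth k t r) =
      Φ.npt y (Fin.insertNth k (s k.succ) r) - Φ.npt y (Fin.insertNth k (s k.castSucc) r) := by
    refine intervalIntegral.integral_eq_sub_of_hasDerivAt
      (fun t _ => Φ.hasDerivAt_npt_insertNth y k r t) (Continuous.intervalIntegrable ?_ _ _)
    exact continuous_const.mul ((hΦ.continuous_npt y').comp
      (Continuous.finInsertNth k (continuous_id' (X := ℝ)) (continuous_const (y := r))))
  simp only [hint]
  rw [hΦ.apply_real y fun j => s (k.castSucc.succAbove j),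
    hΦ.apply_real y fun j => s (k.succ.succAbove j), h0, h1, ← hFTC,
    intervalIntegral.integral_const_mul, integral_Icc_eq_integral_Ioc,
    ← intervalIntegral.integral_of_le zero_le_one]
  have := intervalIntegral.smul_integral_comp_add_mul (a := 0) (b := 1)
    (fun t => Φ.npt y' (Fin.insertNth k t r)) (s k.succ - s k.castSucc) (s k.castSucc)
  rw [mul_zero, mul_one, add_zero, add_sub_cancel, Complex.real_smul] at this
  rw [← this]
  push_cast
  ring

theorem intervalIntegral_tubeFn (hΦ : Φ.HasContinuations) {n : ℕ} (y : Fin (n + 2) → D.smooth) (k : Fin (n + 1))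
    {v : Fin n → ℝ} (hv : v ∈ orderSimplex n) :
    ∫ t in (lo v k)..(hi v k),
      Φ.tubeFn (Function.update y k.succ (D.δLin (D.δLin (y k.succ))))
        (cpt 0 (Fin.insertNth k t v)) =
      Φ.tubeFn y (cpt 0 (Fin.insertNth k (lo v k) v)) -
        Φ.tubeFn y (cpt 0 (Fin.insertNth k (hi v k) v)) := by
  set u : Fin (n + 2) → ℝ := Fin.insertNth k.castSucc (lo v k) (Fin.insertNth k (hi v k) v)
  have hlh := lo_le_hi hv k
  have hu : u ∈ orderSimplex (n + 2) := by
    refine insertNth_mem_orderSimplex.2 ⟨insertNth_mem_orderSimplex.2 ⟨hv, hlh, le_rfl⟩, ?_, ?_⟩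
    · rw [lo_insertNth_castSucc]
    · rwa [hi_castSucc, Fin.insertNth_apply_same]
  have h0 : u k.castSucc = lo v k := Fin.insertNth_apply_same _ _ _
  have hsucc : ∀ j, u (k.castSucc.succAbove j) = (Fin.insertNth k (hi v k) v : Fin (n + 1) → ℝ) j :=
    fun j => Fin.insertNth_apply_succAbove _ _ _ j
  have h1 : u k.succ = hi v k := by
    rw [← Fin.succAbove_castSucc_self, hsucc, Fin.insertNth_apply_same]
  have hcast : ∀ j, u (k.succ.succAbove j) = (Fin.insertNth k (lo v k) v : Fin (n + 1) → ℝ) j := by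
    intro j
    refine Fin.succAboveCases k ?_ (fun i => ?_) j
    · rw [Fin.succAbove_succ_self, h0, Fin.insertNth_apply_same]
    · rw [succ_succAbove_of_ne (Fin.succAbove_ne k i), hsucc, Fin.insertNth_apply_succAbove,
        Fin.insertNth_apply_succAbove]
  have h := hΦ.tubeFn_sub_tubeFn y k (cpt_mem_tube_of hu 0)
  have e1 : (fun j => cpt 0 u (k.castSucc.succAbove j)) = cpt 0 (Fin.insertNth k (hi v k) v) := by
    ext j; simp only [cpt, hsucc, Pi.zero_apply]
  have e0 : (fun j => cpt 0 u (k.succ.succAbove j)) = cpt 0 (Fin.insertNth k (lo v k) v) := by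
    ext j; simp only [cpt, hcast, Pi.zero_apply]
  have et : ∀ t : ℝ, (fun j => (1 - (t : ℂ)) * cpt 0 u (k.succ.succAbove j) +
      t * cpt 0 u (k.castSucc.succAbove j)) =
      cpt 0 (Fin.insertNth k (lo v k + (hi v k - lo v k) * t) v) := by
    intro t
    ext j
    simp only [cpt, hsucc, hcast, Pi.zero_apply]
    refine Fin.succAboveCases k ?_ (fun i => ?_) j
    · simp only [Fin.insertNth_apply_same]
      push_cast
      ring
    · simp only [Fin.insertNth_apply_succAbove]
      push_cast
      ring
  rw [e1, e0] at h
  simp only [et] at h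
  rw [integral_Icc_eq_integral_Ioc, ← intervalIntegral.integral_of_le zero_le_one] at h
  have := intervalIntegral.smul_integral_comp_add_mul (a := 0) (b := 1)
    (fun t => Φ.tubeFn (Function.update y k.succ (D.δLin (D.δLin (y k.succ))))
        (cpt 0 (Fin.insertNth k t v))) (hi v k - lo v k) (lo v k)
  rw [mul_zero, mul_one, add_zero, add_sub_cancel, Complex.real_smul] at this
  -- The i from the derivative and the i from the imaginary direction multiply to -1; therefore the
  -- lower end enters with the positive sign.
  have hI : Complex.I * (cpt 0 u k.succ - cpt 0 u k.castSucc) = -((hi v k - lo v k : ℝ) : ℂ) := by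
    simp only [cpt, h0, h1, Pi.zero_apply]
    push_cast
    linear_combination ((hi v k : ℂ) - lo v k) * Complex.I_mul_I
  rw [hI, neg_mul, this] at h
  linear_combination h

end HasContinuations

end SKMSFunctional

end TubeFunctionIdentities

section JLO

variable {H : Type*} [NormedAddCommGroup H] [InnerProductSpace ℂ H] [CompleteSpace H]

/-! ### The components of the cocycle -/

theorem I_mem_strip : Complex.I ∈ strip := by simp [strip]

theorem IsStripContinuation.analContAtI_eq {f : ℝ → ℂ} {F : ℂ → ℂ}
    (hF : IsStripContinuation f F) : analContAtI f = F Complex.I := by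
  have h : ∃ F, IsStripContinuation f F := ⟨F, hF⟩
  rw [analContAtI, dif_pos h]
  exact h.choose_spec.eqOn hF I_mem_strip

namespace Superderivation

variable {N : GradedNet H} (D : Superderivation N)

theorem γHom_δLin_toSmooth (x : D.evenSmooth) :
    D.γHom (D.δLin (D.toSmooth x)) = -D.δLin (D.toSmooth x) := by
  rw [γHom_δLin, γHom_toSmooth]

/-- The inclusion of `C^∞(δ)_c^γ` into `C^∞(δ)_c` as a linear map. -/
def toSmoothLin : D.evenSmooth →ₗ[ℂ] D.smooth where
  toFun := D.toSmooth
  map_add' _ _ := rfl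
  map_smul' _ _ := rfl

theorem toSmooth_one : D.toSmooth 1 = 1 := rfl

theorem toSmooth_mul (x y : D.evenSmooth) : D.toSmooth (x * y) = D.toSmooth x * D.toSmooth y := rfl

theorem δLin_toSmooth_mul (x y : D.evenSmooth) : D.δLin (D.toSmooth (x * y)) =
    D.δLin (D.toSmooth x) * D.toSmooth y + D.toSmooth x * D.δLin (D.toSmooth y) := by
  rw [toSmooth_mul, δLin_mul, γHom_toSmooth]

/-- The map applied to the `i`-th argument: the inclusion for `i = 0` and `δ` otherwise. -/
def entry {n : ℕ} (i : Fin (n + 1)) : D.evenSmooth →ₗ[ℂ] D.smooth :=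
  if i = 0 then D.toSmoothLin else D.δLin ∘ₗ D.toSmoothLin

/-- The entries `x_0, δ(x_1), ..., δ(x_n)` as smooth elements. -/
def entries {n : ℕ} (x : Fin (n + 1) → D.evenSmooth) : Fin (n + 1) → D.smooth :=
  fun i => D.entry i (x i)

@[simp] theorem entries_zero {n : ℕ} (x : Fin (n + 1) → D.evenSmooth) :
    D.entries x 0 = D.toSmooth (x 0) := by
  rw [entries, entry, if_pos rfl]; rfl

@[simp] theorem entries_succ {n : ℕ} (x : Fin (n + 1) → D.evenSmooth) (i : Fin n) :
    D.entries x i.succ = D.δLin (D.toSmooth (x i.succ)) := by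
  rw [entries, entry, if_neg (Fin.succ_ne_zero i)]; rfl

theorem entries_of_ne_zero {n : ℕ} (x : Fin (n + 1) → D.evenSmooth) {i : Fin (n + 1)}
    (hi : i ≠ 0) : D.entries x i = D.δLin (D.toSmooth (x i)) := by
  rw [entries, entry, if_neg hi]; rfl

theorem graphNorm_nonneg (x : D.evenSmooth) : 0 ≤ D.graphNorm x :=
  add_nonneg (norm_nonneg _) (norm_nonneg _)

theorem norm_entries_le {n : ℕ} (x : Fin (n + 1) → D.evenSmooth) (i : Fin (n + 1)) :
    ‖(D.entries x i : H →L[ℂ] H)‖ ≤ D.graphNorm (x i) := by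
  refine Fin.cases ?_ (fun i => ?_) i
  · rw [entries_zero]
    exact le_add_of_nonneg_right (norm_nonneg _)
  · rw [entries_succ]
    exact le_add_of_nonneg_left (norm_nonneg _)

theorem entries_mem_alg {n : ℕ} {x : Fin (n + 1) → D.evenSmooth} {I : BddInterval}
    (hx : ∀ i, (x i : H →L[ℂ] H) ∈ N.alg I) (i : Fin (n + 1)) :
    (D.entries x i : H →L[ℂ] H) ∈ N.alg I := by
  refine Fin.cases ?_ (fun i => ?_) i
  · rw [entries_zero]
    exact hx 0
  · rw [entries_succ]
    exact D.δ_local I ⟨x i.succ, D.smooth_le_dom (x i.succ).2.1⟩ (hx i.succ)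

end Superderivation

namespace SKMSFunctional

variable {N : GradedNet H} {D : Superderivation N} (Φ : SKMSFunctional D)

theorem jloEntries_eq {n : ℕ} (x : Fin (n + 1) → D.evenSmooth) :
    Φ.jloEntries x = fun j => Φ.ofSmooth (D.entries x j) := by
  ext1 j
  refine Fin.cases ?_ (fun i => ?_) j
  · rw [D.entries_zero]; rfl
  · rw [D.entries_succ]; rfl

theorem jloIntegrand_eq {n : ℕ} (x : Fin (n + 1) → D.evenSmooth) (t : ℝ) (s : Fin n → ℝ) :
    Φ.jloIntegrand x t s = Φ.npt (D.entries x) fun j => s j * t := by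
  rw [jloIntegrand, jloEntries_eq, multiPoint_ofSmooth]

/-- The integral over the simplex of the continued multi-point function. -/
def simplexIntegral {n : ℕ} (y : Fin (n + 1) → D.smooth) : ℂ :=
  ∫ u in orderSimplex n, Φ.tubeFn y (cpt 0 u)

namespace HasContinuations

variable {Φ}

theorem integrableOn_tubeFn (hΦ : Φ.HasContinuations) {n : ℕ} (y : Fin (n + 1) → D.smooth) :
    IntegrableOn (fun u => Φ.tubeFn y (cpt 0 u)) (orderSimplex n) :=
  integrableOn_orderSimplex (hΦ.continuousOn_cpt_zero y)

theorem integrableOn_jloIntegrand (hΦ : Φ.HasContinuations) {n : ℕ}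
    (x : Fin (n + 1) → D.evenSmooth) (t : ℝ) :
    IntegrableOn (Φ.jloIntegrand x t) (orderSimplex n) := by
  refine integrableOn_orderSimplex (Continuous.continuousOn ?_)
  have : Φ.jloIntegrand x t = fun s => Φ.npt (D.entries x) fun j => s j * t :=
    funext (Φ.jloIntegrand_eq x t)
  rw [this]
  exact (hΦ.continuous_npt _).comp (by fun_prop)

/-- For s in the simplex, z ↦ (z s_j) maps the strip into the tube, so the integral is one of affine
pull-backs; the strip is treated as the tube in one variable. -/
theorem isStripContinuation_jloIntegral (hΦ : Φ.HasContinuations) {n : ℕ}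
    (x : Fin (n + 1) → D.evenSmooth) :
    IsStripContinuation (Φ.jloIntegral x)
      fun z => ∫ s in orderSimplex n, Φ.tubeFn (D.entries x) fun j => z * s j := by
  have h : TubeHolo fun ζ : Fin 1 → ℂ =>
      ∫ s in orderSimplex n, Φ.tubeFn (D.entries x) fun j => ζ 0 * s j := by
    refine TubeHolo.integral (isCompact_orderSimplex n) (measurableSet_orderSimplex n)
      (hΦ.tubeHolo _) (A := fun ζ s j => ζ 0 * (s j : ℂ)) ?_ (fun s a b => ?_) fun ζ hζ s hs => ?_
    · refine continuous_pi fun j => ?_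
      simp only [Function.uncurry]
      fun_prop
    · refine ⟨fun j => a 0 * s j, fun j => b 0 * s j, fun w => ?_⟩
      ext j
      simp only [Pi.add_apply, Pi.smul_apply, smul_eq_mul]
      ring
    · have := smul_mem_orderSimplex hs (hζ.2 0).1 (hζ.2 0).2
      simpa [tube, Pi.smul_def] using this
  obtain ⟨h1, h2⟩ := h.strip_line (a := 0) (b := fun _ => 1) fun w hw => by
    refine ⟨fun i j _ => ?_, fun i => ?_⟩
    · simp
    · simpa [strip] using hw
  simp only [Pi.add_apply, Pi.zero_apply, Pi.smul_apply, smul_eq_mul, mul_one, zero_add] at h1 h2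
  refine ⟨h1, h2, fun t => ?_⟩
  rw [jloIntegral]
  refine integral_congr_ae (Filter.Eventually.of_forall fun s => ?_)
  simp only [jloIntegrand_eq]
  rw [← hΦ.apply_real]
  congr 1
  ext j
  push_cast
  ring

theorem jlo_eq (hΦ : Φ.HasContinuations) {n : ℕ} (hn : Even n) (x : Fin (n + 1) → D.evenSmooth) :
    Φ.jlo n x = Φ.simplexIntegral (D.entries x) := by
  rw [jlo, if_pos hn, (hΦ.isStripContinuation_jloIntegral x).analContAtI_eq, simplexIntegral]
  refine integral_congr_ae (Filter.Eventually.of_forall fun s => ?_)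
  simp only
  congr 1
  ext j
  simp [cpt, mul_comm]

theorem simplexIntegral_update_add (hΦ : Φ.HasContinuations) {n : ℕ} (y : Fin (n + 1) → D.smooth)
    (i : Fin (n + 1)) (a b : D.smooth) : Φ.simplexIntegral (Function.update y i (a + b)) =
      Φ.simplexIntegral (Function.update y i a) + Φ.simplexIntegral (Function.update y i b) := by
  rw [simplexIntegral, simplexIntegral, simplexIntegral,
    ← integral_add (hΦ.integrableOn_tubeFn _) (hΦ.integrableOn_tubeFn _)]
  exact setIntegral_congr_fun (measurableSet_orderSimplex n) fun u hu =>
    hΦ.tubeFn_update_add y i a b (cpt_mem_tube.2 hu)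

theorem simplexIntegral_update_smul (hΦ : Φ.HasContinuations) {n : ℕ} (y : Fin (n + 1) → D.smooth)
    (i : Fin (n + 1)) (c : ℂ) (a : D.smooth) :
    Φ.simplexIntegral (Function.update y i (c • a)) =
      c • Φ.simplexIntegral (Function.update y i a) := by
  rw [simplexIntegral, simplexIntegral, smul_eq_mul, ← integral_const_mul]
  exact setIntegral_congr_fun (measurableSet_orderSimplex n) fun u hu =>
    hΦ.tubeFn_update_smul y i c a (cpt_mem_tube.2 hu)

/-- `simplexIntegral` as a multilinear form. -/
def simplexIntegralML (hΦ : Φ.HasContinuations) (n : ℕ) :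
    MultilinearMap ℂ (fun _ : Fin (n + 1) => D.smooth) ℂ :=
  MultilinearMap.mk' Φ.simplexIntegral hΦ.simplexIntegral_update_add hΦ.simplexIntegral_update_smul

theorem simplexIntegralML_apply (hΦ : Φ.HasContinuations) {n : ℕ} (y : Fin (n + 1) → D.smooth) :
    hΦ.simplexIntegralML n y = Φ.simplexIntegral y := rfl

/-- The cochain with components `τ_n`. -/
def jloCochain (hΦ : Φ.HasContinuations) : Cochain D.evenSmooth := fun n =>
  if Even n then (hΦ.simplexIntegralML n).compLinearMap D.entry else 0

theorem jloCochain_of_even (hΦ : Φ.HasContinuations) {n : ℕ} (hn : Even n)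
    (x : Fin (n + 1) → D.evenSmooth) :
    hΦ.jloCochain n x = Φ.simplexIntegral (D.entries x) := by
  rw [jloCochain, if_pos hn]
  rfl

theorem jloCochain_of_odd (hΦ : Φ.HasContinuations) {n : ℕ} (hn : ¬ Even n) :
    hΦ.jloCochain n = 0 := by
  rw [jloCochain, if_neg hn]

theorem jloCochain_apply (hΦ : Φ.HasContinuations) (n : ℕ) (x : Fin (n + 1) → D.evenSmooth) :
    hΦ.jloCochain n x = Φ.jlo n x := by
  by_cases hn : Even n
  · rw [hΦ.jloCochain_of_even hn, hΦ.jlo_eq hn]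
  · rw [hΦ.jloCochain_of_odd hn, jlo, if_neg hn]
    rfl

theorem isEvenCochain_jloCochain (hΦ : Φ.HasContinuations) : IsEvenCochain hΦ.jloCochain :=
  fun n => hΦ.jloCochain_of_odd (by simp)

theorem jloCochain_normalized (hΦ : Φ.HasContinuations) (n : ℕ) (x : Fin (n + 1) → D.evenSmooth)
    (h : ∃ i, i ≠ 0 ∧ ∃ c : ℂ, x i = algebraMap ℂ D.evenSmooth c) : hΦ.jloCochain n x = 0 := by
  by_cases hn : Even n
  · obtain ⟨i, hi, c, hc⟩ := h
    rw [hΦ.jloCochain_of_even hn, ← simplexIntegralML_apply hΦ]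
    refine MultilinearMap.map_coord_zero _ i ?_
    rw [D.entries_of_ne_zero x hi, hc, Algebra.algebraMap_eq_smul_one]
    change D.δLin (D.toSmoothLin (c • 1)) = 0
    rw [map_smul, map_smul]
    change c • D.δLin (D.toSmooth 1) = 0
    rw [D.toSmooth_one, D.δLin_one, smul_zero]
  · rw [hΦ.jloCochain_of_odd hn]
    rfl

end HasContinuations

/-! ### Entireness of the cochain -/

theorem norm_simplexIntegral_entries_le {C₁ C₂ : ℝ} (hC₁ : 0 < C₁) (hC₂ : 0 < C₂)
    (hΦ : Φ.LocallyExpBounded C₁ C₂) {I : BddInterval} {n : ℕ} {x : Fin (n + 1) → D.evenSmooth}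
    (hx : ∀ i, (x i : H →L[ℂ] H) ∈ N.alg I) :
    ‖Φ.simplexIntegral (D.entries x)‖ ≤
      C₁ * Real.exp (2 * C₂ * (I.radius + 1) ^ 2 * (n + 1)) *
        Real.exp (2 * C₂ * (I.radius + 1) * n) * (∏ i, D.graphNorm (x i)) / n.factorial := by
  refine norm_setIntegral_orderSimplex_le fun u hu => ?_
  have hcont := Φ.hasContinuations hC₁ hC₂ hΦ
  obtain ⟨F, hF, hv, hb⟩ := Φ.exists_tubeHolo (x := fun j => Φ.ofSmooth (D.entries x j))
    hC₁ hC₂ hΦ (fun i => D.entries_mem_alg hx i)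
  have hz : cpt 0 u ∈ tube n := cpt_mem_tube.2 hu
  rw [hcont.eqOn hF (fun s => by
    rw [← cpt_zero, ← vtx_last, hv, vertexFn_last, multiPoint_ofSmooth]) _ hz]
  refine (hb _ hz).trans ?_
  have hr := I.radius_pos
  have hsum : ∑ k, ‖cpt 0 u k‖ ^ 2 ≤ n := by
    calc ∑ k, ‖cpt 0 u k‖ ^ 2 ≤ ∑ _k : Fin n, (1 : ℝ) := by
          refine Finset.sum_le_sum fun k _ => ?_
          have h1 := hu.2 k
          simp only [cpt, Pi.zero_apply, Complex.ofReal_zero, zero_add, norm_mul, Complex.norm_I,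
            mul_one, Complex.norm_real, Real.norm_eq_abs, sq_abs]
          nlinarith [h1.1, h1.2]
      _ = n := by simp
  gcongr with i
  exact D.norm_entries_le x i

/-- A single term of the exponential series of n is at most eⁿ. -/
theorem pow_inv_factorial_le (n : ℕ) (hn : n ≠ 0) :
    (1 : ℝ) / n.factorial ≤ (Real.exp 1 / n) ^ n := by
  have h := Real.pow_div_factorial_le_exp (n : ℝ) (Nat.cast_nonneg n) n
  have hn' : (0 : ℝ) < (n : ℝ) ^ n := by positivity
  rw [div_pow, ← Real.exp_nat_mul, mul_one, le_div_iff₀ hn']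
  calc 1 / (n.factorial : ℝ) * (n : ℝ) ^ n = (n : ℝ) ^ n / n.factorial := by ring
    _ ≤ _ := h

/-- Factorial decay of the components makes a cochain entire. -/
theorem tendsto_restrictedNorm {A : StarSubalgebra ℂ (H →L[ℂ] H)} {nrm : A → ℝ}
    (hnrm : ∀ x, 0 ≤ nrm x) (M : Set (H →L[ℂ] H)) (ρ : Cochain A) {C K : ℝ} (hK : 0 ≤ K)
    (h : ∀ (n : ℕ) (x : Fin (n + 1) → A), (∀ i, (x i : H →L[ℂ] H) ∈ M) →
      ‖ρ n x‖ ≤ C * K ^ n / n.factorial * ∏ i, nrm (x i)) :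
    Tendsto (fun n : ℕ => (n : ℝ≥0∞) ^ (1 / 2 : ℝ) *
      restrictedNorm nrm M (ρ n) ^ (1 / (n : ℝ))) atTop (𝓝 0) := by
  -- Replacing C by max C 1 allows C ≤ (max C 1)ⁿ, so everything is an n-th power; the root is L/n
  -- and the product with n^{1/2} is L n^{-1/2}.
  set L := max C 1 * (K * Real.exp 1) with hL
  have hL0 : 0 ≤ L := by positivity
  have hlim : Tendsto (fun n : ℕ => ENNReal.ofReal (L * (n : ℝ) ^ (-(1 / 2 : ℝ)))) atTop (𝓝 0) := by
    have h1 : Tendsto (fun n : ℕ => L * (n : ℝ) ^ (-(1 / 2 : ℝ))) atTop (𝓝 (L * 0)) :=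
      ((tendsto_rpow_neg_atTop (by norm_num)).comp tendsto_natCast_atTop_atTop).const_mul L
    have := (ENNReal.continuous_ofReal.tendsto _).comp h1
    simpa [Function.comp_def] using this
  refine tendsto_of_tendsto_of_tendsto_of_le_of_le' tendsto_const_nhds hlim
    (Filter.Eventually.of_forall fun n => bot_le) ?_
  filter_upwards [Filter.eventually_ge_atTop 1] with n hn
  have hn0 : n ≠ 0 := by omega
  have hn' : (0 : ℝ) < n := by positivity
  have hb : restrictedNorm nrm M (ρ n) ≤ ENNReal.ofReal ((L / n) ^ n) := by
    refine iSup_le fun x => ENNReal.ofReal_le_ofReal ?_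
    refine div_le_of_le_mul₀ (Finset.prod_nonneg fun i _ => hnrm _) (by positivity) ?_
    refine (h n x.1 x.2).trans ?_
    refine mul_le_mul_of_nonneg_right ?_ (Finset.prod_nonneg fun i _ => hnrm _)
    have hC1 : C ≤ max C 1 ^ n :=
      (le_max_left C 1).trans (le_self_pow₀ (le_max_right C 1) hn0)
    calc C * K ^ n / n.factorial = C * K ^ n * (1 / n.factorial) := by ring
      _ ≤ max C 1 ^ n * K ^ n * (Real.exp 1 / n) ^ n := by
        gcongr
        exact pow_inv_factorial_le n hn0
      _ = (L / n) ^ n := by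
        rw [← mul_pow, ← mul_pow, hL]
        congr 1
        ring
  have hroot : restrictedNorm nrm M (ρ n) ^ (1 / (n : ℝ)) ≤ ENNReal.ofReal (L / n) := by
    refine (ENNReal.rpow_le_rpow hb (by positivity)).trans (le_of_eq ?_)
    rw [ENNReal.ofReal_rpow_of_nonneg (by positivity) (by positivity), one_div,
      Real.pow_rpow_inv_natCast (by positivity) hn0]
  have hn2 : (n : ℝ≥0∞) ^ (1 / 2 : ℝ) = ENNReal.ofReal ((n : ℝ) ^ (1 / 2 : ℝ)) := by
    rw [← ENNReal.ofReal_rpow_of_nonneg hn'.le (by norm_num), ENNReal.ofReal_natCast]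
  calc _ ≤ ENNReal.ofReal ((n : ℝ) ^ (1 / 2 : ℝ)) * ENNReal.ofReal (L / n) := by
        rw [hn2]; gcongr
    _ = ENNReal.ofReal (L * (n : ℝ) ^ (-(1 / 2 : ℝ))) := by
        rw [← ENNReal.ofReal_mul (by positivity)]
        congr 1
        have : (n : ℝ) ^ (-(1 / 2 : ℝ)) = (n : ℝ) ^ (1 / 2 : ℝ) / n := by
          rw [show (-(1 / 2 : ℝ)) = 1 / 2 - 1 by norm_num, Real.rpow_sub_one hn'.ne']
        rw [this]
        ring

theorem jloCochain_entire {C₁ C₂ : ℝ} (hC₁ : 0 < C₁) (hC₂ : 0 < C₂)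
    (hΦ : Φ.LocallyExpBounded C₁ C₂) (I : BddInterval) :
    Tendsto (fun n : ℕ => (n : ℝ≥0∞) ^ (1 / 2 : ℝ) *
      restrictedNorm D.graphNorm (N.alg I : Set (H →L[ℂ] H))
        ((Φ.hasContinuations hC₁ hC₂ hΦ).jloCochain n) ^ (1 / (n : ℝ))) atTop (𝓝 0) := by
  set a := 2 * C₂ * (I.radius + 1) ^ 2
  set b := 2 * C₂ * (I.radius + 1)
  refine tendsto_restrictedNorm D.graphNorm_nonneg _ _ (C := C₁ * Real.exp a)
    (K := Real.exp (a + b)) (by positivity) fun n x hx => ?_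
  have hprod : 0 ≤ ∏ i, D.graphNorm (x i) := Finset.prod_nonneg fun i _ => D.graphNorm_nonneg _
  by_cases hn : Even n
  · rw [HasContinuations.jloCochain_of_even _ hn]
    refine (Φ.norm_simplexIntegral_entries_le hC₁ hC₂ hΦ hx).trans (le_of_eq ?_)
    have : Real.exp (a * (n + 1)) * Real.exp (b * n) = Real.exp a * Real.exp (a + b) ^ n := by
      rw [← Real.exp_add, ← Real.exp_nat_mul, ← Real.exp_add]
      congr 1
      ring
    rw [mul_assoc C₁, this]
    ring
  · rw [HasContinuations.jloCochain_of_odd _ hn, zero_apply, norm_zero]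
    positivity

end SKMSFunctional

end JLO

section Cocycle

variable {H : Type*} [NormedAddCommGroup H] [InnerProductSpace ℂ H] [CompleteSpace H]

/-! ### The cocycle identity -/

theorem cpt_zero_rot {n : ℕ} (u : Fin n → ℝ) :
    (fun j : Fin n => Complex.I - loC (cpt 0 u) (Fin.last n) + loC (cpt 0 u) j.castSucc) =
      cpt 0 (rot u) := by
  ext j
  simp only [loC_cpt_zero, cpt, rot, Pi.zero_apply]
  push_cast
  ring

theorem cons_last_castSucc {α : Type*} {n : ℕ} (y : Fin (n + 1) → α) :
    (Fin.cons (y (Fin.last n)) fun j : Fin n => y j.castSucc) = fun i => y (i - 1) := by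
  ext1 i
  refine Fin.cases ?_ (fun j => ?_) i
  · rw [Fin.cons_zero]
    congr 1
    rw [zero_sub]
    exact (neg_eq_of_add_eq_zero_left (Fin.last_add_one n)).symm
  · rw [Fin.cons_succ]
    congr 1
    rw [← Fin.coeSucc_eq_succ, add_sub_cancel_right]

theorem prod_ite_lt_neg_one {n : ℕ} (k : Fin n) :
    ∏ i : Fin n, (if i < k then (-1 : ℂ) else 1) = (-1) ^ (k : ℕ) := by
  rw [Finset.prod_ite, Finset.prod_const_one, mul_one, Finset.prod_const]
  have : (Finset.univ.filter fun i : Fin n => i < k) = Finset.Iio k := by ext; simp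
  rw [this, Fin.card_Iio]

theorem insertNth_succ_eq {n : ℕ} (i : Fin n) (v : Fin n → ℝ) :
    (Fin.insertNth i.succ (v i) v : Fin (n + 1) → ℝ) = Fin.insertNth i.castSucc (v i) v := by
  ext j
  refine Fin.succAboveCases i.succ ?_ (fun l => ?_) j
  · rw [Fin.insertNth_apply_same, ← Fin.succAbove_castSucc_self, Fin.insertNth_apply_succAbove]
  · rw [Fin.insertNth_apply_succAbove]
    by_cases h : l = i
    · subst h
      rw [Fin.succAbove_succ_self, Fin.insertNth_apply_same]
    · rw [succ_succAbove_of_ne h, Fin.insertNth_apply_succAbove]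

namespace SKMSFunctional

variable {N : GradedNet H} {D : Superderivation N} {Φ : SKMSFunctional D}

namespace HasContinuations

theorem tubeFn_smul (hΦ : Φ.HasContinuations) {n : ℕ} (y : Fin (n + 1) → D.smooth)
    {z : Fin n → ℂ} (hz : z ∈ tube n) (c : Fin (n + 1) → ℂ) :
    Φ.tubeFn (fun i => c i • y i) z = (∏ i, c i) * Φ.tubeFn y z :=
  (hΦ.multilinear z hz).map_smul_univ c y

/-- Of the n + 1 odd entries all but the one brought to the front receive γ, hence the sign. -/
theorem tubeFn_rotate_odd (hΦ : Φ.HasContinuations) {n : ℕ} {y : Fin (n + 1) → D.smooth}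
    (hy : ∀ i, D.γHom (y i) = -y i) {u : Fin n → ℝ} (hu : u ∈ orderSimplex n) :
    Φ.tubeFn y (cpt 0 u) = (-1) ^ n * Φ.tubeFn (fun i => y (i - 1)) (cpt 0 (rot u)) := by
  rw [hΦ.tubeFn_rotate y (cpt_mem_tube.2 hu), cpt_zero_rot, ← cons_last_castSucc]
  have e : (Fin.cons (y (Fin.last n)) fun j : Fin n => D.γHom (y j.castSucc)) =
      fun i => (Fin.cons 1 fun _ => -1 : Fin (n + 1) → ℂ) i •
        (Fin.cons (y (Fin.last n)) fun j : Fin n => y j.castSucc : Fin (n + 1) → D.smooth) i := by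
    ext1 i
    refine Fin.cases ?_ (fun j => ?_) i <;> simp [hy]
  rw [e, hΦ.tubeFn_smul _ (cpt_mem_tube.2 (rot_mem_orderSimplex.2 hu)), Fin.prod_univ_succ]
  simp

/-- Rotation moves the 1 from the front to the end past n + 1 odd entries, an even number. There
nothing depends on the last time, and integrating it out gives the last gap. -/
theorem simplexIntegral_cons_one (hΦ : Φ.HasContinuations) {n : ℕ} {y : Fin (n + 1) → D.smooth}
    (hn : Odd n) (hy : ∀ i, D.γHom (y i) = -y i) :
    Φ.simplexIntegral (Fin.cons 1 y : Fin (n + 2) → D.smooth) =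
      ∫ v in orderSimplex n, gap (Fin.last n) v * Φ.tubeFn y (cpt 0 v) := by
  rw [simplexIntegral, ← setIntegral_rot]
  have e : ∀ u ∈ orderSimplex (n + 1),
      Φ.tubeFn (Fin.cons 1 y : Fin (n + 2) → D.smooth) (cpt 0 (rot u)) =
        Φ.tubeFn (Fin.snoc y 1 : Fin (n + 2) → D.smooth) (cpt 0 u) := by
    intro u hu
    rw [hΦ.tubeFn_rotate _ (cpt_mem_tube.2 hu), cpt_zero_rot]
    have e : (Fin.cons ((Fin.snoc y 1 : Fin (n + 2) → D.smooth) (Fin.last (n + 1)))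
        fun j : Fin (n + 1) => D.γHom ((Fin.snoc y 1 : Fin (n + 2) → D.smooth) j.castSucc)) =
        fun i => (Fin.cons 1 fun _ => -1 : Fin (n + 2) → ℂ) i •
          (Fin.cons 1 y : Fin (n + 2) → D.smooth) i := by
      ext1 i
      refine Fin.cases ?_ (fun j => ?_) i <;> simp [hy]
    rw [e, hΦ.tubeFn_smul _ (cpt_mem_tube.2 (rot_mem_orderSimplex.2 hu)), Fin.prod_univ_succ]
    simp [hn.add_one.neg_one_pow]
  rw [setIntegral_congr_fun (measurableSet_orderSimplex _) e]
  refine setIntegral_orderSimplex_init (hΦ.integrableOn_tubeFn _)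
    (g := fun v => Φ.tubeFn y (cpt 0 v)) fun u hu => ?_
  rw [hΦ.tubeFn_snoc_one y (cpt_mem_tube.2 hu)]
  rfl

/-- Undoing the cyclic permutation of the entries rotates the gap instead; the signs cancel for odd
n, each gap occurs once, and the gaps sum to 1. -/
theorem sum_simplexIntegral_cons_one (hΦ : Φ.HasContinuations) {n : ℕ} (hn : Odd n)
    {y : Fin (n + 1) → D.smooth} (hy : ∀ i, D.γHom (y i) = -y i) :
    ∑ j : Fin (n + 1), (-1 : ℂ) ^ (n * (j : ℕ)) *
      Φ.simplexIntegral (Fin.cons 1 fun i => y (j + i) : Fin (n + 2) → D.smooth) =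
      Φ.simplexIntegral y := by
  set P : Fin (n + 1) → Fin (n + 1) → ℂ := fun j i =>
    ∫ v in orderSimplex n, gap i v * Φ.tubeFn (fun l => y (j + l)) (cpt 0 v) with hP
  -- One rotation of the simplex lowers the shift of the entries and raises the index of the gap.
  have hstep : ∀ j i, P (j + 1) i = -P j (i + 1) := by
    intro j i
    change ∫ v in orderSimplex n, gap i v * Φ.tubeFn (fun l => y (j + 1 + l)) (cpt 0 v) =
      -∫ v in orderSimplex n, gap (i + 1) v * Φ.tubeFn (fun l => y (j + l)) (cpt 0 v)
    rw [← setIntegral_gap_rot i fun v => Φ.tubeFn (fun l => y (j + l)) (cpt 0 v), ← integral_neg]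
    refine setIntegral_congr_fun (measurableSet_orderSimplex n) fun u hu => ?_
    have := hΦ.tubeFn_rotate_odd (y := fun l => y (j + 1 + l)) (fun l => hy _) hu
    beta_reduce at this ⊢
    rw [this, hn.neg_one_pow]
    have e : ∀ l : Fin (n + 1), j + 1 + (l - 1) = j + l := fun l => by abel
    simp only [e]
    ring
  have hiter : ∀ j i, P j i = (-1) ^ (j : ℕ) * P 0 (i + j) := by
    intro j
    induction j using Fin.induction with
    | zero => intro i; simp
    | succ j ih =>
      intro i
      rw [← Fin.coeSucc_eq_succ, hstep, ih, Fin.coeSucc_eq_succ, ← Fin.coeSucc_eq_succ,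
        add_assoc, add_comm 1 j.castSucc, Fin.coeSucc_eq_succ, Fin.val_succ, Fin.val_castSucc,
        pow_succ]
      ring
  have hterm : ∀ j : Fin (n + 1), (-1 : ℂ) ^ (n * (j : ℕ)) *
      Φ.simplexIntegral (Fin.cons 1 fun i => y (j + i) : Fin (n + 2) → D.smooth) =
      P 0 (Fin.last n + j) := by
    intro j
    rw [hΦ.simplexIntegral_cons_one hn fun i => hy _]
    change _ * P j (Fin.last n) = _
    rw [hiter, pow_mul, hn.neg_one_pow, ← mul_assoc, ← mul_pow]
    simp
  simp only [hterm]
  refine (Equiv.sum_comp (Equiv.addLeft (Fin.last n)) (P 0)).trans ?_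
  rw [hP, sum_setIntegral_gap]
  · simp only [zero_add]
    rfl
  · simp only [zero_add]
    exact hΦ.continuousOn_cpt_zero y

/-- Invariance of the functional under `δ` for the entries `x_0, δ(x_1), ..., δ(x_n)`. -/
theorem tubeFn_entries_leibniz (hΦ : Φ.HasContinuations) {n : ℕ} (x : Fin (n + 1) → D.evenSmooth)
    {z : Fin n → ℂ} (hz : z ∈ tube n) :
    Φ.tubeFn (fun i => D.δLin (D.toSmooth (x i))) z + ∑ k : Fin n, (-1 : ℂ) ^ (k : ℕ) *
      Φ.tubeFn (Function.update (D.entries x) k.succ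
        (D.δLin (D.δLin (D.toSmooth (x k.succ))))) z = 0 := by
  rw [← hΦ.sum_tubeFn_leibniz (D.entries x) hz, Fin.sum_univ_succ]
  congr 1
  · congr 1
    ext1 i
    refine Fin.cases ?_ (fun j => ?_) i
    · simp [Superderivation.leibniz]
    · simp [Superderivation.leibniz, Fin.succ_ne_zero]
  · refine Finset.sum_congr rfl fun k _ => ?_
    -- To the left of position k + 1 stand the even x_0 and k odd entries, so γ contributes (-1)^k.
    have e : D.leibniz (D.entries x) k.succ =
        fun i => (Fin.cons 1 fun j => if j < k then -1 else 1 : Fin (n + 1) → ℂ) i •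
          Function.update (D.entries x) k.succ (D.δLin (D.δLin (D.toSmooth (x k.succ)))) i := by
      ext1 i
      refine Fin.cases ?_ (fun j => ?_) i
      · simp [Superderivation.leibniz, D.γHom_toSmooth, Function.update_of_ne (Fin.succ_ne_zero k).symm]
      · rcases lt_trichotomy j k with h | h | h
        · have h' : j.succ ≠ k.succ := fun e => h.ne (Fin.succ_injective _ e)
          simp [Superderivation.leibniz, h, Function.update_of_ne h', D.γHom_δLin_toSmooth]
        · subst h
          simp [Superderivation.leibniz]
        · have h' : j.succ ≠ k.succ := fun e => h.ne' (Fin.succ_injective _ e)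
          simp [Superderivation.leibniz, h.not_gt, h.ne']
    rw [e, hΦ.tubeFn_smul _ hz, Fin.prod_univ_succ, Fin.cons_zero, one_mul]
    simp only [Fin.cons_succ, prod_ite_lt_neg_one]

end HasContinuations

/-! ### Faces of the simplex and the Hochschild boundary -/

/-- The entries `x_0, δ(x_1), ..., x_{k+1}, ..., δ(x_n)`, without `δ` at position `k + 1`. -/
def entriesOmit (D : Superderivation N) {n : ℕ} (x : Fin (n + 2) → D.evenSmooth)
    (k : Fin (n + 1)) : Fin (n + 2) → D.smooth :=
  Function.update (D.entries x) k.succ (D.toSmooth (x k.succ))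

/-- The contribution of the lower face in direction `k`. -/
def lowerFace (Φ : SKMSFunctional D) {n : ℕ} (x : Fin (n + 2) → D.evenSmooth) (k : Fin (n + 1)) :
    ℂ :=
  ∫ v in orderSimplex n, Φ.tubeFn (entriesOmit D x k) (cpt 0 (Fin.insertNth k (lo v k) v))

/-- The contribution of the upper face in direction `k`. -/
def upperFace (Φ : SKMSFunctional D) {n : ℕ} (x : Fin (n + 2) → D.evenSmooth) (k : Fin (n + 1)) :
    ℂ :=
  ∫ v in orderSimplex n, Φ.tubeFn (entriesOmit D x k) (cpt 0 (Fin.insertNth k (hi v k) v))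

namespace HasContinuations

theorem integrableOn_face (hΦ : Φ.HasContinuations) {n : ℕ} (y : Fin (n + 2) → D.smooth)
    (k : Fin (n + 1)) {t : (Fin n → ℝ) → ℝ} (ht : Continuous t)
    (hlt : ∀ v ∈ orderSimplex n, t v ∈ Set.Icc (lo v k) (hi v k)) :
    IntegrableOn (fun v => Φ.tubeFn y (cpt 0 (Fin.insertNth k (t v) v))) (orderSimplex n) := by
  refine integrableOn_orderSimplex ((hΦ.continuousOn_cpt_zero y).comp
    (f := fun v => (Fin.insertNth k (t v) v : Fin (n + 1) → ℝ)) ?_ fun v hv => ?_)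
  · exact (Continuous.finInsertNth k ht (continuous_id' (X := Fin n → ℝ))).continuousOn
  · exact insertNth_mem_orderSimplex.2 ⟨hv, hlt v hv⟩

/-- Fubini with the k-th time innermost: δ² is its derivative, and only the two ends remain. -/
theorem simplexIntegral_update_δδ (hΦ : Φ.HasContinuations) {n : ℕ}
    (x : Fin (n + 2) → D.evenSmooth) (k : Fin (n + 1)) :
    Φ.simplexIntegral (Function.update (D.entries x) k.succ
        (D.δLin (D.δLin (D.toSmooth (x k.succ))))) = Φ.lowerFace x k - Φ.upperFace x k := by
  rw [simplexIntegral, setIntegral_orderSimplex_succ k (hΦ.integrableOn_tubeFn _), lowerFace,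
    upperFace, ← integral_sub
      (hΦ.integrableOn_face _ k (continuous_lo k) fun v hv => ⟨le_rfl, lo_le_hi hv k⟩)
      (hΦ.integrableOn_face _ k (continuous_hi k) fun v hv => ⟨lo_le_hi hv k, le_rfl⟩)]
  refine setIntegral_congr_fun (measurableSet_orderSimplex n) fun v hv => ?_
  have := hΦ.intervalIntegral_tubeFn (entriesOmit D x k) k hv
  simp only [entriesOmit, Function.update_self, Function.update_idem] at this
  exact this

/-- The invariance identity `tubeFn_entries_leibniz`, integrated over the simplex. -/
theorem simplexIntegral_δ_entries (hΦ : Φ.HasContinuations) {n : ℕ}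
    (x : Fin (n + 2) → D.evenSmooth) :
    Φ.simplexIntegral (fun i => D.δLin (D.toSmooth (x i))) +
      ∑ k : Fin (n + 1), (-1 : ℂ) ^ (k : ℕ) * (Φ.lowerFace x k - Φ.upperFace x k) = 0 := by
  simp only [← hΦ.simplexIntegral_update_δδ, simplexIntegral, ← integral_const_mul]
  rw [← integral_finsetSum _ fun k _ => (hΦ.integrableOn_tubeFn _).const_mul _,
    ← integral_add (hΦ.integrableOn_tubeFn _)
      (integrable_finsetSum _ fun k _ => (hΦ.integrableOn_tubeFn _).const_mul _)]
  rw [setIntegral_congr_fun (measurableSet_orderSimplex _) (g := fun _ => (0 : ℂ)) fun u hu =>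
    hΦ.tubeFn_entries_leibniz x (cpt_mem_tube.2 hu)]
  simp

theorem simplexIntegral_contractNth (hΦ : Φ.HasContinuations) {n : ℕ}
    (y : Fin (n + 2) → D.smooth) (k : Fin (n + 1)) :
    Φ.simplexIntegral (Fin.contractNth k.castSucc (· * ·) y) =
      ∫ v in orderSimplex n, Φ.tubeFn y (cpt 0 (Fin.insertNth k (lo v k) v)) := by
  refine setIntegral_congr_fun (measurableSet_orderSimplex n) fun v hv => ?_
  rw [hΦ.tubeFn_contractNth y k (cpt_mem_tube.2 hv), cpt_zero_insertNth, loC_cpt_zero]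

theorem simplexIntegral_entries_contract_zero (hΦ : Φ.HasContinuations) {n : ℕ}
    (x : Fin (n + 2) → D.evenSmooth) :
    Φ.simplexIntegral (D.entries (Fin.contractNth (0 : Fin (n + 1)).castSucc (· * ·) x)) =
      Φ.lowerFace x 0 := by
  rw [lowerFace, ← hΦ.simplexIntegral_contractNth]
  congr 1
  ext1 i
  refine Fin.cases ?_ (fun j => ?_) i
  · rw [D.entries_zero, Fin.contractNth_apply_of_eq _ _ _ _ rfl,
      Fin.contractNth_apply_of_eq _ _ _ _ rfl, D.toSmooth_mul]
    simp [entriesOmit, Function.update_of_ne]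
  · have hj : j.succ.succ ≠ (0 : Fin (n + 1)).succ := by simp [Fin.ext_iff]
    rw [D.entries_succ, Fin.contractNth_apply_of_gt _ _ _ _ (by simp),
      Fin.contractNth_apply_of_gt _ _ _ _ (by simp), entriesOmit, Function.update_of_ne hj,
      D.entries_succ]

/-- The face where two adjacent times coincide is both a lower and an upper one. The two terms of
δ(xy) = δ(x)y + xδ(y), for even x, omit δ at one or the other of the two positions. -/
theorem simplexIntegral_entries_contract_succ (hΦ : Φ.HasContinuations) {n : ℕ}
    (x : Fin (n + 2) → D.evenSmooth) (i : Fin n) :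
    Φ.simplexIntegral (D.entries (Fin.contractNth i.succ.castSucc (· * ·) x)) =
      Φ.lowerFace x i.succ + Φ.upperFace x i.castSucc := by
  have hup : Φ.upperFace x i.castSucc =
      Φ.simplexIntegral (Fin.contractNth i.succ.castSucc (· * ·) (entriesOmit D x i.castSucc)) := by
    rw [hΦ.simplexIntegral_contractNth, upperFace]
    simp only [hi_castSucc, lo_succ, insertNth_succ_eq]
  set W := D.entries (Fin.contractNth i.succ.castSucc (· * ·) x) with hW
  -- After contraction the omitted δ is visible in the merged entry alone; all other entries agree
  -- with `W`.
  have key : ∀ k : Fin (n + 1), k = i.succ ∨ k = i.castSucc →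
      Fin.contractNth i.succ.castSucc (· * ·) (entriesOmit D x k) =
      Function.update W i.succ
        (entriesOmit D x k i.succ.castSucc * entriesOmit D x k i.succ.succ) := by
    intro k hk
    have hne : ∀ l : Fin (n + 2), (l : ℕ) ≠ i + 1 → (l : ℕ) ≠ i + 2 → l ≠ k.succ := by
      rintro l h1 h2 rfl
      rcases hk with rfl | rfl <;> simp at h1 h2
    ext1 j
    rcases lt_trichotomy (j : ℕ) i.succ with h | h | h
    · have h' : j ≠ i.succ := fun e => h.ne (congrArg Fin.val e)
      rw [Fin.val_succ] at h
      rw [Function.update_of_ne h', Fin.contractNth_apply_of_lt _ _ _ _ (by simpa using h),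
        entriesOmit, Function.update_of_ne (hne _ (by simp; omega) (by simp; omega)), hW]
      rcases Fin.eq_zero_or_eq_succ j with rfl | ⟨l, rfl⟩
      · rw [Fin.castSucc_zero, D.entries_zero, D.entries_zero,
          Fin.contractNth_apply_of_lt _ _ _ _ (by simp)]
        rfl
      · rw [D.entries_succ, Fin.contractNth_apply_of_lt _ _ _ _ (by simpa using h),
          D.entries_of_ne_zero _ (by simp [Fin.ext_iff])]
    · have h' : j = i.succ := Fin.ext h
      subst h'
      rw [Function.update_self, Fin.contractNth_apply_of_eq _ _ _ _ rfl]
    · have h' : j ≠ i.succ := fun e => h.ne' (congrArg Fin.val e)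
      rw [Fin.val_succ] at h
      obtain ⟨l, rfl⟩ := Fin.exists_succ_eq.2 (show j ≠ 0 by rintro rfl; simp at h)
      rw [Function.update_of_ne h', Fin.contractNth_apply_of_gt _ _ _ _ (by simpa using h),
        entriesOmit, Function.update_of_ne (hne _ (by simp at h ⊢; omega) (by simp at h ⊢; omega)),
        hW, D.entries_succ, D.entries_succ, Fin.contractNth_apply_of_gt _ _ _ _ (by simpa using h)]
  rw [hup, lowerFace, ← hΦ.simplexIntegral_contractNth, key _ (Or.inl rfl), key _ (Or.inr rfl),
    ← hΦ.simplexIntegral_update_add]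
  congr 1
  have h2 : i.succ.succ ≠ i.castSucc.succ := fun e => by simp [Fin.ext_iff] at e
  rw [eq_comm, Function.update_eq_self_iff, hW, D.entries_succ,
    Fin.contractNth_apply_of_eq _ _ _ _ rfl, D.δLin_toSmooth_mul]
  simp only [entriesOmit, Function.update_self, Function.update_of_ne h2,
    Function.update_of_ne h2.symm,
    ← Fin.succ_castSucc, D.entries_succ]

/-- On the face where the last time is 1, the KMS property brings the last entry to the front; the n
odd entries each change sign under γ, which is harmless for even n. -/
theorem simplexIntegral_entries_last (hΦ : Φ.HasContinuations) {n : ℕ} (hn : Even n)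
    (x : Fin (n + 2) → D.evenSmooth) :
    Φ.simplexIntegral (D.entries (Fin.cons (x (Fin.last (n + 1)) * x 0)
      fun i : Fin n => x i.succ.castSucc)) = Φ.upperFace x (Fin.last n) := by
  refine setIntegral_congr_fun (measurableSet_orderSimplex n) fun v hv => ?_
  have hz := cpt_mem_tube_of hv 0
  have h := hΦ.tubeFn_last_face (entriesOmit D x (Fin.last n)) hz
  rw [hi_last, cpt_zero_insertNth, Complex.ofReal_one, one_mul, ← h]
  have e : (Fin.cons (entriesOmit D x (Fin.last n) (Fin.last (n + 1)) *
      D.γHom (entriesOmit D x (Fin.last n) 0))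
      fun i : Fin n => D.γHom (entriesOmit D x (Fin.last n) i.succ.castSucc)) =
      fun i => (Fin.cons 1 fun _ => -1 : Fin (n + 1) → ℂ) i •
        D.entries (Fin.cons (x (Fin.last (n + 1)) * x 0) fun i : Fin n => x i.succ.castSucc) i := by
    ext1 i
    refine Fin.cases ?_ (fun j => ?_) i
    · simp [entriesOmit, D.toSmooth_mul, D.γHom_toSmooth, ← Fin.succ_last,
        Function.update_of_ne (Fin.succ_ne_zero _).symm]
    · simp [entriesOmit, D.γHom_δLin_toSmooth]
  rw [e, hΦ.tubeFn_smul _ hz, Fin.prod_univ_succ]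
  simp [hn.neg_one_pow]

theorem closed (hΦ : Φ.HasContinuations) (n : ℕ) (x : Fin (n + 1) → D.evenSmooth) :
    connesB hΦ.jloCochain n x + hochschildB hΦ.jloCochain n x = 0 := by
  rcases Nat.even_or_odd n with hn | hn
  -- In even degree both operators involve odd components only, and these vanish.
  · have h1 : connesB hΦ.jloCochain n x = 0 := by
      refine Finset.sum_eq_zero fun j _ => ?_
      rw [hΦ.jloCochain_of_odd (Nat.not_even_iff_odd.2 hn.add_one), zero_apply, mul_zero]
    rw [h1, zero_add]
    cases n with
    | zero => rfl
    | succ m =>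
      have hm : ¬ Even m := by rwa [Nat.even_add_one] at hn
      simp [hochschildB, hΦ.jloCochain_of_odd hm]
  · obtain ⟨m, rfl⟩ : ∃ m, n = m + 1 := ⟨n - 1, by have := hn.pos; omega⟩
    have hm : Even m := by
      rw [← Nat.not_odd_iff_even]
      exact fun h => (Nat.not_even_iff_odd.2 hn) h.add_one
    have hB : connesB hΦ.jloCochain (m + 1) x =
        Φ.simplexIntegral (fun i => D.δLin (D.toSmooth (x i))) := by
      rw [← hΦ.sum_simplexIntegral_cons_one hn fun i => D.γHom_δLin_toSmooth (x i)]
      refine Finset.sum_congr rfl fun j _ => ?_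
      rw [hΦ.jloCochain_of_even hn.add_one]
      congr 2
      ext1 i
      refine Fin.cases ?_ (fun l => ?_) i
      · simp [D.toSmooth_one]
      · simp
    -- The contraction at i + 1 carries (-1)^{i+1}: this matches the lower face in direction i + 1
    -- and is minus the sign of the upper face in direction i. Contraction at 0 and the cyclic term
    -- supply the two outer faces.
    have hb : hochschildB hΦ.jloCochain (m + 1) x =
        ∑ k : Fin (m + 1), (-1 : ℂ) ^ (k : ℕ) * (Φ.lowerFace x k - Φ.upperFace x k) := by
      simp only [hochschildB, hΦ.jloCochain_of_even hm]
      rw [hΦ.simplexIntegral_entries_last hm, Fin.sum_univ_succ,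
        hΦ.simplexIntegral_entries_contract_zero]
      simp only [hΦ.simplexIntegral_entries_contract_succ, mul_sub, mul_add,
        Finset.sum_sub_distrib, Finset.sum_add_distrib]
      rw [Fin.sum_univ_succ (fun k : Fin (m + 1) => (-1 : ℂ) ^ (k : ℕ) * Φ.lowerFace x k),
        Fin.sum_univ_castSucc (fun k : Fin (m + 1) => (-1 : ℂ) ^ (k : ℕ) * Φ.upperFace x k)]
      simp only [Fin.val_succ, Fin.val_castSucc, pow_succ, mul_neg, mul_one, neg_mul,
        Finset.sum_neg_distrib, Fin.val_last]
      ring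
    rw [hB, hb, hΦ.simplexIntegral_δ_entries]

end HasContinuations

end SKMSFunctional

end Cocycle

theorem theorem3p2 {H : Type*} [NormedAddCommGroup H] [InnerProductSpace ℂ H] [CompleteSpace H]
    [TopologicalSpace.SeparableSpace H] (hH : ¬ FiniteDimensional ℂ H)
    (N : GradedNet H) (D : Superderivation N) (Φ : SKMSFunctional D)
    (C₁ C₂ : ℝ) (hC₁ : 0 < C₁) (hC₂ : 0 < C₂) (hΦ : Φ.LocallyExpBounded C₁ C₂) :
    -- the expression for `τ_n` is well defined
    (∀ (n : ℕ) (x : Fin (n + 1) → D.evenSmooth), Even n →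
      (∀ t : ℝ, IntegrableOn (Φ.jloIntegrand x t) (orderSimplex n)) ∧
      (∃ F : ℂ → ℂ, IsStripContinuation (Φ.jloIntegral x) F) ∧
      (∀ F G : ℂ → ℂ, IsStripContinuation (Φ.jloIntegral x) F →
        IsStripContinuation (Φ.jloIntegral x) G → Set.EqOn F G strip)) ∧
    -- it is an even local-entire cyclic cocycle for the graph norm
    (∃ τ : Cochain D.evenSmooth,
      (∀ (n : ℕ) (x : Fin (n + 1) → D.evenSmooth), τ n x = Φ.jlo n x) ∧
      IsEvenCochain τ ∧ IsLocalEntireCyclicCocycle N D.graphNorm τ) ∧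
    -- multi-point functions continue uniquely to the tube, with exponential bounds
    (∀ (I : BddInterval) (n : ℕ) (x : Fin (n + 1) → Φ.dom),
      (∀ i, (x i : H →L[ℂ] H) ∈ N.alg I) →
      (∃ F : (Fin n → ℂ) → ℂ, IsTubeContinuation (Φ.multiPoint x) F) ∧
      (∀ F G : (Fin n → ℂ) → ℂ, IsTubeContinuation (Φ.multiPoint x) F →
        IsTubeContinuation (Φ.multiPoint x) G → Set.EqOn F G (tube n)) ∧
      (∀ F : (Fin n → ℂ) → ℂ, IsTubeContinuation (Φ.multiPoint x) F → ∀ z ∈ tube n,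
        ‖F z‖ ≤ C₁ * Real.exp (2 * C₂ * (I.radius + 1) ^ 2 * (n + 1)) *
          Real.exp (2 * C₂ * (I.radius + 1) * ∑ k, ‖z k‖ ^ 2) *
          ∏ i, ‖(x i : H →L[ℂ] H)‖)) := by
  have hcont := Φ.hasContinuations hC₁ hC₂ hΦ
  refine ⟨fun n x _ => ⟨hcont.integrableOn_jloIntegrand x,
      ⟨_, hcont.isStripContinuation_jloIntegral x⟩, fun F G hF hG => hF.eqOn hG⟩,
    ⟨hcont.jloCochain, hcont.jloCochain_apply, hcont.isEvenCochain_jloCochain,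
      ⟨⟨hcont.jloCochain_normalized, Φ.jloCochain_entire hC₁ hC₂ hΦ⟩, hcont.closed⟩⟩,
    fun I n x hx => ?_⟩
  obtain ⟨F, hF, hv, hb⟩ := Φ.exists_tubeHolo hC₁ hC₂ hΦ hx
  have hFc : IsTubeContinuation (Φ.multiPoint x) F := hF.isTubeContinuation fun s => by
    rw [← cpt_zero, ← vtx_last, hv, Φ.vertexFn_last]
  refine ⟨⟨F, hFc⟩, fun F G hF hG => hF.eqOn hG, fun G hG z hz => ?_⟩
  rw [hG.eqOn hFc hz]
  exact hb z hz

end
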